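/- Let $\alpha>0$. For $x=(x_1,x_2)\in\mathbb R^2$ put $x^\perp=(-x_2,x_1)$ and let $$K^\alpha(x)=\frac{x^\perp}{|x|}\,D\Psi^\alpha(|x|),\qquad D\Psi^\alpha(r)=\frac1{2\pi}\Big[-\frac1\alpha K_1\Big(\frac r\alpha\Big)+\frac1r\Big],\qquad K^\alpha(0)=0,$$ where $K_1$ is the modified Bessel function of the second kind of order one. The Birkhoff-Rott-$\alpha$ (BR-$\alpha$) equation for a curve $x(\Gamma,t)\in\mathbb R^2$ is $$\frac{\partial x}{\partial t}(\Gamma,t)=\int K^\alpha\big(x(\Gamma,t)-x(\Gamma',t)\big)\,d\Gamma',\qquad x(\Gamma,0)=x_0(\Gamma),$$ the integral being over the parameter domain of the curve. This domain is either an interval $(\Gamma_0,\Gamma_1)$ with $-\infty<\Gamma_0<\Gamma_1<\infty$, or, for closed curves, $S^1=\mathbb R/2\pi\mathbb Z$. The chord-arc constant is $$|x|_*=\inf_{\Gamma\ne\Gamma'}\frac{|x(\Gamma)-x(\Gamma')|}{|\Gamma-\Gamma'|},$$ where on $S^1$ the condition is $\Gamma\neq\Gamma'$ mod $2\pi$ and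 $|\Gamma-\Gamma'|$ is the distance on the circle. For $0<\beta\le 1$, $C^{n,\beta}$ is the space of $n$ times continuously differentiable curves with finite norm $$\sum_{k\le n}\sup|x^{(k)}|+\sup_{\Gamma\ne\Gamma'}|x^{(n)}(\Gamma)-x^{(n)}(\Gamma')|\,|\Gamma-\Gamma'|^{-\beta}.$$ Moreover $C^{n,0}=C^n$ (with bounded derivatives up to order $n$ and the corresponding sup norm), and $\mathrm{Lip}=C^{0,1}$. (i) Let $V$ be $C^{1,\beta}((\Gamma_0,\Gamma_1))$ with $0\le\beta<1$, or $\mathrm{Lip}((\Gamma_0,\Gamma_1))$, and let $x_0\in V\cap\{|x|_*>0\}$. Then for every $T>0$ there is a unique solution $x\in C^1([-T,T];V\cap\{|x|_*>0\})$ of the BR-$\alpha$ equation with initial value $x_0$. (ii) Let $n\ge1$, $0<\beta<1$ and $x_0\in C^{n,\beta}(S^1)\cap\{|x|_*>0\}$. Then for every $T>0$ there is a unique solution $x\in C^1([-T,T];C^{n,\beta}(S^1)\cap\{|x|_*>0\})$ of the BR-$\alpha$ equation with initial value $x_0$. (iii) In particular, if $x_0\in C^\infty(S^1)\cap\{|x|_*>0\}$,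 then for every $T>0$ there is a single curve $x$ which is the solution in (ii) for all $n\ge1$ and all $0<\beta<1$, and $x\in C^1([-T,T];C^\infty(S^1)\cap\{|x|_*>0\})$, where $C^\infty(S^1)$ carries its Fréchet topology (uniform convergence of every derivative). -/

import Mathlib

open Set Filter Topology MeasureTheory Real
open scoped ENNReal NNReal

noncomputable section

namespace BRAlpha

/-- The plane, with its Euclidean norm. -/
abbrev Plane : Type := EuclideanSpace ℝ (Fin 2)

/-! ### The smoothed Biot–Savart kernel -/

/-- The modified Bessel function of the second kind of order `ν`, for `z > 0`:
`K_ν(z) = ∫_0^∞ exp(-z cosh s) cosh(ν s) ds`. -/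
def besselK (ν z : ℝ) : ℝ :=
  ∫ s in Ioi (0 : ℝ), Real.exp (-z * Real.cosh s) * Real.cosh (ν * s)

/-- `DΨ^α(r) = (1/2π) [-(1/α) K₁(r/α) + 1/r]`, the derivative of
`Ψ^α(r) = (1/2π) [K₀(r/α) + log r]`. -/
def DPsi (α r : ℝ) : ℝ :=
  1 / (2 * π) * (-(1 / α) * besselK 1 (r / α) + 1 / r)

/-- `x^⊥ = (-x₂, x₁)`. -/
def perp (x : Plane) : Plane := !₂[-(x 1), x 0]

/-- The kernel `K^α(x) = ∇^⊥ Ψ^α(|x|) = (x^⊥ / |x|) DΨ^α(|x|)`; the formula gives the value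
`0` at `x = 0`, which is the continuous extension. -/
def kernel (α : ℝ) (x : Plane) : Plane :=
  (DPsi α ‖x‖ / ‖x‖) • perp x

/-! ### Spaces of curves

Curves are functions `ℝ → Plane`; on an open set `J` of parameters only the values on `J` matter. -/

/-- `∑_{k ≤ n} sup_J |d^k x / dΓ^k|`. -/
def cNorm (n : ℕ) (J : Set ℝ) (x : ℝ → Plane) : ℝ≥0∞ :=
  ∑ k ∈ Finset.range (n + 1), ⨆ Γ ∈ J, ‖iteratedDerivWithin k x J Γ‖ₑ

/-- The norm of `C^{n,β}(J)`: the `C^n` norm plus the `β`-Hölder seminorm on `J` of the `n`-th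
derivative. For `β = 0` the last term is the oscillation of the `n`-th derivative, at most twice
its supremum, so that the norm is then equivalent to the `C^n` norm. -/
def holderNorm (n : ℕ) (β : ℝ≥0) (J : Set ℝ) (x : ℝ → Plane) : ℝ≥0∞ :=
  cNorm n J x + eHolderNorm β (J.domRestrict (iteratedDerivWithin n x J))

/-- `C^{n,β}(J)` for an open set `J`: `n` times continuously differentiable on `J`, with finite
norm. In particular `C^{n,0}(J)` is `C^n(J)` and `C^{0,1}(J)` is `Lip(J)`. -/
def holderSpace (n : ℕ) (β : ℝ≥0) (J : Set ℝ) : Set (ℝ → Plane) :=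
  {x | ContDiffOn ℝ n x J ∧ holderNorm n β J x < ⊤}

/-- `C^{n,β}(S¹)`, `S¹ = ℝ/2πℤ`: the `2π`-periodic functions in `C^{n,β}(ℝ)`. (For a periodic
function, the Hölder quotients with `|Γ - Γ'|` and with the distance on the circle have the same
supremum.) -/
def holderSpaceCircle (n : ℕ) (β : ℝ≥0) : Set (ℝ → Plane) :=
  {x | Function.Periodic x (2 * π) ∧ x ∈ holderSpace n β univ}

/-- `C^∞(S¹)`; its topology is given by the family of the norms `cNorm k univ`, `k : ℕ`. -/
def smoothSpaceCircle : Set (ℝ → Plane) :=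
  {x | Function.Periodic x (2 * π) ∧ ContDiff ℝ ((⊤ : ℕ∞) : WithTop ℕ∞) x}

/-- The chord-arc constant `|x|_*` of a curve parametrized by `J`. -/
def chordArc (J : Set ℝ) (x : ℝ → Plane) : ℝ≥0∞ :=
  ⨅ (Γ ∈ J) (Γ' ∈ J) (_ : Γ ≠ Γ'), edist (x Γ) (x Γ') / edist Γ Γ'

/-- The chord-arc constant `|x|_*` of a closed curve parametrized by `S¹ = ℝ/2πℤ`: the infimum is
over `Γ ≠ Γ' mod 2π`, and the denominator is the distance on the circle. -/
def chordArcCircle (x : ℝ → Plane) : ℝ≥0∞ :=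
  ⨅ (Γ : ℝ) (Γ' : ℝ) (_ : (Γ : AddCircle (2 * π)) ≠ (Γ' : AddCircle (2 * π))),
    edist (x Γ) (x Γ') / edist (Γ : AddCircle (2 * π)) (Γ' : AddCircle (2 * π))

/-! ### Solutions -/

/-- `x ∈ C^1(I; V)`, where the topology of the function space `V` is given by the family of
(semi)norms `N i`: the values lie in `V`, and there is `v : I → V` that is the limit in `V` of the
difference quotients of `x` at every `t ∈ I` (one-sided at end points of `I`) and is continuous
into `V`. -/
def IsC1Into {ι : Type} (V : Set (ℝ → Plane)) (N : ι → (ℝ → Plane) → ℝ≥0∞) (I : Set ℝ)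
    (x : ℝ → ℝ → Plane) : Prop :=
  (∀ t ∈ I, x t ∈ V) ∧
  ∃ v : ℝ → ℝ → Plane, (∀ t ∈ I, v t ∈ V) ∧
    ∀ t ∈ I, ∀ i,
      Tendsto (fun s => N i (fun Γ => (s - t)⁻¹ • (x s Γ - x t Γ) - v t Γ))
        (𝓝[I \ {t}] t) (𝓝 0) ∧
      Tendsto (fun s => N i (fun Γ => v s Γ - v t Γ)) (𝓝[I] t) (𝓝 0)

/-- `x` solves `∂x/∂t (Γ,t) = ∫_D K^α(x(Γ,t) - x(Γ',t)) dΓ'` for `t ∈ [-T,T]` and `Γ ∈ J`, and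
`x(Γ,0) = x₀(Γ)` for `Γ ∈ J`. (For closed curves `J = ℝ` and `D = (0, 2π)`.) -/
def SolvesBR (α T : ℝ) (J D : Set ℝ) (x₀ : ℝ → Plane) (x : ℝ → ℝ → Plane) : Prop :=
  (∀ t ∈ Icc (-T) T, ∀ Γ ∈ J,
    HasDerivWithinAt (fun s => x s Γ) (∫ Γ' in D, kernel α (x t Γ - x t Γ')) (Icc (-T) T) t) ∧
  EqOn (x 0) x₀ J

/-- `x ∈ C^1([-T,T]; C^{n,β}((Γ₀,Γ₁)) ∩ {|x|_* > 0})` is a solution with initial value `x₀`. -/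
def IsSolution (α Γ₀ Γ₁ : ℝ) (n : ℕ) (β : ℝ≥0) (T : ℝ) (x₀ : ℝ → Plane)
    (x : ℝ → ℝ → Plane) : Prop :=
  IsC1Into (holderSpace n β (Ioo Γ₀ Γ₁)) (fun _ : Unit => holderNorm n β (Ioo Γ₀ Γ₁))
    (Icc (-T) T) x ∧
  (∀ t ∈ Icc (-T) T, 0 < chordArc (Ioo Γ₀ Γ₁) (x t)) ∧
  SolvesBR α T (Ioo Γ₀ Γ₁) (Ioo Γ₀ Γ₁) x₀ x

/-- `x ∈ C^1([-T,T]; C^{n,β}(S¹) ∩ {|x|_* > 0})` is a solution with initial value `x₀`. -/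
def IsClosedSolution (α : ℝ) (n : ℕ) (β : ℝ≥0) (T : ℝ) (x₀ : ℝ → Plane)
    (x : ℝ → ℝ → Plane) : Prop :=
  IsC1Into (holderSpaceCircle n β) (fun _ : Unit => holderNorm n β univ) (Icc (-T) T) x ∧
  (∀ t ∈ Icc (-T) T, 0 < chordArcCircle (x t)) ∧
  SolvesBR α T univ (Ioo 0 (2 * π)) x₀ x

/-- `x ∈ C^1([-T,T]; C^∞(S¹) ∩ {|x|_* > 0})` is a solution with initial value `x₀`. -/
def IsSmoothClosedSolution (α : ℝ) (T : ℝ) (x₀ : ℝ → Plane) (x : ℝ → ℝ → Plane) : Prop :=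
  IsC1Into smoothSpaceCircle (fun k : ℕ => cNorm k univ) (Icc (-T) T) x ∧
  (∀ t ∈ Icc (-T) T, 0 < chordArcCircle (x t)) ∧
  SolvesBR α T univ (Ioo 0 (2 * π)) x₀ x

end BRAlpha

end

/-! Kernel. In `DΨ^α` the `1/r` singularities cancel, and the radial factor `DΨ^α(r)/r` of the
kernel is a Laplace transform with an explicit positive density (`profile_zero_eq`). Hence its
`k`-th derivative is `O(r^(-k-ε))` and the factor itself is at most logarithmic at the origin. So
`K^α` is bounded and log-Lipschitz: `|K(X) - K(Y)| ≤ C |X - Y| (1 + log⁺(1/|X|))`, with the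
logarithm on either one of the two arguments.

Flow. For any continuous curve, the difference `ξ` of two of its points satisfies `|ξ'| ≤ C |ξ| (1 +
|log |ξ||)`, so `|log |ξ||` obeys a linear Grönwall inequality (`log_gronwall`). Points never
collide, and since the initial curve is chord-arc, `∫ |log |x(Γ) - x(Γ')|| dΓ'` stays bounded. With
this integral under control the logarithm integrates out: the velocity is Lipschitz along the curve,
so the curve stays bi-Lipschitz to the initial one and the chord-arc constant survives; and the
velocity is Lipschitz in the curve for the sup norm, which gives uniqueness and the convergence of
the flows of truncated kernels (`exists_isFlow`). Every bound is a linear Grönwall bound, so `T` is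
arbitrary.

One derivative. The velocity at `Γ` depends on `Γ` only through the point `z(Γ)`, so `p = ∂z/∂Γ`
should solve, for each `Γ` separately, the linear equation `p' = M p` with `M(Γ) = ∫ DK(z(Γ) -
z(Γ')) dΓ'`. This `M` is Hölder of every exponent below one, which yields `C^{1,β}` for `β < 1`
(`exists_spatialDeriv`, `SpatialDeriv.tReg`). The Lipschitz class is treated directly
(`CurveFlow.tReg_zero`).

Closed curves. Over a full period `∫ DK(z(Γ) - z(Γ')) p(Γ') dΓ' = 0`, since the integrand is a total
derivative. Hence `M p = ∫ DK(z(Γ) - z(Γ')) (p(Γ) - p(Γ')) dΓ'`: the pair `(z, p)` again moves by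
convolution with a kernel, `tangentKernel K`, which is singular only where the first component
vanishes and still has order one. The class `CurveFlow` is thus stable under `z ↦ (z, ∂z)`, and
induction gives all derivatives. For this reason kernels are treated as symbols on a general space
`E` with a projection to the plane. On an interval boundary terms would remain.

Throughout, the velocity is Hölder in time with values in the relevant class, which gives `C^1` in
time. Uniqueness uses only continuity in `Γ`, so the same curve serves for all `n` and `β`, and
hence in the smooth case. -/

noncomputable section

namespace BRAlpha

/-! ### Differential inequalities -/

section Gronwall

variable {E : Type*} [NormedAddCommGroup E] [NormedSpace ℝ E]

/-- Grönwall's inequality for the supremum of a family of curves, forward in time. -/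
theorem sup_gronwall_right {ι : Type*} {f f' : ι → ℝ → E} {T K ε δ B : ℝ} (hT : 0 ≤ T)
    (hK : 0 ≤ K) (hε : 0 ≤ ε)
    (hd : ∀ i, ∀ t ∈ Icc 0 T, HasDerivWithinAt (f i) (f' i t) (Icc 0 T) t)
    (hB : ∀ i, ∀ t ∈ Icc 0 T, ‖f i t‖ ≤ B) (h0 : ∀ i, ‖f i 0‖ ≤ δ)
    (hb : ∀ t ∈ Icc 0 T, ∀ m, (∀ j, ‖f j t‖ ≤ m) → ∀ i, ‖f' i t‖ ≤ K * m + ε) :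
    ∀ i, ∀ t ∈ Icc 0 T, ‖f i t‖ ≤ 2 * (δ + ε * T) * exp (2 * K * T) := by
  intro i₀ t₀ ht₀
  -- The supremum over the family need not be continuous in time, so a weighted supremum `M` over
  -- indices and times replaces the usual comparison. With the weight `exp (-(2 * K * t))` the
  -- growth term contributes at most `M / 2` and is absorbed, hence the factor 2 in the result; `B`
  -- only makes `M` finite.
  set S : Set ℝ := {r | ∃ i, ∃ t ∈ Icc 0 T, r = ‖f i t‖ * exp (-(2 * K * t))} with hS
  have hSb : BddAbove S := by
    refine ⟨B, ?_⟩
    rintro r ⟨i, t, ht, rfl⟩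
    have h1 : exp (-(2 * K * t)) ≤ 1 := by
      apply exp_le_one_iff.2
      have := mul_nonneg hK ht.1
      linarith
    calc ‖f i t‖ * exp (-(2 * K * t)) ≤ ‖f i t‖ * 1 := by gcongr
      _ ≤ B := by rw [mul_one]; exact hB i t ht
  have hSne : S.Nonempty := ⟨_, i₀, t₀, ht₀, rfl⟩
  set M := sSup S with hM
  have hfM : ∀ i, ∀ t ∈ Icc 0 T, ‖f i t‖ ≤ M * exp (2 * K * t) := by
    intro i t ht
    have : ‖f i t‖ * exp (-(2 * K * t)) ≤ M := le_csSup hSb ⟨i, t, ht, rfl⟩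
    rw [exp_neg, ← div_eq_mul_inv, div_le_iff₀ (exp_pos _)] at this
    exact this
  have hM0 : 0 ≤ M := by
    have := hfM i₀ 0 ⟨le_rfl, hT⟩
    simp only [mul_zero, exp_zero, mul_one] at this
    exact (norm_nonneg _).trans this
  have hδ : 0 ≤ δ := (norm_nonneg _).trans (h0 i₀)
  have key : ∀ i, ∀ t ∈ Icc 0 T, ‖f i t‖ ≤ δ + M * (exp (2 * K * t) - 1) / 2 + ε * t := by
    intro i
    refine image_norm_le_of_norm_deriv_right_le_deriv_boundary (f' := f' i)
      (B := fun t => δ + M * (exp (2 * K * t) - 1) / 2 + ε * t)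
      (B' := fun t => K * (M * exp (2 * K * t)) + ε)
      (fun t ht => (hd i t ht).continuousWithinAt) ?_ ?_ ?_ ?_
    · intro t ht
      exact (hd i t ⟨ht.1, ht.2.le⟩).mono_of_mem_nhdsWithin
        (mem_of_superset (Icc_mem_nhdsGE ht.2) (Icc_subset_Icc_left ht.1))
    · simpa using h0 i
    · intro t
      have h1 : HasDerivAt (fun t : ℝ => exp (2 * K * t)) (exp (2 * K * t) * (2 * K)) t := by
        simpa using ((hasDerivAt_id t).const_mul (2 * K)).exp
      have h2 := ((((h1.sub_const 1).const_mul M).div_const 2).const_add δ).add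
        ((hasDerivAt_id t).const_mul ε)
      refine h2.congr_deriv ?_
      ring
    · intro t ht
      exact hb t ⟨ht.1, ht.2.le⟩ _ (fun j => hfM j t ⟨ht.1, ht.2.le⟩) i
  have hM2 : M ≤ δ + ε * T + M / 2 := by
    apply csSup_le hSne
    rintro r ⟨i, t, ht, rfl⟩
    have h1 := key i t ht
    have h3 : (1 : ℝ) ≤ exp (2 * K * t) := one_le_exp (by have := mul_nonneg hK ht.1; linarith)
    rw [exp_neg, ← div_eq_mul_inv, div_le_iff₀ (exp_pos _)]
    have h4 : ε * t ≤ ε * T := by gcongr; exact ht.2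
    have h5 : (δ + ε * T) * 1 ≤ (δ + ε * T) * exp (2 * K * t) := by
      have : 0 ≤ ε * T := by positivity
      gcongr
    nlinarith
  have hM3 : M ≤ 2 * (δ + ε * T) := by linarith
  calc ‖f i₀ t₀‖ ≤ M * exp (2 * K * t₀) := hfM _ _ ht₀
    _ ≤ 2 * (δ + ε * T) * exp (2 * K * T) := by
      have : exp (2 * K * t₀) ≤ exp (2 * K * T) := by gcongr; exact ht₀.2
      have := exp_pos (2 * K * t₀)
      gcongr

/-- Grönwall's inequality for the supremum of a family of curves, from an arbitrary base time. -/
theorem sup_gronwall {ι : Type*} {f f' : ι → ℝ → E} {T K ε δ B t₀ : ℝ}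
    (ht₀ : t₀ ∈ Icc (-T) T) (hK : 0 ≤ K) (hε : 0 ≤ ε)
    (hd : ∀ i, ∀ t ∈ Icc (-T) T, HasDerivWithinAt (f i) (f' i t) (Icc (-T) T) t)
    (hB : ∀ i, ∀ t ∈ Icc (-T) T, ‖f i t‖ ≤ B) (h0 : ∀ i, ‖f i t₀‖ ≤ δ)
    (hb : ∀ t ∈ Icc (-T) T, ∀ m, (∀ j, ‖f j t‖ ≤ m) → ∀ i, ‖f' i t‖ ≤ K * m + ε) :
    ∀ i, ∀ t ∈ Icc (-T) T, ‖f i t‖ ≤ 2 * (δ + ε * (2 * T)) * exp (2 * K * (2 * T)) := by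
  intro i t ht
  have hδ : 0 ≤ δ := (norm_nonneg _).trans (h0 i)
  have mono : ∀ s, 0 ≤ s → s ≤ 2 * T →
      2 * (δ + ε * s) * exp (2 * K * s) ≤ 2 * (δ + ε * (2 * T)) * exp (2 * K * (2 * T)) := by
    intro s hs hs'
    have : 0 ≤ ε * s := by positivity
    have hT : 0 ≤ T := by linarith
    gcongr
  rcases le_total t₀ t with h | h
  · have h2 : ∀ s ∈ Icc 0 (t - t₀), t₀ + s ∈ Icc (-T) T := fun s hs =>
      ⟨by linarith [hs.1, ht₀.1], by linarith [hs.2, ht.2]⟩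
    have := sup_gronwall_right (f := fun i s => f i (t₀ + s)) (f' := fun i s => f' i (t₀ + s))
      (T := t - t₀) (K := K) (ε := ε) (δ := δ) (B := B) (by linarith) hK hε
      (fun j s hs => by
        have h1 : HasDerivWithinAt (fun s => t₀ + s) 1 (Icc 0 (t - t₀)) s :=
          ((hasDerivAt_id s).const_add t₀).hasDerivWithinAt
        simpa [Function.comp_def] using (hd j _ (h2 s hs)).scomp s h1 h2)
      (fun j s hs => hB j _ (h2 s hs)) (fun j => by simpa using h0 j)
      (fun s hs m hm j => hb _ (h2 s hs) m hm j) i (t - t₀) ⟨by linarith, le_rfl⟩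
    simp only [add_sub_cancel] at this
    exact this.trans (mono _ (by linarith) (by linarith [ht.2, ht₀.1]))
  · have h2 : ∀ s ∈ Icc 0 (t₀ - t), t₀ - s ∈ Icc (-T) T := fun s hs =>
      ⟨by linarith [hs.2, ht.1], by linarith [hs.1, ht₀.2]⟩
    have := sup_gronwall_right (f := fun i s => f i (t₀ - s)) (f' := fun i s => -f' i (t₀ - s))
      (T := t₀ - t) (K := K) (ε := ε) (δ := δ) (B := B) (by linarith) hK hε
      (fun j s hs => by
        have h1 : HasDerivWithinAt (fun s => t₀ - s) (-1) (Icc 0 (t₀ - t)) s :=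
          ((hasDerivAt_id s).const_sub t₀).hasDerivWithinAt
        simpa [Function.comp_def] using (hd j _ (h2 s hs)).scomp s h1 h2)
      (fun j s hs => hB j _ (h2 s hs)) (fun j => by simpa using h0 j)
      (fun s hs m hm j => by simpa using hb _ (h2 s hs) m hm j) i (t₀ - t) ⟨by linarith, le_rfl⟩
    simp only [sub_sub_cancel] at this
    exact this.trans (mono _ (by linarith) (by linarith [ht.1, ht₀.2]))

/-- Grönwall's inequality on `[-T, T]` from an arbitrary base time. -/
theorem gronwall {f f' : ℝ → E} {T K ε t₀ : ℝ}
    (ht₀ : t₀ ∈ Icc (-T) T) (hK : 0 ≤ K) (hε : 0 ≤ ε)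
    (hd : ∀ t ∈ Icc (-T) T, HasDerivWithinAt f (f' t) (Icc (-T) T) t)
    (hb : ∀ t ∈ Icc (-T) T, ‖f' t‖ ≤ K * ‖f t‖ + ε) :
    ∀ t ∈ Icc (-T) T, ‖f t‖ ≤ 2 * (‖f t₀‖ + ε * (2 * T)) * exp (2 * K * (2 * T)) := by
  have hc : ContinuousOn f (Icc (-T) T) := fun t ht => (hd t ht).continuousWithinAt
  obtain ⟨B, hB⟩ := isCompact_Icc.exists_bound_of_continuousOn hc
  intro t ht
  refine sup_gronwall (ι := Unit) (f := fun _ => f) (f' := fun _ => f') (B := B) ht₀ hK hε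
    (fun _ => hd) (fun _ => hB) (fun _ => le_rfl) (fun t ht m hm _ => ?_) () t ht
  have := hm ()
  calc ‖f' t‖ ≤ K * ‖f t‖ + ε := hb t ht
    _ ≤ K * m + ε := by gcongr

theorem norm_sub_le_of_hasDerivWithinAt {f f' : ℝ → E} {T C : ℝ}
    (hd : ∀ t ∈ Icc (-T) T, HasDerivWithinAt f (f' t) (Icc (-T) T) t)
    (hb : ∀ t ∈ Icc (-T) T, ‖f' t‖ ≤ C) {s t : ℝ} (hs : s ∈ Icc (-T) T) (ht : t ∈ Icc (-T) T) :
    ‖f t - f s‖ ≤ C * |t - s| := by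
  simpa using (convex_Icc (-T) T).norm_image_sub_le_of_norm_hasDerivWithin_le hd hb hs ht

/-- The radial truncation of a normed space at radius `R`. -/
def radialTrunc (R : ℝ) (p : E) : E := (R / max R ‖p‖) • p

theorem norm_radialTrunc_le {R : ℝ} (hR : 0 < R) (p : E) : ‖radialTrunc R p‖ ≤ R := by
  have h : 0 < max R ‖p‖ := lt_max_of_lt_left hR
  rw [radialTrunc, norm_smul, Real.norm_of_nonneg (by positivity), div_mul_eq_mul_div,
    div_le_iff₀ h]
  gcongr
  exact le_max_right _ _

theorem norm_radialTrunc_le_norm {R : ℝ} (hR : 0 < R) (p : E) : ‖radialTrunc R p‖ ≤ ‖p‖ := by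
  have h : 0 < max R ‖p‖ := lt_max_of_lt_left hR
  rw [radialTrunc, norm_smul, Real.norm_of_nonneg (by positivity)]
  exact mul_le_of_le_one_left (norm_nonneg _) ((div_le_one h).2 (le_max_left _ _))

theorem radialTrunc_of_norm_le {R : ℝ} (hR : 0 < R) {p : E} (hp : ‖p‖ ≤ R) :
    radialTrunc R p = p := by
  rw [radialTrunc, max_eq_left hp, div_self hR.ne', one_smul]

/-- The difference is a rescaled `p - q` plus the variation of the scaling factor acting on `q`;
each part is at most `‖p - q‖`. -/
theorem norm_radialTrunc_sub_le {R : ℝ} (hR : 0 < R) (p q : E) :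
    ‖radialTrunc R p - radialTrunc R q‖ ≤ 2 * ‖p - q‖ := by
  set a := max R ‖p‖ with ha
  set b := max R ‖q‖ with hb
  have ha0 : 0 < a := lt_max_of_lt_left hR
  have hb0 : 0 < b := lt_max_of_lt_left hR
  have hRa : R ≤ a := le_max_left _ _
  have hqb : ‖q‖ ≤ b := le_max_right _ _
  have hab : |b - a| ≤ ‖p - q‖ := by
    rw [ha, hb]
    refine (abs_max_sub_max_le_max _ _ _ _).trans ?_
    rw [sub_self, abs_zero, max_eq_right (abs_nonneg _), abs_sub_comm]
    exact abs_norm_sub_norm_le p q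
  have h1 : radialTrunc R p - radialTrunc R q = (R / a) • (p - q) + (R * (b - a) / (a * b)) • q := by
    rw [radialTrunc, radialTrunc, ← ha, ← hb, smul_sub]
    have : R * (b - a) / (a * b) = R / a - R / b := by field_simp
    rw [this, sub_smul]
    abel
  rw [h1, two_mul]
  refine (norm_add_le _ _).trans (add_le_add ?_ ?_)
  · rw [norm_smul, Real.norm_of_nonneg (by positivity)]
    exact mul_le_of_le_one_left (norm_nonneg _) ((div_le_one ha0).2 hRa)
  · rw [norm_smul, Real.norm_eq_abs, abs_div, abs_mul, abs_of_pos hR, abs_of_pos (mul_pos ha0 hb0),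
      div_mul_eq_mul_div, div_le_iff₀ (by positivity)]
    calc R * |b - a| * ‖q‖ ≤ a * ‖p - q‖ * b := by gcongr
      _ = ‖p - q‖ * (a * b) := by ring

/-- Global solvability of bounded, globally Lipschitz autonomous differential equations. -/
theorem exists_solution_of_bounded_lipschitz [CompleteSpace E] {F : ℝ → E → E} {T L : ℝ} {K : ℝ≥0}
    (hT : 0 ≤ T) (hF : ∀ t ∈ Icc (-T) T, LipschitzWith K (F t))
    (hc : ∀ x, ContinuousOn (fun t => F t x) (Icc (-T) T))
    (hL : ∀ t ∈ Icc (-T) T, ∀ x, ‖F t x‖ ≤ L) (x₀ : E) :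
    ∃ x : ℝ → E, x 0 = x₀ ∧
      ∀ t ∈ Icc (-T) T, HasDerivWithinAt x (F t (x t)) (Icc (-T) T) t := by
  have h0 : (0 : ℝ) ∈ Icc (-T) T := ⟨by linarith, hT⟩
  have hL0 : 0 ≤ L := (norm_nonneg _).trans (hL 0 h0 0)
  -- A field bounded by `L` cannot leave the ball of radius `L * T` within time `T`, so the local
  -- theorem covers the whole interval.
  have hP : IsPicardLindelof F (tmin := -T) (tmax := T) ⟨0, h0⟩ x₀
      ⟨L * T, mul_nonneg hL0 hT⟩ 0 ⟨L, hL0⟩ K :=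
    { lipschitzOnWith := fun t ht => (hF t ht).lipschitzOnWith
      continuousOn := fun x _ => hc x
      norm_le := fun t ht x _ => hL t ht x
      mul_max_le := by simp; rfl }
  exact hP.exists_eq_forall_mem_Icc_hasDerivWithinAt₀

/-- Global solvability of linear differential equations. -/
theorem exists_solution_linear [CompleteSpace E] {M : ℝ → E →L[ℝ] E} {T C : ℝ}
    (hT : 0 ≤ T) (hM : ContinuousOn M (Icc (-T) T)) (hC : ∀ t ∈ Icc (-T) T, ‖M t‖ ≤ C) (p₀ : E) :
    ∃ p : ℝ → E, p 0 = p₀ ∧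
      ∀ t ∈ Icc (-T) T, HasDerivWithinAt p (M t (p t)) (Icc (-T) T) t := by
  have h0 : (0 : ℝ) ∈ Icc (-T) T := ⟨by linarith, hT⟩
  have hC0 : 0 ≤ C := (norm_nonneg _).trans (hC 0 h0)
  -- Truncation does not increase norms, so the Grönwall bound for the truncated equation does not
  -- depend on the radius. Taking `R` above it, the solution never meets the truncation.
  set R : ℝ := 2 * (‖p₀‖ + 0 * (2 * T)) * exp (2 * C * (2 * T)) + 1 with hR
  have hR0 : 0 < R := by positivity
  obtain ⟨p, hp0, hp⟩ := exists_solution_of_bounded_lipschitz (T := T) (L := C * R)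
    (F := fun t p => M t (radialTrunc R p)) (K := ⟨C * 2, by positivity⟩) hT
    (fun t ht => LipschitzWith.of_dist_le_mul fun p q => by
      rw [dist_eq_norm, dist_eq_norm, ← map_sub]
      refine (M t).le_of_opNorm_le_of_le (hC t ht) (norm_radialTrunc_sub_le hR0 p q) |>.trans ?_
      rw [← mul_assoc]; rfl)
    (fun x => hM.clm_apply continuousOn_const)
    (fun t ht x => (M t).le_of_opNorm_le_of_le (hC t ht) (norm_radialTrunc_le hR0 x)) p₀
  refine ⟨p, hp0, fun t ht => ?_⟩
  have hb := gronwall (f := p) h0 hC0 le_rfl hp (fun t ht => by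
    rw [add_zero]
    exact (M t).le_of_opNorm_le_of_le (hC t ht) (norm_radialTrunc_le_norm hR0 _)) t ht
  rw [hp0] at hb
  have := hp t ht
  rwa [radialTrunc_of_norm_le hR0 (by linarith)] at this

end Gronwall

end BRAlpha

end

noncomputable section

namespace BRAlpha

/-! ### The radial profile of the kernel as a Laplace transform -/

section Laplace

/-- This is `x ^ N ≤ N ^ N * exp x` with `N = k + ε` and `x = z * c`. The spare factor `c ^ (-ε)`
pays for densities whose integral diverges logarithmically. -/
theorem exp_neg_mul_pow_le {z c ε : ℝ} (k : ℕ) (hz : 0 < z) (hc : 0 < c) (hε : 0 < ε) :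
    exp (-z * c) * c ^ k ≤ ((k + ε) ^ ((k : ℝ) + ε) * z ^ (-((k : ℝ) + ε))) * c ^ (-ε) := by
  have hN : (0 : ℝ) < k + ε := by positivity
  have hx : 0 < z * c := by positivity
  have h1 : (z * c) ^ ((k : ℝ) + ε) ≤ (k + ε) ^ ((k : ℝ) + ε) * exp (z * c) := by
    have h2 : z * c ≤ (k + ε) * exp (z * c / (k + ε)) := by
      have := add_one_le_exp (z * c / (k + ε))
      calc z * c = (k + ε) * (z * c / (k + ε)) := by field_simp
        _ ≤ (k + ε) * exp (z * c / (k + ε)) := by gcongr; linarith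
    calc (z * c) ^ ((k : ℝ) + ε) ≤ ((k + ε) * exp (z * c / (k + ε))) ^ ((k : ℝ) + ε) := by gcongr
      _ = (k + ε) ^ ((k : ℝ) + ε) * exp (z * c) := by
        rw [mul_rpow hN.le (exp_pos _).le, ← exp_mul, div_mul_cancel₀ _ hN.ne']
  have h3 : (z * c) ^ ((k : ℝ) + ε) = z ^ ((k : ℝ) + ε) * (c ^ k * c ^ ε) := by
    rw [mul_rpow hz.le hc.le, rpow_add hc, rpow_natCast]
  rw [h3] at h1
  rw [neg_mul, exp_neg, rpow_neg hz.le, rpow_neg hc.le]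
  have e1 := exp_pos (z * c)
  have e2 : 0 < z ^ ((k : ℝ) + ε) := by positivity
  have e3 : 0 < c ^ ε := by positivity
  have h4 : c ^ k ≤ (k + ε) ^ ((k : ℝ) + ε) * exp (z * c) / (z ^ ((k : ℝ) + ε) * c ^ ε) := by
    rw [le_div_iff₀ (by positivity)]
    calc c ^ k * (z ^ ((k : ℝ) + ε) * c ^ ε) = z ^ ((k : ℝ) + ε) * (c ^ k * c ^ ε) := by ring
      _ ≤ _ := h1
  calc (exp (z * c))⁻¹ * c ^ k
      ≤ (exp (z * c))⁻¹ *
        ((k + ε) ^ ((k : ℝ) + ε) * exp (z * c) / (z ^ ((k : ℝ) + ε) * c ^ ε)) := by gcongr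
    _ = _ := by field_simp

/-- The `k`-th derivative of the Laplace transform of the image under `c` of the measure with
density `b` on `S`. -/
def lap (c b : ℝ → ℝ) (S : Set ℝ) (k : ℕ) (z : ℝ) : ℝ :=
  ∫ s in S, exp (-z * c s) * (-c s) ^ k * b s

variable {c b : ℝ → ℝ} {S : Set ℝ}

theorem abs_lap_integrand_le {z ε : ℝ} (hc0 : ∀ s ∈ S, 0 < c s) (hb0 : ∀ s ∈ S, 0 ≤ b s)
    (k : ℕ) (hz : 0 < z) (hε : 0 < ε) {s : ℝ} (hs : s ∈ S) :
    ‖exp (-z * c s) * (-c s) ^ k * b s‖ ≤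
      ((k + ε) ^ ((k : ℝ) + ε) * z ^ (-((k : ℝ) + ε))) * (c s ^ (-ε) * b s) := by
  rw [norm_mul, norm_mul, norm_pow, norm_neg, Real.norm_of_nonneg (hb0 s hs),
    Real.norm_of_nonneg (hc0 s hs).le, Real.norm_of_nonneg (exp_pos _).le, ← mul_assoc]
  have := exp_neg_mul_pow_le k hz (hc0 s hs) hε
  have := hb0 s hs
  gcongr

theorem lap_integrable (hS : MeasurableSet S) (hc : Continuous c) (hb : Continuous b)
    (hc0 : ∀ s ∈ S, 0 < c s) (hb0 : ∀ s ∈ S, 0 ≤ b s)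
    (hint : ∀ ε : ℝ, 0 < ε → ε ≤ 1 → IntegrableOn (fun s => c s ^ (-ε) * b s) S)
    (k : ℕ) {z : ℝ} (hz : 0 < z) :
    IntegrableOn (fun s => exp (-z * c s) * (-c s) ^ k * b s) S := by
  refine Integrable.mono' ((hint 1 one_pos le_rfl).const_mul
    ((k + 1) ^ ((k : ℝ) + 1) * z ^ (-((k : ℝ) + 1)))) ?_ ?_
  · exact Continuous.aestronglyMeasurable (by fun_prop)
  · filter_upwards [ae_restrict_mem hS] with s hs
    exact abs_lap_integrand_le hc0 hb0 k hz one_pos hs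

theorem abs_lap_le (hS : MeasurableSet S)
    (hc0 : ∀ s ∈ S, 0 < c s) (hb0 : ∀ s ∈ S, 0 ≤ b s)
    (hint : ∀ ε : ℝ, 0 < ε → ε ≤ 1 → IntegrableOn (fun s => c s ^ (-ε) * b s) S)
    (k : ℕ) {ε : ℝ} (hε : 0 < ε) (hε1 : ε ≤ 1) :
    ∃ C, 0 ≤ C ∧ ∀ z, 0 < z → |lap c b S k z| ≤ C * z ^ (-((k : ℝ) + ε)) := by
  refine ⟨(k + ε) ^ ((k : ℝ) + ε) * ∫ s in S, c s ^ (-ε) * b s, ?_, fun z hz => ?_⟩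
  · refine mul_nonneg (by positivity) (setIntegral_nonneg hS fun s hs => ?_)
    have := hc0 s hs
    have := hb0 s hs
    positivity
  · have h := norm_integral_le_of_norm_le (μ := volume.restrict S) ((hint ε hε hε1).const_mul
      ((k + ε) ^ ((k : ℝ) + ε) * z ^ (-((k : ℝ) + ε)))) (by
      filter_upwards [ae_restrict_mem hS] with s hs
      exact abs_lap_integrand_le hc0 hb0 k hz hε hs)
    rw [integral_const_mul] at h
    calc |lap c b S k z| ≤ _ := h
      _ = _ := by ring

/-- Differentiation under the integral sign: for parameters above `z / 2` the differentiated
integrand is dominated by its absolute value at `z / 2`. -/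
theorem hasDerivAt_lap (hS : MeasurableSet S) (hc : Continuous c) (hb : Continuous b)
    (hc0 : ∀ s ∈ S, 0 < c s) (hb0 : ∀ s ∈ S, 0 ≤ b s)
    (hint : ∀ ε : ℝ, 0 < ε → ε ≤ 1 → IntegrableOn (fun s => c s ^ (-ε) * b s) S)
    (k : ℕ) {z : ℝ} (hz : 0 < z) :
    HasDerivAt (lap c b S k) (lap c b S (k + 1) z) z := by
  have hz2 : 0 < z / 2 := by positivity
  refine (hasDerivAt_integral_of_dominated_loc_of_deriv_le (μ := volume.restrict S)
    (F := fun z s => exp (-z * c s) * (-c s) ^ k * b s)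
    (F' := fun z s => exp (-z * c s) * (-c s) ^ (k + 1) * b s) (s := Ioi (z / 2))
    (bound := fun s => ‖exp (-(z / 2) * c s) * (-c s) ^ (k + 1) * b s‖)
    (Ioi_mem_nhds (by linarith)) ?_ ?_ ?_ ?_ ?_ ?_).2
  · exact Eventually.of_forall fun x => Continuous.aestronglyMeasurable (by fun_prop)
  · exact lap_integrable hS hc hb hc0 hb0 hint k hz
  · exact Continuous.aestronglyMeasurable (by fun_prop)
  · filter_upwards [ae_restrict_mem hS] with s hs x hx
    rw [norm_mul, norm_mul, norm_mul, norm_mul, Real.norm_of_nonneg (exp_pos _).le,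
      Real.norm_of_nonneg (exp_pos _).le]
    have := hc0 s hs
    have hx' : z / 2 < x := hx
    gcongr
  · exact (lap_integrable hS hc hb hc0 hb0 hint (k + 1) hz2).norm
  · filter_upwards with s x hx
    have h1 : HasDerivAt (fun x => exp (-x * c s)) (exp (-x * c s) * (-1 * c s)) x :=
      (((hasDerivAt_id x).neg).mul_const (c s)).exp
    refine ((h1.mul_const ((-c s) ^ k)).mul_const (b s)).congr_deriv ?_
    ring

end Laplace

/-! ### The Bessel profile: representation, derivatives and bounds. -/

section Profile

theorem integrableOn_cosh_rpow {ε : ℝ} (hε : 0 < ε) :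
    IntegrableOn (fun s => cosh s ^ (-ε)) (Ioi (0 : ℝ)) := by
  refine Integrable.mono' ((exp_neg_integrableOn_Ioi 0 hε).const_mul (2 ^ ε)) ?_ ?_
  · exact (continuous_cosh.rpow_const fun s => Or.inl (cosh_pos s).ne').aestronglyMeasurable
  · filter_upwards with s
    have h : exp s / 2 ≤ cosh s := by rw [cosh_eq]; have := exp_pos (-s); linarith
    have hc := cosh_pos s
    rw [Real.norm_of_nonneg (by positivity)]
    calc cosh s ^ (-ε) ≤ (exp s / 2) ^ (-ε) :=
          rpow_le_rpow_of_nonpos (by positivity) h (by linarith)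
      _ = 2 ^ ε * exp (-ε * s) := by
        rw [div_rpow (exp_pos s).le two_pos.le, ← exp_mul, rpow_neg two_pos.le, div_inv_eq_mul,
          mul_comm s, mul_comm]

/-- The density of the far part of the profile. -/
def farDensity (s : ℝ) : ℝ := sinh s * exp (-s)

theorem farDensity_nonneg {s : ℝ} (hs : 0 < s) : 0 ≤ farDensity s :=
  mul_nonneg (sinh_nonneg_iff.2 hs.le) (exp_pos _).le

theorem farDensity_le_one (s : ℝ) : farDensity s ≤ 1 := by
  have h : farDensity s = (1 - exp (-s) * exp (-s)) / 2 := by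
    rw [farDensity, sinh_eq, sub_div, sub_mul, div_mul_eq_mul_div, ← exp_add]
    simp; ring
  have : 0 < exp (-s) * exp (-s) := by positivity
  linarith

theorem cosh_mul_farDensity_le {s : ℝ} (hs : 0 < s) : cosh s * farDensity s ≤ sinh s := by
  have h1 : cosh s * exp (-s) ≤ 1 := by
    have : cosh s ≤ exp s := by
      have := sinh_nonneg_iff.2 hs.le
      have h := cosh_sub_sinh s
      have h' := cosh_add_sinh s
      linarith
    calc cosh s * exp (-s) ≤ exp s * exp (-s) := by gcongr
      _ = 1 := by rw [← exp_add]; simp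
  calc cosh s * farDensity s = sinh s * (cosh s * exp (-s)) := by rw [farDensity]; ring
    _ ≤ sinh s * 1 := by have := sinh_nonneg_iff.2 hs.le; gcongr
    _ = sinh s := mul_one _

theorem continuous_farDensity : Continuous farDensity := by unfold farDensity; fun_prop

theorem integrableOn_far (ε : ℝ) (hε : 0 < ε) (_ : ε ≤ 1) :
    IntegrableOn (fun s => cosh s ^ (-ε) * farDensity s) (Ioi (0 : ℝ)) := by
  refine Integrable.mono' (integrableOn_cosh_rpow hε) ?_ ?_
  · exact ((continuous_cosh.rpow_const fun s => Or.inl (cosh_pos s).ne').mul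
      continuous_farDensity).aestronglyMeasurable
  · filter_upwards [ae_restrict_mem measurableSet_Ioi] with s hs
    have hc := cosh_pos s
    have := farDensity_nonneg hs
    rw [Real.norm_of_nonneg (by positivity)]
    exact mul_le_of_le_one_right (by positivity) (farDensity_le_one s)

theorem integrableOn_near (ε : ℝ) (_ : 0 < ε) (hε : ε ≤ 1) :
    IntegrableOn (fun s : ℝ => s ^ (-ε) * s) (Ioo 0 1) := by
  refine Measure.integrableOn_of_bounded (M := 1) (by simp)
    (by measurability) ?_
  filter_upwards [ae_restrict_mem measurableSet_Ioo] with s hs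
  have h0 : 0 < s := hs.1
  rw [Real.norm_of_nonneg (by positivity), ← rpow_add_one h0.ne']
  exact rpow_le_one h0.le hs.2.le (by linarith)

/-- The `k`-th derivative of the profile. -/
def profile (k : ℕ) (z : ℝ) : ℝ :=
  lap (fun s => s) (fun s => s) (Ioo 0 1) k z + lap cosh farDensity (Ioi 0) k z

theorem hasDerivAt_profile (k : ℕ) {z : ℝ} (hz : 0 < z) :
    HasDerivAt (profile k) (profile (k + 1) z) z :=
  (hasDerivAt_lap measurableSet_Ioo continuous_id continuous_id (fun _ h => h.1)
    (fun _ h => h.1.le) integrableOn_near k hz).add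
  (hasDerivAt_lap measurableSet_Ioi continuous_cosh continuous_farDensity
    (fun s _ => cosh_pos s) (fun _ h => farDensity_nonneg h) integrableOn_far k hz)

theorem abs_profile_le (k : ℕ) {ε : ℝ} (hε : 0 < ε) (hε1 : ε ≤ 1) :
    ∃ C, 0 ≤ C ∧ ∀ z, 0 < z → |profile k z| ≤ C * z ^ (-((k : ℝ) + ε)) := by
  obtain ⟨C₁, h₁, H₁⟩ := abs_lap_le (c := fun s => s) (b := fun s => s) measurableSet_Ioo
    (fun _ h => h.1) (fun _ h => h.1.le) integrableOn_near k hε hε1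
  obtain ⟨C₂, h₂, H₂⟩ := abs_lap_le measurableSet_Ioi (fun s _ => cosh_pos s)
    (fun _ h => farDensity_nonneg h) integrableOn_far k hε hε1
  refine ⟨C₁ + C₂, by positivity, fun z hz => ?_⟩
  rw [add_mul]
  exact (abs_add_le _ _).trans (add_le_add (H₁ z hz) (H₂ z hz))

theorem exp_neg_mul_cosh_pow_le (k : ℕ) {z : ℝ} (hz : 0 < z) (s : ℝ) :
    exp (-z * cosh s) * cosh s ^ k ≤
      ((k + 1) ^ ((k : ℝ) + 1) * z ^ (-((k : ℝ) + 1))) * cosh s ^ (-1 : ℝ) :=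
  exp_neg_mul_pow_le k hz (cosh_pos s) one_pos

theorem integrableOn_exp_cosh_pow (k : ℕ) {z : ℝ} (hz : 0 < z) :
    IntegrableOn (fun s => exp (-z * cosh s) * cosh s ^ k) (Ioi (0 : ℝ)) := by
  refine Integrable.mono' ((integrableOn_cosh_rpow one_pos).const_mul
    ((k + 1) ^ ((k : ℝ) + 1) * z ^ (-((k : ℝ) + 1)))) ?_ ?_
  · exact Continuous.aestronglyMeasurable (by fun_prop)
  · filter_upwards with s
    have := cosh_pos s
    rw [Real.norm_of_nonneg (by positivity)]
    exact exp_neg_mul_cosh_pow_le k hz s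

theorem tendsto_exp_cosh_pow (k : ℕ) {z : ℝ} (hz : 0 < z) :
    Tendsto (fun s => exp (-z * cosh s) * cosh s ^ k) atTop (𝓝 0) := by
  have h1 : Tendsto (fun s : ℝ => 2 * exp (-s)) atTop (𝓝 0) := by
    simpa using (tendsto_exp_neg_atTop_nhds_zero).const_mul (2 : ℝ)
  have h2 : Tendsto (fun s : ℝ => ((k + 1) ^ ((k : ℝ) + 1) * z ^ (-((k : ℝ) + 1))) * (2 * exp (-s)))
    atTop (𝓝 0) := by simpa using h1.const_mul ((k + 1) ^ ((k : ℝ) + 1) * z ^ (-((k : ℝ) + 1)))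
  refine squeeze_zero (fun s => ?_) (fun s => ?_) h2
  · have := cosh_pos s
    positivity
  · refine (exp_neg_mul_cosh_pow_le k hz s).trans ?_
    gcongr
    have h : exp s / 2 ≤ cosh s := by rw [cosh_eq]; have := exp_pos (-s); linarith
    rw [rpow_neg_one, exp_neg]
    calc (cosh s)⁻¹ ≤ (exp s / 2)⁻¹ := by gcongr
      _ = 2 * (exp s)⁻¹ := by rw [inv_div]; rfl

/-- The endpoint `ε = 0` of `abs_profile_le` for `k = 1`, which the general estimate just misses. It
makes the radial factor logarithmic rather than an `ε`-power, as the logarithmic Grönwall inequality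
requires. In the far part `cosh_mul_farDensity_le` leads to the exact integral of `exp (-z * cosh s)
* sinh s`. -/
theorem abs_profile_one_le : ∃ C, 0 ≤ C ∧ ∀ z, 0 < z → |profile 1 z| ≤ C * z⁻¹ := by
  refine ⟨2, by norm_num, fun z hz => ?_⟩
  refine (abs_add_le _ _).trans ?_
  rw [show (2 : ℝ) * z⁻¹ = 1 * z⁻¹ + 1 * z⁻¹ by ring]
  apply add_le_add
  · have h := norm_setIntegral_le_of_norm_le_const (μ := volume) (s := Ioo (0 : ℝ) 1)
      (f := fun s => exp (-z * s) * (-s) ^ 1 * s) (C := z⁻¹) (by simp) (fun s hs => by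
        have h0 : 0 < s := hs.1
        rw [norm_mul, norm_mul, norm_pow, norm_neg, Real.norm_of_nonneg h0.le, pow_one,
          Real.norm_of_nonneg (exp_pos _).le, neg_mul, exp_neg]
        have h1 : z * s ≤ exp (z * s) := by have := add_one_le_exp (z * s); linarith
        have h2 : (exp (z * s))⁻¹ ≤ (z * s)⁻¹ := by gcongr
        calc (exp (z * s))⁻¹ * s * s ≤ (z * s)⁻¹ * s * 1 := by gcongr; exact hs.2.le
          _ = z⁻¹ := by field_simp)
    simpa [lap] using h
  · have hint := integrableOn_exp_cosh_pow 1 hz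
    have hder : ∀ s ∈ Ici (0 : ℝ), HasDerivAt (fun s => -z⁻¹ * exp (-z * cosh s))
        (exp (-z * cosh s) * sinh s) s := by
      intro s _
      refine ((((hasDerivAt_cosh s).const_mul (-z)).exp).const_mul (-z⁻¹)).congr_deriv ?_
      field_simp
    have hi : IntegrableOn (fun s => exp (-z * cosh s) * sinh s) (Ioi (0 : ℝ)) := by
      refine Integrable.mono' hint (Continuous.aestronglyMeasurable (by fun_prop)) ?_
      filter_upwards [ae_restrict_mem measurableSet_Ioi] with s hs
      have := sinh_nonneg_iff.2 (le_of_lt hs)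
      rw [Real.norm_of_nonneg (by positivity), pow_one]
      gcongr
      exact (sinh_lt_cosh s).le
    have ht : Tendsto (fun s => -z⁻¹ * exp (-z * cosh s)) atTop (𝓝 0) := by
      simpa using (tendsto_exp_cosh_pow 0 hz).const_mul (-z⁻¹)
    have hI := integral_Ioi_of_hasDerivAt_of_tendsto' hder hi ht
    have h := norm_integral_le_of_norm_le (μ := volume.restrict (Ioi (0 : ℝ)))
      (f := fun s => exp (-z * cosh s) * (-cosh s) ^ 1 * farDensity s) hi (by
      filter_upwards [ae_restrict_mem measurableSet_Ioi] with s hs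
      rw [norm_mul, norm_mul, norm_pow, norm_neg, Real.norm_of_nonneg (cosh_pos s).le, pow_one,
          Real.norm_of_nonneg (exp_pos _).le, Real.norm_of_nonneg (farDensity_nonneg hs), mul_assoc]
      gcongr
      exact cosh_mul_farDensity_le hs)
    rw [hI] at h
    refine h.trans ?_
    have : exp (-z * cosh 0) ≤ 1 := exp_le_one_iff.2 (by simp; linarith)
    calc 0 - -z⁻¹ * exp (-z * cosh 0) = z⁻¹ * exp (-z * cosh 0) := by ring
      _ ≤ z⁻¹ * 1 := by gcongr
      _ = 1 * z⁻¹ := by ring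

theorem integral_near (z : ℝ) (hz : 0 < z) :
    lap (fun s => s) (fun s => s) (Ioo 0 1) 0 z =
      z⁻¹ * z⁻¹ - exp (-z) * (z⁻¹ + z⁻¹ * z⁻¹) := by
  have h : ∀ s ∈ uIcc (0 : ℝ) 1, HasDerivAt
      (fun s => -(s * z⁻¹ + z⁻¹ * z⁻¹) * exp (-z * s)) (exp (-z * s) * (-s) ^ 0 * s) s := by
    intro s _
    refine (((((hasDerivAt_id s).mul_const z⁻¹).add_const (z⁻¹ * z⁻¹)).neg).mul
      (((hasDerivAt_id s).const_mul (-z)).exp)).congr_deriv ?_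
    simp only [id, Pi.neg_apply]
    field_simp
    ring
  have := intervalIntegral.integral_eq_sub_of_hasDerivAt h
    (Continuous.intervalIntegrable (by fun_prop) _ _)
  rw [lap, ← integral_Ioc_eq_integral_Ioo, ← intervalIntegral.integral_of_le zero_le_one, this]
  simp
  ring

/-- Neither term is elementary, but the sum of the two integrands has an explicit primitive. -/
theorem integral_far (z : ℝ) (hz : 0 < z) :
    lap cosh farDensity (Ioi 0) 0 z + z⁻¹ * besselK 1 z = exp (-z) * (z⁻¹ + z⁻¹ * z⁻¹) := by
  have i1 := lap_integrable measurableSet_Ioi continuous_cosh continuous_farDensity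
    (fun s _ => cosh_pos s) (fun _ h => farDensity_nonneg h) integrableOn_far 0 hz
  have i2 : IntegrableOn (fun s => z⁻¹ * (exp (-z * cosh s) * cosh (1 * s))) (Ioi (0 : ℝ)) := by
    simpa [IntegrableOn] using (integrableOn_exp_cosh_pow 1 hz).const_mul z⁻¹
  have hder : ∀ s ∈ Ici (0 : ℝ), HasDerivAt
      (fun s => (z⁻¹ * sinh s - (cosh s * z⁻¹ + z⁻¹ * z⁻¹)) * exp (-z * cosh s))
      (exp (-z * cosh s) * (-cosh s) ^ 0 * farDensity s +
        z⁻¹ * (exp (-z * cosh s) * cosh (1 * s))) s := by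
    intro s _
    refine ((((hasDerivAt_sinh s).const_mul z⁻¹).sub
      (((hasDerivAt_cosh s).mul_const z⁻¹).add_const (z⁻¹ * z⁻¹))).mul
      (((hasDerivAt_cosh s).const_mul (-z)).exp)).congr_deriv ?_
    rw [farDensity, ← cosh_sub_sinh, one_mul]
    simp only [Pi.sub_apply]
    field_simp
    ring
  have ht : Tendsto (fun s => (z⁻¹ * sinh s - (cosh s * z⁻¹ + z⁻¹ * z⁻¹)) * exp (-z * cosh s))
      atTop (𝓝 0) := by
    have h1 : Tendsto (fun s : ℝ => exp (-s) * (exp (-z * cosh s) * cosh s ^ 0)) atTop (𝓝 0) := by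
      simpa using tendsto_exp_neg_atTop_nhds_zero.mul (tendsto_exp_cosh_pow 0 hz)
    have h2 := (h1.const_mul (-z⁻¹)).sub ((tendsto_exp_cosh_pow 0 hz).const_mul (z⁻¹ * z⁻¹))
    simp only [mul_zero, sub_zero] at h2
    refine h2.congr fun s => ?_
    rw [← cosh_sub_sinh]
    ring
  have hI := integral_Ioi_of_hasDerivAt_of_tendsto' hder (i1.add i2) ht
  rw [integral_add i1 i2, integral_const_mul] at hI
  rw [lap, besselK, hI]
  simp
  ring

/-- As functions of `z`, `z⁻²` is the Laplace transform of `c` on `(0, ∞)`, and `K₁(z)/z` that of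
`√(c² - 1)` on `(1, ∞)`. Their difference has density `c` on `(0, 1)` and `c - √(c² - 1)` on `(1,
∞)`; for `c = cosh s` the latter is `exp (-s)`, with `dc = sinh s ds`. The boundary terms of the two
parts at `c = 1` cancel. -/
theorem profile_zero_eq {z : ℝ} (hz : 0 < z) :
    profile 0 z = (z⁻¹ - besselK 1 z) * z⁻¹ := by
  have h1 := integral_near z hz
  have h2 := integral_far z hz
  rw [profile, h1]
  linarith

end Profile

end BRAlpha

end

noncomputable section

namespace BRAlpha

/-! ### Estimates for the kernel and its truncations -/

section KernelEstimates

/-- `x ↦ x^⊥` as a continuous linear map. -/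
def perpL : Plane →L[ℝ] Plane :=
  LinearMap.toContinuousLinearMap
    { toFun := perp
      map_add' := fun x y => by
        ext i; fin_cases i <;> simp [perp] ; ring
      map_smul' := fun a x => by
        ext i; fin_cases i <;> simp [perp] }

theorem norm_perp (x : Plane) : ‖perp x‖ = ‖x‖ := by
  simp [EuclideanSpace.norm_eq, perp, Fin.sum_univ_two, add_comm]

theorem perp_sub (x y : Plane) : perp (x - y) = perp x - perp y := map_sub perpL x y

/-- The `k`-th derivative of the radial factor of the kernel. -/
def radial (α : ℝ) (k : ℕ) (r : ℝ) : ℝ :=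
  (1 / (2 * π * α ^ 2)) * α⁻¹ ^ k * profile k (r / α)

variable {α : ℝ}

theorem kernel_eq (hα : 0 < α) (x : Plane) : kernel α x = radial α 0 ‖x‖ • perp x := by
  by_cases hx : x = 0
  · subst hx
    have : perp 0 = 0 := map_zero perpL
    simp [kernel, this]
  · have hr : 0 < ‖x‖ := norm_pos_iff.2 hx
    have hz : 0 < ‖x‖ / α := by positivity
    rw [kernel, radial, profile_zero_eq hz, DPsi]
    congr 1
    have := pi_pos
    field_simp
    ring

theorem hasDerivAt_radial (hα : 0 < α) (k : ℕ) {r : ℝ} (hr : 0 < r) :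
    HasDerivAt (radial α k) (radial α (k + 1) r) r := by
  have h := (hasDerivAt_profile k (z := r / α) (by positivity)).comp r
    ((hasDerivAt_id r).div_const α)
  refine (h.const_mul ((1 / (2 * π * α ^ 2)) * α⁻¹ ^ k)).congr_deriv ?_
  rw [radial, pow_succ α⁻¹ k]
  ring

theorem abs_radial_le (hα : 0 < α) (k : ℕ) {ε : ℝ} (hε : 0 < ε) (hε1 : ε ≤ 1) :
    ∃ C, 0 ≤ C ∧ ∀ r, 0 < r → |radial α k r| ≤ C * r ^ (-((k : ℝ) + ε)) := by
  obtain ⟨C, hC, H⟩ := abs_profile_le k hε hε1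
  have := pi_pos
  refine ⟨(1 / (2 * π * α ^ 2)) * α⁻¹ ^ k * (C * α⁻¹ ^ (-((k : ℝ) + ε))), by positivity,
    fun r hr => ?_⟩
  rw [radial, abs_mul, abs_of_nonneg (a := 1 / (2 * π * α ^ 2) * α⁻¹ ^ k) (by positivity)]
  calc (1 / (2 * π * α ^ 2)) * α⁻¹ ^ k * |profile k (r / α)|
      ≤ (1 / (2 * π * α ^ 2)) * α⁻¹ ^ k * (C * (r / α) ^ (-((k : ℝ) + ε))) := by
        gcongr; exact H _ (by positivity)
    _ = _ := by rw [div_eq_mul_inv r, mul_rpow hr.le (by positivity)]; ring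

theorem abs_radial_one_le (hα : 0 < α) :
    ∃ C, 0 ≤ C ∧ ∀ r, 0 < r → |radial α 1 r| ≤ C * r⁻¹ := by
  obtain ⟨C, hC, H⟩ := abs_profile_one_le
  have := pi_pos
  refine ⟨(1 / (2 * π * α ^ 2)) * α⁻¹ ^ 1 * (C * α), by positivity, fun r hr => ?_⟩
  rw [radial, abs_mul, abs_of_nonneg (a := 1 / (2 * π * α ^ 2) * α⁻¹ ^ 1) (by positivity)]
  calc (1 / (2 * π * α ^ 2)) * α⁻¹ ^ 1 * |profile 1 (r / α)|
      ≤ (1 / (2 * π * α ^ 2)) * α⁻¹ ^ 1 * (C * (r / α)⁻¹) := by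
        gcongr; exact H _ (by positivity)
    _ = _ := by rw [inv_div, div_eq_mul_inv]; ring

theorem abs_radial_sub_le (hα : 0 < α) :
    ∃ C, 0 ≤ C ∧ ∀ a b, 0 < b → b ≤ a → |radial α 0 a - radial α 0 b| ≤ C * (a - b) / b := by
  obtain ⟨C, hC, H⟩ := abs_radial_one_le hα
  refine ⟨C, hC, fun a b hb hab => ?_⟩
  have h := (convex_Icc b a).norm_image_sub_le_of_norm_hasDerivWithin_le
    (f := radial α 0) (f' := radial α 1) (C := C * b⁻¹)
    (fun x hx => (hasDerivAt_radial hα 0 (hb.trans_le hx.1)).hasDerivWithinAt)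
    (fun x hx => (H x (hb.trans_le hx.1)).trans (by gcongr; exact hx.1))
    (left_mem_Icc.2 hab) (right_mem_Icc.2 hab)
  rw [Real.norm_eq_abs, Real.norm_of_nonneg (by linarith)] at h
  calc _ ≤ _ := h
    _ = _ := by ring

/-! ### The logarithmic weight and the kernels truncated near the origin. -/

/-- The logarithmic weight `1 + log⁺ (1 / r)`. -/
def ell (r : ℝ) : ℝ := 1 + max 0 (-log r)

theorem one_le_ell (r : ℝ) : 1 ≤ ell r := by
  have := le_max_left 0 (-log r)
  rw [ell]; linarith

theorem ell_le_of_le {r s : ℝ} (hr : 0 < r) (h : r ≤ s) : ell s ≤ ell r := by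
  have := log_le_log hr h
  rw [ell, ell]
  gcongr

theorem ell_le_abs_log (r : ℝ) : ell r ≤ 1 + |log r| := by
  rw [ell]
  gcongr
  exact max_le (abs_nonneg _) (neg_le_abs _)

theorem ell_half_le {r : ℝ} (hr : 0 < r) : ell (r / 2) ≤ 2 * ell r := by
  have h1 : log (r / 2) = log r - log 2 := log_div hr.ne' two_ne_zero
  have h2 := log_two_lt_d9
  have h3 := le_max_left 0 (-log r)
  have h4 := le_max_right 0 (-log r)
  rw [ell, ell, h1]
  have : max 0 (-(log r - log 2)) ≤ max 0 (-log r) + 1 := max_le (by linarith) (by linarith)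
  linarith

theorem abs_radial_le_ell (hα : 0 < α) :
    ∃ C, 0 ≤ C ∧ ∀ r, 0 < r → |radial α 0 r| ≤ C * ell r := by
  obtain ⟨C₁, hC₁, H₁⟩ := abs_radial_one_le hα
  obtain ⟨C₂, hC₂, H₂⟩ := abs_radial_le hα 0 one_pos le_rfl
  refine ⟨C₁ + C₂, by positivity, fun r hr => ?_⟩
  have hell := one_le_ell r
  rcases le_total 1 r with h | h
  · calc |radial α 0 r| ≤ C₂ * r ^ (-(((0 : ℕ) : ℝ) + 1)) := H₂ r hr
      _ ≤ C₂ * 1 := by gcongr; exact rpow_le_one_of_one_le_of_nonpos h (by norm_num)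
      _ ≤ C₂ * ell r := by gcongr
      _ ≤ (C₁ + C₂) * ell r := by gcongr; linarith
  -- Near the origin the derivative is at most `C₁ / r`, so adding `C₁ * log` makes the function
  -- monotone and subtracting it makes it antitone. Comparison with the value at 1 gives the
  -- logarithm.
  · have hder : ∀ c : ℝ, ∀ x ∈ Ioi (0 : ℝ), HasDerivAt (fun s => radial α 0 s + c * log s)
        (radial α 1 x + c * x⁻¹) x := fun c x hx =>
      (hasDerivAt_radial hα 0 hx).add ((hasDerivAt_log (ne_of_gt hx)).const_mul c)
    have hm := monotoneOn_of_deriv_nonneg (convex_Ioi (0 : ℝ))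
      (f := fun s => radial α 0 s + C₁ * log s)
      (fun x hx => (hder C₁ x hx).continuousAt.continuousWithinAt)
      (fun x hx => (hder C₁ x (by simpa using hx)).differentiableAt.differentiableWithinAt)
      (fun x hx => by
        have hx : 0 < x := by simpa using hx
        rw [(hder C₁ x hx).deriv]
        have := neg_le_of_abs_le (H₁ x hx)
        linarith) hr (mem_Ioi.2 one_pos) h
    have ha := antitoneOn_of_deriv_nonpos (convex_Ioi (0 : ℝ))
      (f := fun s => radial α 0 s + (-C₁) * log s)
      (fun x hx => (hder (-C₁) x hx).continuousAt.continuousWithinAt)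
      (fun x hx => (hder (-C₁) x (by simpa using hx)).differentiableAt.differentiableWithinAt)
      (fun x hx => by
        have hx : 0 < x := by simpa using hx
        rw [(hder (-C₁) x hx).deriv]
        have := le_of_abs_le (H₁ x hx)
        linarith) hr (mem_Ioi.2 one_pos) h
    simp only [log_one, mul_zero, add_zero] at hm ha
    have h1 := H₂ 1 one_pos
    rw [one_rpow, mul_one] at h1
    have h2 := abs_le.1 h1
    have h3 : -log r ≤ ell r - 1 := by
      have := le_max_right 0 (-log r)
      rw [ell]; linarith
    have h4 : C₁ * (-log r) ≤ C₁ * ell r := by gcongr; linarith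
    have h5 : C₂ * 1 ≤ C₂ * ell r := by gcongr
    rw [abs_le]
    constructor <;> nlinarith

/-- The kernel with its radial factor frozen on the disc of radius `ε`. -/
def truncKernel (α ε : ℝ) (x : Plane) : Plane := radial α 0 (max ‖x‖ ε) • perp x

theorem truncKernel_zero (hα : 0 < α) (x : Plane) : truncKernel α 0 x = kernel α x := by
  rw [kernel_eq hα, truncKernel, max_eq_left (norm_nonneg _)]

/-- Let `‖Y‖ ≤ ‖X‖`. The variation of the radial factor is `O((a - b) / b)` with `b ≥ ‖Y‖`, and it
multiplies `perp Y`, so it costs no logarithm. Only the radial factor at the larger radius does,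
which is why the weight sits at the maximum. -/
theorem truncKernel_sub_le (hα : 0 < α) :
    ∃ C, 0 ≤ C ∧ ∀ ε, 0 ≤ ε → ∀ X Y : Plane, ‖truncKernel α ε X - truncKernel α ε Y‖ ≤
      C * ‖X - Y‖ * ell (max (max ‖X‖ ‖Y‖) ε) := by
  obtain ⟨C₁, hC₁, H₁⟩ := abs_radial_le_ell hα
  obtain ⟨C₂, hC₂, H₂⟩ := abs_radial_sub_le hα
  refine ⟨C₁ + C₂, by positivity, fun ε hε => ?_⟩
  have main : ∀ X Y : Plane, ‖Y‖ ≤ ‖X‖ → ‖truncKernel α ε X - truncKernel α ε Y‖ ≤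
      (C₁ + C₂) * ‖X - Y‖ * ell (max ‖X‖ ε) := by
    intro X Y hXY
    set a := max ‖X‖ ε with ha
    set b := max ‖Y‖ ε with hb
    have hell := one_le_ell a
    by_cases hX : X = 0
    · subst hX
      have hY : Y = 0 := by simpa using hXY
      subst hY
      simp
    have ha0 : 0 < a := lt_max_of_lt_left (norm_pos_iff.2 hX)
    have h1 : truncKernel α ε X - truncKernel α ε Y =
        radial α 0 a • perp (X - Y) + (radial α 0 a - radial α 0 b) • perp Y := by
      rw [truncKernel, truncKernel, perp_sub, smul_sub, sub_smul]
      abel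
    have h2 : |radial α 0 a - radial α 0 b| * ‖Y‖ ≤ C₂ * ‖X - Y‖ := by
      by_cases hY : Y = 0
      · subst hY
        simp
        positivity
      have hY0 := norm_pos_iff.2 hY
      have hb0 : 0 < b := lt_max_of_lt_left hY0
      have hab : a - b ≤ ‖X - Y‖ := by
        have h3 : |a - b| ≤ ‖X - Y‖ := by
          refine (abs_max_sub_max_le_max _ _ _ _).trans ?_
          rw [sub_self, abs_zero, max_eq_left (abs_nonneg _)]
          exact abs_norm_sub_norm_le _ _
        exact (le_abs_self _).trans h3
      calc |radial α 0 a - radial α 0 b| * ‖Y‖ ≤ (C₂ * (a - b) / b) * b := by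
            have hba : b ≤ a := max_le_max hXY le_rfl
            have h4 := H₂ a b hb0 hba
            have h5 : ‖Y‖ ≤ b := le_max_left _ _
            exact mul_le_mul h4 h5 (norm_nonneg _) ((abs_nonneg _).trans h4)
        _ = C₂ * (a - b) := by field_simp
        _ ≤ C₂ * ‖X - Y‖ := by gcongr
    rw [h1]
    refine (norm_add_le _ _).trans ?_
    rw [norm_smul, norm_smul, norm_perp, norm_perp, Real.norm_eq_abs, Real.norm_eq_abs]
    calc |radial α 0 a| * ‖X - Y‖ + |radial α 0 a - radial α 0 b| * ‖Y‖
        ≤ (C₁ * ell a) * ‖X - Y‖ + C₂ * ‖X - Y‖ * 1 := by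
          rw [mul_one]; gcongr; exact H₁ a ha0
      _ ≤ (C₁ * ell a) * ‖X - Y‖ + C₂ * ‖X - Y‖ * ell a := by gcongr
      _ = _ := by ring
  intro X Y
  rcases le_total ‖Y‖ ‖X‖ with h | h
  · rw [max_eq_left h]; exact main X Y h
  · rw [max_eq_right h, norm_sub_rev, norm_sub_rev X]; exact main Y X h

theorem norm_truncKernel_le (hα : 0 < α) :
    ∃ C, 0 ≤ C ∧ ∀ ε, 0 ≤ ε → ∀ X : Plane, ‖truncKernel α ε X‖ ≤ C := by
  obtain ⟨C, hC, H⟩ := abs_radial_le hα 0 one_pos le_rfl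
  refine ⟨C, hC, fun ε hε X => ?_⟩
  by_cases hX : X = 0
  · subst hX
    simpa [truncKernel, norm_smul, norm_perp] using hC
  have h0 := norm_pos_iff.2 hX
  have hm : 0 < max ‖X‖ ε := lt_max_of_lt_left h0
  rw [truncKernel, norm_smul, norm_perp, Real.norm_eq_abs]
  calc |radial α 0 (max ‖X‖ ε)| * ‖X‖
      ≤ (C * (max ‖X‖ ε) ^ (-(((0 : ℕ) : ℝ) + 1))) * max ‖X‖ ε := by
        gcongr
        · exact H _ hm
        · exact le_max_left _ _
    _ = C := by
      rw [Nat.cast_zero, zero_add, rpow_neg_one]; field_simp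

/-- The two kernels agree outside the disc of radius `ε`; inside, the radial bound with power `-1/2`
makes both `O(ε ^ (1/2))`. Some positive power is all that is needed. -/
theorem truncKernel_sub_kernel_le (hα : 0 < α) :
    ∃ C, 0 ≤ C ∧ ∀ ε, 0 < ε → ∀ X : Plane,
      ‖truncKernel α ε X - kernel α X‖ ≤ C * ε ^ (1 / 2 : ℝ) := by
  obtain ⟨C, hC, H⟩ := abs_radial_le hα 0 (ε := 1 / 2) (by norm_num) (by norm_num)
  refine ⟨C + C, by positivity, fun ε hε X => ?_⟩
  have hp : ∀ r : ℝ, 0 < r → r ^ (-(((0 : ℕ) : ℝ) + 1 / 2)) * r = r ^ (1 / 2 : ℝ) := by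
    intro r hr
    rw [← rpow_add_one hr.ne']
    norm_num
  by_cases hX : X = 0
  · subst hX
    have : perp 0 = 0 := map_zero perpL
    simp only [truncKernel, kernel, this, smul_zero, sub_self, norm_zero]
    positivity
  have h0 := norm_pos_iff.2 hX
  rcases le_total ε ‖X‖ with h | h
  · rw [kernel_eq hα, truncKernel, max_eq_left h, sub_self, norm_zero]
    positivity
  · rw [kernel_eq hα, truncKernel, max_eq_right h]
    refine (norm_sub_le _ _).trans ?_
    rw [norm_smul, norm_smul, norm_perp, Real.norm_eq_abs, Real.norm_eq_abs, add_mul]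
    apply add_le_add
    · calc |radial α 0 ε| * ‖X‖ ≤ C * ε ^ (-(((0 : ℕ) : ℝ) + 1 / 2)) * ε := by
            gcongr; exact H ε hε
        _ = _ := by rw [mul_assoc, hp ε hε]
    · calc |radial α 0 ‖X‖| * ‖X‖ ≤ C * ‖X‖ ^ (-(((0 : ℕ) : ℝ) + 1 / 2)) * ‖X‖ := by
            gcongr; exact H _ h0
        _ = C * ‖X‖ ^ (1 / 2 : ℝ) := by rw [mul_assoc, hp _ h0]
        _ ≤ _ := by gcongr

/-- One of `X`, `Y` has norm at least `‖X - Y‖ / 2`. The weight then depends on the difference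
alone, so this bound can be integrated along a curve about which nothing is known. -/
theorem truncKernel_two_point_le (hα : 0 < α) :
    ∃ C, 0 ≤ C ∧ ∀ ε, 0 ≤ ε → ∀ X Y : Plane, X ≠ Y →
      ‖truncKernel α ε X - truncKernel α ε Y‖ ≤ C * ‖X - Y‖ * ell ‖X - Y‖ := by
  obtain ⟨C, hC, H⟩ := truncKernel_sub_le hα
  refine ⟨C * 2, by positivity, fun ε hε X Y hXY => (H ε hε X Y).trans ?_⟩
  have hr : 0 < ‖X - Y‖ := norm_pos_iff.2 (sub_ne_zero.2 hXY)
  have h1 : ‖X - Y‖ / 2 ≤ max (max ‖X‖ ‖Y‖) ε := by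
    have := norm_sub_le X Y
    have h2 := le_max_left ‖X‖ ‖Y‖
    have h3 := le_max_right ‖X‖ ‖Y‖
    have h4 := le_max_left (max ‖X‖ ‖Y‖) ε
    linarith
  calc C * ‖X - Y‖ * ell (max (max ‖X‖ ‖Y‖) ε) ≤ C * ‖X - Y‖ * (2 * ell ‖X - Y‖) := by
        gcongr
        exact (ell_le_of_le (by positivity) h1).trans (ell_half_le hr)
    _ = _ := by ring

/-- Here the weight is on `X` alone. When `X` runs over chords of a curve with integrable logarithm,
integration gives a true Lipschitz bound, whatever `Y` is. -/
theorem truncKernel_sub_le_left (hα : 0 < α) :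
    ∃ C, 0 ≤ C ∧ ∀ ε, 0 ≤ ε → ∀ X Y : Plane, X ≠ 0 →
      ‖truncKernel α ε X - truncKernel α ε Y‖ ≤ C * ‖X - Y‖ * ell ‖X‖ := by
  obtain ⟨C, hC, H⟩ := truncKernel_sub_le hα
  refine ⟨C, by positivity, fun ε hε X Y hX => (H ε hε X Y).trans ?_⟩
  gcongr
  exact ell_le_of_le (norm_pos_iff.2 hX) ((le_max_left _ _).trans (le_max_left _ _))

theorem lipschitzWith_truncKernel (hα : 0 < α) {ε : ℝ} (hε : 0 < ε) :
    ∃ K : ℝ≥0, LipschitzWith K (truncKernel α ε) := by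
  obtain ⟨C, hC, H⟩ := truncKernel_sub_le hα
  have h1 := one_le_ell ε
  refine ⟨⟨C * ell ε, by positivity⟩, LipschitzWith.of_dist_le_mul fun X Y => ?_⟩
  rw [dist_eq_norm, dist_eq_norm]
  calc _ ≤ _ := H ε hε.le X Y
    _ ≤ C * ‖X - Y‖ * ell ε := by gcongr; exact ell_le_of_le hε (le_max_right _ _)
    _ = (C * ell ε) * ‖X - Y‖ := by ring

theorem continuous_kernel (hα : 0 < α) : Continuous (kernel α) := by
  obtain ⟨C, hC, H⟩ := truncKernel_sub_kernel_le hα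
  refine continuous_of_uniform_approx_of_continuous (fun u hu => ?_)
  obtain ⟨δ, hδ, hδu⟩ := Metric.mem_uniformity_dist.1 hu
  have ht : Tendsto (fun ε : ℝ => C * ε ^ (1 / 2 : ℝ)) (𝓝[>] 0) (𝓝 0) := by
    have h1 : ContinuousAt (fun ε : ℝ => C * ε ^ (1 / 2 : ℝ)) 0 :=
      (continuousAt_rpow_const _ _ (Or.inr (by norm_num))).const_mul C
    have h2 := h1.tendsto
    rw [zero_rpow (by norm_num), mul_zero] at h2
    exact h2.mono_left nhdsWithin_le_nhds
  obtain ⟨ε, h1, h2⟩ := ((ht.eventually (gt_mem_nhds hδ)).and self_mem_nhdsWithin).exists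
  obtain ⟨K, hK⟩ := lipschitzWith_truncKernel hα (show (0 : ℝ) < ε from h2)
  refine ⟨_, hK.continuous, fun y => hδu ?_⟩
  rw [dist_comm, dist_eq_norm]
  exact (H ε h2 y).trans_lt h1

end KernelEstimates

/-! ### Logarithmic Grönwall inequality -/

/-- Monotonicity of `w * |log w|` up to a linear error; it passes from `‖ξ‖ ^ 2` to the regularized
`‖ξ‖ ^ 2 + η`. -/
theorem mul_abs_log_le {w s : ℝ} (hw : 0 ≤ w) (hws : w ≤ s) : w * |log w| ≤ s * |log s| + s := by
  rcases hw.eq_or_lt with rfl | hw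
  · have := abs_nonneg (log s)
    simp; positivity
  have hs := hw.trans_le hws
  have h0 := abs_nonneg (log s)
  rcases le_total 1 w with h | h
  · have h1 := log_nonneg h
    have h2 := log_le_log hw hws
    rw [abs_of_nonneg h1, abs_of_nonneg (h1.trans h2)]
    nlinarith
  · have h1 := log_nonpos hw.le h
    rw [abs_of_nonpos h1]
    have h2 : log (s / w) ≤ s / w - 1 := log_le_sub_one_of_pos (by positivity)
    rw [log_div hs.ne' hw.ne'] at h2
    have h3 : w * (log s - log w) ≤ s := by
      calc w * (log s - log w) ≤ w * (s / w - 1) := by gcongr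
        _ = s - w := by field_simp
        _ ≤ s := by linarith
    have h4 : w * (-log s) ≤ s * |log s| := by
      calc w * (-log s) ≤ w * |log s| := by gcongr; exact neg_le_abs _
        _ ≤ s * |log s| := by gcongr
    linarith

/-- Where `ξ` does not vanish, the logarithm of `‖ξ‖` satisfies a linear differential inequality. To
avoid assuming this, the argument uses `log (‖ξ‖ ^ 2 + η)`, with bounds uniform in `η`. A zero of
`ξ` would make the left side infinite as `η → 0`, while the right side converges. -/
theorem log_gronwall {ξ ξ' : ℝ → Plane} {T C : ℝ} (hT : 0 ≤ T) (hC : 0 ≤ C)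
    (hd : ∀ t ∈ Icc (-T) T, HasDerivWithinAt ξ (ξ' t) (Icc (-T) T) t)
    (hb : ∀ t ∈ Icc (-T) T, ‖ξ' t‖ ≤ C * ‖ξ t‖ * (1 + |log ‖ξ t‖|)) (h0 : ξ 0 ≠ 0) :
    ∀ t ∈ Icc (-T) T, ξ t ≠ 0 ∧
      |log ‖ξ t‖| ≤ 2 * (|log ‖ξ 0‖| + 2 * C * (2 * T)) * exp (2 * (2 * C) * (2 * T)) := by
  have hz : (0 : ℝ) ∈ Icc (-T) T := ⟨by linarith, hT⟩
  have hη : ∀ η : ℝ, 0 < η → ∀ t ∈ Icc (-T) T, |log (‖ξ t‖ ^ 2 + η)| ≤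
      2 * (|log (‖ξ 0‖ ^ 2 + η)| + 4 * C * (2 * T)) * exp (2 * (2 * C) * (2 * T)) := by
    intro η hη
    refine gronwall (f := fun t => log (‖ξ t‖ ^ 2 + η))
      (f' := fun t => (2 * inner ℝ (ξ t) (ξ' t)) / (‖ξ t‖ ^ 2 + η)) hz (by positivity)
      (by positivity) (fun t ht => ?_) (fun t ht => ?_)
    · exact (((hd t ht).norm_sq).add_const η).log (by positivity)
    · set w := ‖ξ t‖ ^ 2 with hw
      have hw0 : 0 ≤ w := by positivity
      have hs : 0 < w + η := by positivity
      rw [Real.norm_eq_abs, Real.norm_eq_abs, abs_div, abs_of_pos hs, div_le_iff₀ hs, abs_mul,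
        abs_two]
      have h1 : |inner ℝ (ξ t) (ξ' t)| ≤ ‖ξ t‖ * ‖ξ' t‖ := abs_real_inner_le_norm _ _
      have h2 : |log w| = 2 * |log ‖ξ t‖| := by rw [hw, log_pow, abs_mul]; simp
      have h3 := mul_abs_log_le hw0 (show w ≤ w + η by linarith)
      calc 2 * |inner ℝ (ξ t) (ξ' t)| ≤ 2 * (‖ξ t‖ * (C * ‖ξ t‖ * (1 + |log ‖ξ t‖|))) := by
            gcongr; exact h1.trans (by gcongr; exact hb t ht)
        _ = C * (2 * w + w * |log w|) := by rw [h2, hw]; ring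
        _ ≤ C * (2 * (w + η) + ((w + η) * |log (w + η)| + (w + η))) := by gcongr; linarith
        _ ≤ (2 * C * |log (w + η)| + 4 * C) * (w + η) := by
            have := abs_nonneg (log (w + η))
            have h5 : 0 ≤ C * (w + η) := by positivity
            nlinarith [mul_nonneg h5 this]
  have hw0 : 0 < ‖ξ 0‖ ^ 2 := by have := norm_pos_iff.2 h0; positivity
  have hlog : ∀ t, |log (‖ξ t‖ ^ 2)| = 2 * |log ‖ξ t‖| := fun t => by
    rw [log_pow, abs_mul]; simp
  have hlim : ∀ t, ξ t ≠ 0 → Tendsto (fun η => |log (‖ξ t‖ ^ 2 + η)|) (𝓝[>] 0)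
      (𝓝 (2 * |log ‖ξ t‖|)) := by
    intro t ht
    have hpos : 0 < ‖ξ t‖ ^ 2 := by have := norm_pos_iff.2 ht; positivity
    have : ContinuousAt (fun η => |log (‖ξ t‖ ^ 2 + η)|) 0 :=
      ((continuousAt_const.add continuousAt_id).log (by simpa using hpos.ne')).abs
    have := this.tendsto
    rw [add_zero, hlog] at this
    exact this.mono_left nhdsWithin_le_nhds
  have hlim0 := ((((hlim 0 h0).add_const (4 * C * (2 * T))).const_mul 2).mul_const
    (exp (2 * (2 * C) * (2 * T))))
  intro t ht
  have hne : ξ t ≠ 0 := by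
    intro hzero
    have h1 : Tendsto (fun η : ℝ => |log (‖ξ t‖ ^ 2 + η)|) (𝓝[>] 0) atTop := by
      simp only [hzero, norm_zero, ne_eq, OfNat.ofNat_ne_zero, not_false_eq_true, zero_pow, zero_add]
      exact tendsto_abs_atBot_atTop.comp tendsto_log_nhdsGT_zero
    exact not_tendsto_nhds_of_tendsto_atTop (tendsto_atTop_mono' _
      (by filter_upwards [self_mem_nhdsWithin] with η h using hη η h t ht) h1) _ hlim0
  refine ⟨hne, ?_⟩
  have := le_of_tendsto_of_tendsto (hlim t hne) hlim0
    (by filter_upwards [self_mem_nhdsWithin] with η h using hη η h t ht)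
  nlinarith

end BRAlpha

end

noncomputable section

namespace BRAlpha

/-! ### Global existence and uniqueness of the Lagrangian flow -/

section Flow

set_option linter.unusedSectionVars false

variable {P : Type*} [TopologicalSpace P] [FirstCountableTopology P] [MeasurableSpace P] [OpensMeasurableSpace P]
  {μ : Measure P} [IsFiniteMeasure μ] {α : ℝ}

/-- The velocity induced at the point of parameter `Γ` by the curve `x` through the kernel `k`. -/
def velocity (k : Plane → Plane) (μ : Measure P) (x : P → Plane) (Γ : P) : Plane :=
  ∫ Γ', k (x Γ - x Γ') ∂μ

theorem integrable_velocity {k : Plane → Plane} {C : ℝ} (hk : Continuous k) (hC : ∀ X, ‖k X‖ ≤ C)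
    {x : P → Plane} (hx : Continuous x) (a : Plane) : Integrable (fun Γ' => k (a - x Γ')) μ :=
  Integrable.of_bound (hk.comp (continuous_const.sub hx)).aestronglyMeasurable C
    (Eventually.of_forall fun _ => hC _)

theorem norm_velocity_le {k : Plane → Plane} {C : ℝ} (hC : ∀ X, ‖k X‖ ≤ C)
    (x : P → Plane) (Γ : P) : ‖velocity k μ x Γ‖ ≤ C * μ.real univ :=
  norm_integral_le_of_norm_le_const (Eventually.of_forall fun _ => hC _)

theorem norm_velocity_sub_le {k k' : Plane → Plane} {C C' : ℝ} (hk : Continuous k)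
    (hk' : Continuous k') (hC : ∀ X, ‖k X‖ ≤ C) (hC' : ∀ X, ‖k' X‖ ≤ C') {x y : P → Plane}
    (hx : Continuous x) (hy : Continuous y) {Γ₁ Γ₂ : P} {g : P → ℝ} (hg : Integrable g μ)
    (h : ∀ᵐ Γ' ∂μ, ‖k (x Γ₁ - x Γ') - k' (y Γ₂ - y Γ')‖ ≤ g Γ') :
    ‖velocity k μ x Γ₁ - velocity k' μ y Γ₂‖ ≤ ∫ Γ', g Γ' ∂μ := by
  rw [velocity, velocity, ← integral_sub (integrable_velocity hk hC hx _)
    (integrable_velocity hk' hC' hy _)]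
  exact norm_integral_le_of_norm_le hg h

/-- `X` moves with the velocity induced by the kernel truncated at scale `ε`. -/
def IsFlow (α : ℝ) (μ : Measure P) (ε T : ℝ) (x₀ : P → Plane) (X : ℝ → P → Plane) : Prop :=
  (∀ t ∈ Icc (-T) T, Continuous (X t)) ∧ X 0 = x₀ ∧
    ∀ Γ, ∀ t ∈ Icc (-T) T, HasDerivWithinAt (fun s => X s Γ)
      (velocity (truncKernel α ε) μ (X t) Γ) (Icc (-T) T) t

theorem continuous_truncKernel (hα : 0 < α) {ε : ℝ} (hε : 0 ≤ ε) :
    Continuous (truncKernel α ε) := by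
  rcases hε.eq_or_lt with rfl | hε
  · rw [show truncKernel α 0 = kernel α from funext (truncKernel_zero hα)]
    exact continuous_kernel hα
  · exact (lipschitzWith_truncKernel hα hε).choose_spec.continuous

/-- The velocity of the truncated kernel as a vector field on bounded continuous curves. -/
def velocityField {k : Plane → Plane} {C : ℝ} (hC : ∀ X, ‖k X‖ ≤ C)
    (μ : Measure P) [IsFiniteMeasure μ] (hk : Continuous k)
    (x : BoundedContinuousFunction P Plane) : BoundedContinuousFunction P Plane :=
  BoundedContinuousFunction.ofNormedAddCommGroup (velocity k μ x)
    (continuous_of_dominated (bound := fun _ => C)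
      (fun _ => (integrable_velocity hk hC x.continuous _).aestronglyMeasurable)
      (fun _ => Eventually.of_forall fun _ => hC _) (integrable_const _)
      (Eventually.of_forall fun _ => hk.comp (x.continuous.sub continuous_const)))
    (C * μ.real univ) (norm_velocity_le hC x)

/-- For `ε > 0` the velocity is a bounded, globally Lipschitz vector field on the Banach space of
bounded continuous curves. -/
theorem exists_isFlow_trunc (hα : 0 < α) {ε T : ℝ} (hε : 0 < ε) (hT : 0 ≤ T)
    (x₀ : BoundedContinuousFunction P Plane) : ∃ X, IsFlow α μ ε T x₀ X := by
  obtain ⟨C, hC0, hC⟩ := norm_truncKernel_le hα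
  obtain ⟨K, hK⟩ := lipschitzWith_truncKernel hα hε
  have hC := hC ε hε.le
  obtain ⟨X, hX0, hX⟩ := exists_solution_of_bounded_lipschitz (T := T)
    (F := fun _ => velocityField hC μ hK.continuous)
    (K := ⟨K * 2 * μ.real univ, by positivity⟩) (L := C * μ.real univ) hT
    (fun t _ => LipschitzWith.of_dist_le_mul fun x y => by
      refine (BoundedContinuousFunction.dist_le (mul_nonneg (NNReal.coe_nonneg _) dist_nonneg)).2 fun Γ => ?_
      rw [dist_eq_norm]
      refine (norm_velocity_sub_le hK.continuous hK.continuous hC hC x.continuous y.continuous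
        (g := fun _ => K * (2 * dist x y)) (integrable_const _)
        (Eventually.of_forall fun Γ' => ?_)).trans ?_
      · refine (hK.norm_sub_le _ _).trans ?_
        gcongr
        have h1 := x.dist_coe_le_dist (g := y) Γ
        have h2 := x.dist_coe_le_dist (g := y) Γ'
        rw [dist_eq_norm] at h1 h2
        calc ‖x Γ - x Γ' - (y Γ - y Γ')‖ = ‖(x Γ - y Γ) - (x Γ' - y Γ')‖ := by congr 1; abel
          _ ≤ _ := norm_sub_le _ _
          _ ≤ _ := by linarith
      · rw [integral_const, smul_eq_mul]
        apply le_of_eq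
        change _ = (K * 2 * μ.real univ) * dist x y
        ring)
    (fun x => continuousOn_const)
    (fun t _ x => BoundedContinuousFunction.norm_ofNormedAddCommGroup_le _ (by positivity) _) x₀
  refine ⟨fun t => X t, fun t _ => (X t).continuous, by simp [hX0], fun Γ t ht => ?_⟩
  exact (BoundedContinuousFunction.evalCLM ℝ Γ).hasFDerivAt.comp_hasDerivWithinAt t (hX t ht)

theorem IsFlow.norm_sub_le (hα : 0 < α) :
    ∃ C, 0 ≤ C ∧ ∀ ε T x₀ X, 0 ≤ ε → 0 ≤ T → IsFlow α μ ε T x₀ X →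
      ∀ t ∈ Icc (-T) T, ∀ Γ, ‖X t Γ - x₀ Γ‖ ≤ C * T := by
  obtain ⟨C, hC0, hC⟩ := norm_truncKernel_le hα
  refine ⟨C * μ.real univ, by positivity, fun ε T x₀ X hε hT hX t ht Γ => ?_⟩
  have h := norm_sub_le_of_hasDerivWithinAt (hX.2.2 Γ)
    (fun t _ => norm_velocity_le (hC ε hε) _ _) (show (0 : ℝ) ∈ Icc (-T) T from ⟨by linarith, hT⟩) ht
  rw [hX.2.1, sub_zero] at h
  refine h.trans ?_
  gcongr
  exact abs_le.2 ht

/-! ### Non-concentration of the curve and the Lipschitz bounds it implies. -/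

/-- The points of the curve do not concentrate: the logarithm of the distance to any point of the
curve is integrable, with a uniform bound. -/
def LogIntegrable (μ : Measure P) (Λ : ℝ) (x₀ : P → Plane) : Prop :=
  ∀ Γ, (∀ᵐ Γ' ∂μ, x₀ Γ ≠ x₀ Γ') ∧ Integrable (fun Γ' => |log ‖x₀ Γ - x₀ Γ'‖|) μ ∧
    ∫ Γ', |log ‖x₀ Γ - x₀ Γ'‖| ∂μ ≤ Λ

/-- The same with the one-sided weight `ell`. -/
def EllIntegrable (μ : Measure P) (Λ : ℝ) (x : P → Plane) : Prop :=
  ∀ Γ, (∀ᵐ Γ' ∂μ, x Γ ≠ x Γ') ∧ Integrable (fun Γ' => ell ‖x Γ - x Γ'‖) μ ∧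
    ∫ Γ', ell ‖x Γ - x Γ'‖ ∂μ ≤ Λ

theorem measurable_ell : Measurable ell := by unfold ell; fun_prop

/-- By `truncKernel_two_point_le`, integrated over the curve, the difference of any two points
satisfies the hypothesis of `log_gronwall` with a constant independent of `ε`. So `|log|` of each
chord is bounded affinely by its initial value, and integrability is inherited. -/
theorem IsFlow.ellIntegrable (hα : 0 < α) {T Λ₀ : ℝ} {x₀ : P → Plane} (hT : 0 ≤ T)
    (h₀ : LogIntegrable μ Λ₀ x₀) :
    ∃ Λ, 0 ≤ Λ ∧ ∀ ε X, 0 ≤ ε → IsFlow α μ ε T x₀ X →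
      ∀ t ∈ Icc (-T) T, EllIntegrable μ Λ (X t) := by
  obtain ⟨C₁, hC₁, H₁⟩ := truncKernel_two_point_le hα
  obtain ⟨C₂, hC₂, H₂⟩ := norm_truncKernel_le hα
  set C := C₁ * μ.real univ with hC
  have hC0 : 0 ≤ C := by positivity
  set E := exp (2 * (2 * C) * (2 * T)) with hE
  refine ⟨μ.real univ * (1 + 2 * (2 * C * (2 * T)) * E) + 2 * E * |Λ₀|, by positivity,
    fun ε X hε hX t ht Γ => ?_⟩
  have hk := continuous_truncKernel hα hε
  have key : ∀ Γ', x₀ Γ ≠ x₀ Γ' → X t Γ ≠ X t Γ' ∧ |log ‖X t Γ - X t Γ'‖| ≤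
      2 * (|log ‖x₀ Γ - x₀ Γ'‖| + 2 * C * (2 * T)) * E := by
    intro Γ' hne
    have h := log_gronwall (ξ := fun s => X s Γ - X s Γ') hT hC0
      (fun s hs => (hX.2.2 Γ s hs).sub (hX.2.2 Γ' s hs)) (fun s hs => ?_)
      (by simp only [hX.2.1]; exact sub_ne_zero.2 hne) t ht
    · simp only [hX.2.1] at h
      exact ⟨sub_ne_zero.1 h.1, h.2⟩
    · by_cases heq : X s Γ = X s Γ'
      · rw [velocity, velocity, heq]; simp
      · refine (norm_velocity_sub_le hk hk (H₂ ε hε) (H₂ ε hε) (hX.1 s hs) (hX.1 s hs)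
          (g := fun _ => C₁ * ‖X s Γ - X s Γ'‖ * ell ‖X s Γ - X s Γ'‖) (integrable_const _)
          (Eventually.of_forall fun Γ'' => ?_)).trans ?_
        · have := H₁ ε hε (X s Γ - X s Γ'') (X s Γ' - X s Γ'') (by simpa using heq)
          rwa [sub_sub_sub_cancel_right] at this
        · rw [integral_const, smul_eq_mul, hC]
          calc μ.real univ * (C₁ * ‖X s Γ - X s Γ'‖ * ell ‖X s Γ - X s Γ'‖)
              ≤ μ.real univ * (C₁ * ‖X s Γ - X s Γ'‖ * (1 + |log ‖X s Γ - X s Γ'‖|)) := by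
                gcongr; exact ell_le_abs_log _
            _ = _ := by ring
  obtain ⟨h1, h2, h3⟩ := h₀ Γ
  have hbound : ∀ᵐ Γ' ∂μ, ‖ell ‖X t Γ - X t Γ'‖‖ ≤
      (1 + 2 * (2 * C * (2 * T)) * E) + 2 * E * |log ‖x₀ Γ - x₀ Γ'‖| := by
    filter_upwards [h1] with Γ' hne
    have := (key Γ' hne).2
    have h5 := ell_le_abs_log ‖X t Γ - X t Γ'‖
    rw [Real.norm_of_nonneg (zero_le_one.trans (one_le_ell _))]
    linarith
  have hint : Integrable (fun Γ' => (1 + 2 * (2 * C * (2 * T)) * E) +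
      2 * E * |log ‖x₀ Γ - x₀ Γ'‖|) μ := (integrable_const _).add (h2.const_mul _)
  have hm : AEStronglyMeasurable (fun Γ' => ell ‖X t Γ - X t Γ'‖) μ :=
    (measurable_ell.comp
      (continuous_const.sub (hX.1 t ht)).norm.measurable).aestronglyMeasurable
  refine ⟨h1.mono fun Γ' h => (key Γ' h).1, hint.mono' hm hbound, ?_⟩
  refine (Real.le_norm_self _).trans ((norm_integral_le_of_norm_le hint hbound).trans ?_)
  rw [integral_add (integrable_const _) (h2.const_mul _), integral_const, integral_const_mul,
    smul_eq_mul]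
  have hE0 : 0 < E := exp_pos _
  gcongr
  exact h3.trans (le_abs_self _)

/-- Two-sided Lipschitz control of a flow by its initial curve. -/
theorem EllIntegrable.norm_velocity_sub_le (hα : 0 < α) :
    ∃ C, 0 ≤ C ∧ ∀ ε Λ (x : P → Plane), 0 ≤ ε → Continuous x → EllIntegrable μ Λ x → ∀ Γ Γ',
      ‖velocity (truncKernel α ε) μ x Γ - velocity (truncKernel α ε) μ x Γ'‖ ≤
        C * Λ * ‖x Γ - x Γ'‖ := by
  -- The logarithm falls on the chord `x Γ - x Γ''`, whose weight integrates to at most `Λ`; the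
  -- velocity is therefore Lipschitz along the curve, with no logarithmic loss.
  obtain ⟨C₁, hC₁, H₁⟩ := truncKernel_sub_le_left hα
  obtain ⟨C₂, hC₂, H₂⟩ := norm_truncKernel_le hα
  refine ⟨C₁, hC₁, fun ε Λ x hε hx hΛx Γ Γ' => ?_⟩
  have hk := continuous_truncKernel hα hε
  obtain ⟨h1, h2, h3⟩ := hΛx Γ
  refine (BRAlpha.norm_velocity_sub_le hk hk (H₂ ε hε) (H₂ ε hε) hx hx
    (g := fun Γ'' => C₁ * ‖x Γ - x Γ'‖ * ell ‖x Γ - x Γ''‖) (h2.const_mul _) ?_).trans ?_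
  · filter_upwards [h1] with Γ'' hne
    have := H₁ ε hε (x Γ - x Γ'') (x Γ' - x Γ'') (sub_ne_zero.2 hne)
    rwa [sub_sub_sub_cancel_right] at this
  · rw [integral_const_mul]
    calc C₁ * ‖x Γ - x Γ'‖ * ∫ Γ'', ell ‖x Γ - x Γ''‖ ∂μ
        ≤ C₁ * ‖x Γ - x Γ'‖ * Λ := by gcongr
      _ = _ := by ring

/-- Grönwall from time `0` to `t` gives the upper bound, and from `t` back to `0` the lower one,
which preserves the chord-arc property. -/
theorem IsFlow.biLipschitz (hα : 0 < α) {T Λ : ℝ} {x₀ : P → Plane} (hT : 0 ≤ T) (hΛ : 0 ≤ Λ) :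
    ∃ L, 0 ≤ L ∧ ∀ ε X, 0 ≤ ε → IsFlow α μ ε T x₀ X →
      (∀ t ∈ Icc (-T) T, EllIntegrable μ Λ (X t)) → ∀ t ∈ Icc (-T) T, ∀ Γ Γ',
        ‖X t Γ - X t Γ'‖ ≤ L * ‖x₀ Γ - x₀ Γ'‖ ∧ ‖x₀ Γ - x₀ Γ'‖ ≤ L * ‖X t Γ - X t Γ'‖ := by
  obtain ⟨C₁, hC₁, H₁⟩ := EllIntegrable.norm_velocity_sub_le (μ := μ) hα
  refine ⟨2 * exp (2 * (C₁ * Λ) * (2 * T)), by positivity, fun ε X hε hX hΛX t ht Γ Γ' => ?_⟩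
  have h0 : (0 : ℝ) ∈ Icc (-T) T := ⟨by linarith, hT⟩
  have hb : ∀ s ∈ Icc (-T) T, ‖velocity (truncKernel α ε) μ (X s) Γ -
      velocity (truncKernel α ε) μ (X s) Γ'‖ ≤ C₁ * Λ * ‖X s Γ - X s Γ'‖ + 0 := by
    intro s hs
    rw [add_zero]
    exact H₁ ε Λ (X s) hε (hX.1 s hs) (hΛX s hs) Γ Γ'
  have hd := fun s hs => (hX.2.2 Γ s hs).sub (hX.2.2 Γ' s hs)
  constructor
  · have := gronwall (f := fun s => X s Γ - X s Γ') h0 (by positivity) le_rfl hd hb t ht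
    simp only [hX.2.1] at this
    linarith
  · have := gronwall (f := fun s => X s Γ - X s Γ') ht (by positivity) le_rfl hd hb 0 h0
    simp only [hX.2.1] at this
    linarith

/-- Stability of the velocity with respect to the curve and the truncation. -/
theorem velocity_stability (hα : 0 < α) :
    ∃ C, 0 ≤ C ∧ ∀ ε ε' Λ (x y : P → Plane), 0 ≤ ε → 0 ≤ ε' → Continuous x → Continuous y →
      EllIntegrable μ Λ x → ∀ m, (∀ Γ, ‖x Γ - y Γ‖ ≤ m) → ∀ Γ,
      ‖velocity (truncKernel α ε) μ x Γ - velocity (truncKernel α ε') μ y Γ‖ ≤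
        (C * Λ) * m + C * (ε ^ (1 / 2 : ℝ) + ε' ^ (1 / 2 : ℝ)) := by
  obtain ⟨C₁, hC₁, H₁⟩ := truncKernel_sub_le_left hα
  obtain ⟨C₂, hC₂, H₂⟩ := norm_truncKernel_le hα
  obtain ⟨C₃, hC₃, H₃⟩ := truncKernel_sub_kernel_le hα
  have H₃' : ∀ ε, 0 ≤ ε → ∀ X : Plane, ‖truncKernel α ε X - kernel α X‖ ≤ C₃ * ε ^ (1 / 2 : ℝ) := by
    intro ε hε X
    rcases hε.eq_or_lt with rfl | hε
    · rw [truncKernel_zero hα]; simp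
    · exact H₃ ε hε X
  refine ⟨C₁ * 2 + C₃ * μ.real univ, by positivity,
    fun ε ε' Λ x y hε hε' hx hy hΛ m hm Γ => ?_⟩
  have hm0 : 0 ≤ m := (norm_nonneg _).trans (hm Γ)
  obtain ⟨h1, h2, h3⟩ := hΛ Γ
  have hΛ0 : 0 ≤ Λ := (integral_nonneg fun Γ' => zero_le_one.trans (one_le_ell _)).trans h3
  refine (norm_velocity_sub_le (continuous_truncKernel hα hε) (continuous_truncKernel hα hε')
    (H₂ ε hε) (H₂ ε' hε') hx hy
    (g := fun Γ' => C₁ * (2 * m) * ell ‖x Γ - x Γ'‖ +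
      C₃ * (ε ^ (1 / 2 : ℝ) + ε' ^ (1 / 2 : ℝ)))
    ((h2.const_mul _).add (integrable_const _)) ?_).trans ?_
  · filter_upwards [h1] with Γ' hne
    set A := x Γ - x Γ'
    set B := y Γ - y Γ'
    have hAB : ‖A - B‖ ≤ 2 * m := by
      calc ‖x Γ - x Γ' - (y Γ - y Γ')‖ = ‖(x Γ - y Γ) - (x Γ' - y Γ')‖ := by congr 1; abel
        _ ≤ _ := norm_sub_le _ _
        _ ≤ _ := by linarith [hm Γ, hm Γ']
    -- The logarithmic weight is put on the curve `x`, so nothing is asked of `y`; the change of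
    -- truncation is made at the point `B`, where it costs only a power of the scale.
    have e1 := H₁ ε hε A B (sub_ne_zero.2 hne)
    have e2 := H₃' ε hε B
    have e3 := H₃' ε' hε' B
    rw [norm_sub_rev] at e3
    have hell := one_le_ell ‖A‖
    calc ‖truncKernel α ε A - truncKernel α ε' B‖ = ‖(truncKernel α ε A - truncKernel α ε B) +
          ((truncKernel α ε B - kernel α B) + (kernel α B - truncKernel α ε' B))‖ := by
          congr 1; abel
      _ ≤ C₁ * ‖A - B‖ * ell ‖A‖ + (C₃ * ε ^ (1 / 2 : ℝ) + C₃ * ε' ^ (1 / 2 : ℝ)) :=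
          (norm_add_le _ _).trans (add_le_add e1 ((norm_add_le _ _).trans (add_le_add e2 e3)))
      _ ≤ C₁ * (2 * m) * ell ‖A‖ + (C₃ * ε ^ (1 / 2 : ℝ) + C₃ * ε' ^ (1 / 2 : ℝ)) := by gcongr
      _ = _ := by ring
  · rw [integral_add (h2.const_mul _) (integrable_const _), integral_const_mul, integral_const,
      smul_eq_mul]
    have hμ : 0 ≤ μ.real univ := measureReal_nonneg
    have e1 : C₁ * (2 * m) * ∫ Γ', ell ‖x Γ - x Γ'‖ ∂μ ≤ C₁ * (2 * m) * Λ := by gcongr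
    have e2 : 0 ≤ C₃ * μ.real univ * Λ * m := by positivity
    have e3 : 0 ≤ C₁ * 2 * (ε ^ (1 / 2 : ℝ) + ε' ^ (1 / 2 : ℝ)) := by positivity
    linarith

/-- Comparison of two flows with the same initial curve. -/
theorem IsFlow.stability (hα : 0 < α) {T Λ : ℝ} {x₀ : P → Plane} (hT : 0 ≤ T) (hΛ : 0 ≤ Λ) :
    ∃ C, 0 ≤ C ∧ ∀ ε ε' X Y, 0 ≤ ε → 0 ≤ ε' → IsFlow α μ ε T x₀ X → IsFlow α μ ε' T x₀ Y →
      (∀ t ∈ Icc (-T) T, EllIntegrable μ Λ (X t)) → ∀ t ∈ Icc (-T) T, ∀ Γ,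
        ‖X t Γ - Y t Γ‖ ≤ C * (ε ^ (1 / 2 : ℝ) + ε' ^ (1 / 2 : ℝ)) := by
  obtain ⟨C, hC, H⟩ := velocity_stability (μ := μ) hα
  obtain ⟨C', hC', H'⟩ := IsFlow.norm_sub_le (μ := μ) hα
  refine ⟨2 * (C * (2 * T)) * exp (2 * (C * Λ) * (2 * T)), by positivity,
    fun ε ε' X Y hε hε' hX hY hΛX t ht Γ => ?_⟩
  have := sup_gronwall (ι := P) (f := fun Γ s => X s Γ - Y s Γ) (T := T) (K := C * Λ)
    (ε := C * (ε ^ (1 / 2 : ℝ) + ε' ^ (1 / 2 : ℝ))) (δ := 0) (t₀ := 0) (B := 2 * (C' * T))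
    ⟨by linarith, hT⟩ (by positivity) (by positivity)
    (fun Γ s hs => (hX.2.2 Γ s hs).sub (hY.2.2 Γ s hs))
    (fun Γ s hs => by
      have h1 := H' ε T x₀ X hε hT hX s hs Γ
      have h2 := H' ε' T x₀ Y hε' hT hY s hs Γ
      calc ‖X s Γ - Y s Γ‖ = ‖(X s Γ - x₀ Γ) - (Y s Γ - x₀ Γ)‖ := by congr 1; abel
        _ ≤ _ := _root_.norm_sub_le _ _
        _ ≤ _ := by linarith)
    (fun Γ => by simp [hX.2.1, hY.2.1])
    (fun s hs m hm Γ => H ε ε' Λ (X s) (Y s) hε hε' (hX.1 s hs) (hY.1 s hs) (hΛX s hs) m hm Γ)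
    Γ t ht
  calc _ ≤ _ := this
    _ = _ := by ring

/-- Only one of the flows needs integrable logarithms, so uniqueness holds among all flows made of
continuous curves. -/
theorem IsFlow.unique (hα : 0 < α) {T Λ : ℝ} {x₀ : P → Plane} (hT : 0 ≤ T) (hΛ : 0 ≤ Λ)
    {X Y : ℝ → P → Plane} (hX : IsFlow α μ 0 T x₀ X)
    (hY : IsFlow α μ 0 T x₀ Y) (hΛX : ∀ t ∈ Icc (-T) T, EllIntegrable μ Λ (X t)) :
    ∀ t ∈ Icc (-T) T, Y t = X t := by
  obtain ⟨C, hC, H⟩ := IsFlow.stability (μ := μ) hα hT hΛ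
  intro t ht
  ext1 Γ
  have := H 0 0 X Y le_rfl le_rfl hX hY hΛX t ht Γ
  rw [zero_rpow (by norm_num), add_zero, mul_zero] at this
  exact (sub_eq_zero.1 (norm_le_zero_iff.1 this)).symm

/-- Global existence for the kernel without truncation. -/
theorem exists_isFlow (hα : 0 < α) {T Λ₀ : ℝ} (hT : 0 ≤ T)
    (x₀ : BoundedContinuousFunction P Plane) (h₀ : LogIntegrable μ Λ₀ x₀) :
    ∃ X, IsFlow α μ 0 T x₀ X ∧ ∃ L, 0 < L ∧ ∀ t ∈ Icc (-T) T, ∀ Γ Γ',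
      ‖X t Γ - X t Γ'‖ ≤ L * ‖x₀ Γ - x₀ Γ'‖ ∧ ‖x₀ Γ - x₀ Γ'‖ ≤ L * ‖X t Γ - X t Γ'‖ := by
  -- The limit of derivatives is taken on an open time interval; enlarging `T` makes it contain the
  -- endpoints of `[-T, T]`.
  set T' := T + 1 with hT'
  have hT'0 : 0 ≤ T' := by linarith
  obtain ⟨Λ, hΛ, HΛ⟩ := IsFlow.ellIntegrable (μ := μ) hα hT'0 h₀
  obtain ⟨L, hL, HL⟩ := IsFlow.biLipschitz (μ := μ) (x₀ := x₀) hα hT'0 hΛ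
  obtain ⟨C, hC, HC⟩ := IsFlow.stability (μ := μ) (x₀ := x₀) hα hT'0 hΛ
  obtain ⟨D, hD, HD⟩ := velocity_stability (μ := μ) hα
  set e : ℕ → ℝ := fun n => 1 / ((n : ℝ) + 1) with he
  have he0 : ∀ n, 0 < e n := fun n => by positivity
  set w : ℕ → ℝ := fun n => e n ^ (1 / 2 : ℝ) with hw
  have hw0 : ∀ n, 0 ≤ w n := fun n => rpow_nonneg (he0 n).le _
  have hwlim : Tendsto w atTop (𝓝 0) := by
    have h1 : ContinuousAt (fun ε : ℝ => ε ^ (1 / 2 : ℝ)) 0 :=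
      continuousAt_rpow_const _ _ (Or.inr (by norm_num))
    have h2 := h1.tendsto.comp (tendsto_one_div_add_atTop_nhds_zero_nat (𝕜 := ℝ))
    rwa [zero_rpow (by norm_num)] at h2
  choose X hX using fun n => exists_isFlow_trunc (μ := μ) hα (he0 n) hT'0 x₀
  have hcau : ∀ n m, ∀ t ∈ Icc (-T') T', ∀ Γ, ‖X n t Γ - X m t Γ‖ ≤ C * (w n + w m) :=
    fun n m => HC _ _ _ _ (he0 n).le (he0 m).le (hX n) (hX m) (HΛ _ _ (he0 n).le (hX n))
  have hlim : ∀ t Γ, ∃ y, t ∈ Icc (-T') T' → Tendsto (fun n => X n t Γ) atTop (𝓝 y) := by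
    intro t Γ
    by_cases ht : t ∈ Icc (-T') T'
    · have : CauchySeq (fun n => X n t Γ) := by
        rw [Metric.cauchySeq_iff']
        intro ε hε
        have h1 : Tendsto (fun n => C * (w n + w n)) atTop (𝓝 0) := by
          simpa using (hwlim.add hwlim).const_mul C
        obtain ⟨N, hN⟩ := (h1.eventually (gt_mem_nhds hε)).exists_forall_of_atTop
        refine ⟨N, fun n hn => ?_⟩
        rw [dist_eq_norm]
        refine (hcau n N t ht Γ).trans_lt (lt_of_le_of_lt ?_ (hN N le_rfl))
        have hNn : (N : ℝ) ≤ n := by exact_mod_cast hn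
        have : w n ≤ w N := by
          simp only [hw, he]
          gcongr
        gcongr
      obtain ⟨y, hy⟩ := cauchySeq_tendsto_of_complete this
      exact ⟨y, fun _ => hy⟩
    · exact ⟨0, fun h => absurd h ht⟩
  choose x hx using hlim
  have hrate : ∀ n, ∀ t ∈ Icc (-T') T', ∀ Γ, ‖X n t Γ - x t Γ‖ ≤ C * w n := by
    intro n t ht Γ
    have h1 : Tendsto (fun m => ‖X n t Γ - X m t Γ‖) atTop (𝓝 ‖X n t Γ - x t Γ‖) :=
      (tendsto_const_nhds.sub (hx t Γ ht)).norm
    have h2 : Tendsto (fun m => C * (w n + w m)) atTop (𝓝 (C * w n)) := by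
      simpa using (hwlim.const_add (w n)).const_mul C
    exact le_of_tendsto_of_tendsto' h1 h2 (fun m => hcau n m t ht Γ)
  have hbi : ∀ t ∈ Icc (-T') T', ∀ Γ Γ', ‖x t Γ - x t Γ'‖ ≤ L * ‖x₀ Γ - x₀ Γ'‖ ∧
      ‖x₀ Γ - x₀ Γ'‖ ≤ L * ‖x t Γ - x t Γ'‖ := by
    intro t ht Γ Γ'
    have h1 := ((hx t Γ ht).sub (hx t Γ' ht)).norm
    have h2 := fun n => HL _ _ (he0 n).le (hX n) (HΛ _ _ (he0 n).le (hX n)) t ht Γ Γ'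
    exact ⟨le_of_tendsto' h1 fun n => (h2 n).1, ge_of_tendsto' (h1.const_mul L) fun n => (h2 n).2⟩
  have hcont : ∀ t ∈ Icc (-T') T', Continuous (x t) := by
    intro t ht
    rw [continuous_iff_continuousAt]
    intro Γ
    rw [ContinuousAt, tendsto_iff_norm_sub_tendsto_zero]
    have h1 : Tendsto (fun Γ' => L * ‖x₀ Γ' - x₀ Γ‖) (𝓝 Γ) (𝓝 0) := by
      have := (tendsto_iff_norm_sub_tendsto_zero.1 (x₀.continuous.tendsto Γ)).const_mul L
      rwa [mul_zero] at this
    exact squeeze_zero (fun _ => norm_nonneg _) (fun Γ' => (hbi t ht Γ' Γ).1) h1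
  have h00 : (0 : ℝ) ∈ Icc (-T') T' := ⟨by linarith, hT'0⟩
  have hsub : Icc (-T) T ⊆ Ioo (-T') T' := fun t ht => ⟨by linarith [ht.1], by linarith [ht.2]⟩
  have hsub' : Icc (-T) T ⊆ Icc (-T') T' := hsub.trans Ioo_subset_Icc_self
  refine ⟨x, ⟨fun t ht => hcont t (hsub' ht), ?_, fun Γ t ht => ?_⟩, L + 1, by positivity,
    fun t ht Γ Γ' => ?_⟩
  · ext1 Γ
    refine tendsto_nhds_unique (hx 0 Γ h00) ?_
    simp only [(hX _).2.1]
    exact tendsto_const_nhds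
  · refine (hasDerivAt_of_tendstoUniformlyOn (l := atTop) (s := Ioo (-T') T') isOpen_Ioo
      (f := fun n s => X n s Γ) (f' := fun n s => velocity (truncKernel α (e n)) μ (X n s) Γ)
      (g' := fun s => velocity (truncKernel α 0) μ (x s) Γ) ?_ ?_ ?_ (hsub ht)).hasDerivWithinAt
    · rw [Metric.tendstoUniformlyOn_iff]
      intro ε hε
      have h1 : Tendsto (fun n => D * Λ * (C * w n) + D * (w n + 0)) atTop (𝓝 0) := by
        have := ((hwlim.const_mul C).const_mul (D * Λ)).add ((hwlim.add_const 0).const_mul D)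
        simpa using this
      filter_upwards [h1.eventually (gt_mem_nhds hε)] with n hn s hs
      have hs' := Ioo_subset_Icc_self hs
      rw [dist_comm, dist_eq_norm]
      refine lt_of_le_of_lt ?_ hn
      have := HD (e n) 0 Λ (X n s) (x s) (he0 n).le le_rfl ((hX n).1 s hs') (hcont s hs')
        (HΛ _ _ (he0 n).le (hX n) s hs') (C * w n) (hrate n s hs') Γ
      rwa [zero_rpow (by norm_num)] at this
    · exact Eventually.of_forall fun n s hs => ((hX n).2.2 Γ s (Ioo_subset_Icc_self hs)).hasDerivAt
        (Icc_mem_nhds hs.1 hs.2)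
    · exact fun s hs => hx s Γ (Ioo_subset_Icc_self hs)
  · obtain ⟨h1, h2⟩ := hbi t (hsub' ht) Γ Γ'
    have := norm_nonneg (x₀ Γ - x₀ Γ')
    have := norm_nonneg (x t Γ - x t Γ')
    constructor <;> linarith

end Flow

end BRAlpha

end

noncomputable section

namespace BRAlpha

/-! ### Symbols: functions singular on the kernel of a projection -/

section Symbols

set_option linter.unusedSectionVars false

variable {E : Type} [NormedAddCommGroup E] [NormedSpace ℝ E]
  {F : Type} [NormedAddCommGroup F] [NormedSpace ℝ F]
  {G : Type} [NormedAddCommGroup G] [NormedSpace ℝ G]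
  {H : Type} [NormedAddCommGroup H] [NormedSpace ℝ H]
  {pr : E →L[ℝ] Plane}

/-- The bounded conical region of vectors controlled by their projection. -/
def Cone (pr : E →L[ℝ] Plane) (R : ℝ) : Set E := {z | pr z ≠ 0 ∧ ‖z‖ ≤ R * ‖pr z‖ ∧ ‖z‖ ≤ R}

/-- `f` grows at most like the power `d` of the projection, up to arbitrarily small powers. -/
def ConeBound (pr : E →L[ℝ] Plane) (d : ℝ) (f : E → F) : Prop :=
  ∀ ε : ℝ, 0 < ε → ε ≤ 1 → ∀ R : ℝ, ∃ C, 0 ≤ C ∧ ∀ z ∈ Cone pr R, ‖f z‖ ≤ C * ‖pr z‖ ^ (d - ε)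

/-- Symbols of order `d`: `n` derivatives exist where the projection does not vanish, each of them
lowering the order by one. -/
def Symb (pr : E →L[ℝ] Plane) : ℕ → ℝ → ∀ {F : Type} [NormedAddCommGroup F] [NormedSpace ℝ F],
    (E → F) → Prop
  | 0, d, _, _, _, f => ConeBound pr d f
  | n + 1, d, _, _, _, f => ConeBound pr d f ∧ (∀ z, pr z ≠ 0 → DifferentiableAt ℝ f z) ∧
      Symb pr n (d - 1) (fderiv ℝ f)

theorem Cone.norm_pr_le {R : ℝ} {z : E} (hz : z ∈ Cone pr R) : ‖pr z‖ ≤ ‖pr‖ * R + 1 := by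
  have := pr.le_of_opNorm_le_of_le le_rfl hz.2.2
  linarith

theorem Cone.nonneg {R : ℝ} {z : E} (hz : z ∈ Cone pr R) : 0 ≤ R := (norm_nonneg z).trans hz.2.2

theorem Cone.pos {R : ℝ} {z : E} (hz : z ∈ Cone pr R) : 0 < ‖pr z‖ := norm_pos_iff.2 hz.1

theorem isOpen_pr_ne_zero (pr : E →L[ℝ] Plane) : IsOpen {z : E | pr z ≠ 0} :=
  isOpen_ne_fun pr.continuous continuous_const

/-- On a cone the projection is bounded, so its `ε`-th power can be given away. -/
theorem ConeBound.of_le {d : ℝ} {f : E → F}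
    (h : ∀ R, ∃ C, 0 ≤ C ∧ ∀ z ∈ Cone pr R, ‖f z‖ ≤ C * ‖pr z‖ ^ d) : ConeBound pr d f := by
  intro ε hε _ R
  obtain ⟨C, hC, H⟩ := h R
  refine ⟨C * (max (‖pr‖ * R + 1) 0) ^ ε, by positivity, fun z hz => (H z hz).trans ?_⟩
  have hr := Cone.pos hz
  rw [mul_assoc]
  gcongr
  calc ‖pr z‖ ^ d = ‖pr z‖ ^ ε * ‖pr z‖ ^ (d - ε) := by rw [← rpow_add hr]; congr 1; ring
    _ ≤ _ := by gcongr; exact (Cone.norm_pr_le hz).trans (le_max_left _ _)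

theorem Symb.of_succ {n : ℕ} {d : ℝ} {f : E → F} (h : Symb pr (n + 1) d f) : Symb pr n d f := by
  induction n generalizing F d with
  | zero => exact h.1
  | succ n ih => exact ⟨h.1, h.2.1, ih h.2.2⟩

theorem Symb.congr {n : ℕ} {d : ℝ} {f g : E → F} (h : Symb pr n d f)
    (hfg : ∀ z, pr z ≠ 0 → f z = g z) : Symb pr n d g := by
  have hb : ∀ {F : Type} [NormedAddCommGroup F] [NormedSpace ℝ F] {d : ℝ} {f g : E → F},
      ConeBound pr d f → (∀ z, pr z ≠ 0 → f z = g z) → ConeBound pr d g := by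
    intro F _ _ d f g hf hfg ε hε hε1 R
    obtain ⟨C, hC, H⟩ := hf ε hε hε1 R
    exact ⟨C, hC, fun z hz => by rw [← hfg z hz.1]; exact H z hz⟩
  induction n generalizing F d with
  | zero => exact hb h hfg
  | succ n ih =>
    have he : ∀ z, pr z ≠ 0 → f =ᶠ[𝓝 z] g := fun z hz => by
      filter_upwards [(isOpen_pr_ne_zero pr).mem_nhds hz] with w hw using hfg w hw
    exact ⟨hb h.1 hfg, fun z hz => (h.2.1 z hz).congr_of_eventuallyEq (he z hz).symm,
      ih h.2.2 fun z hz => (he z hz).fderiv_eq⟩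

theorem ConeBound.add {d : ℝ} {f g : E → F} (hf : ConeBound pr d f) (hg : ConeBound pr d g) :
    ConeBound pr d (fun z => f z + g z) := by
  intro ε hε hε1 R
  obtain ⟨C, hC, H⟩ := hf ε hε hε1 R
  obtain ⟨C', hC', H'⟩ := hg ε hε hε1 R
  refine ⟨C + C', by positivity, fun z hz => ?_⟩
  rw [add_mul]
  exact (norm_add_le _ _).trans (add_le_add (H z hz) (H' z hz))

theorem Symb.add {n : ℕ} {d : ℝ} {f g : E → F} (hf : Symb pr n d f) (hg : Symb pr n d g) :
    Symb pr n d (fun z => f z + g z) := by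
  induction n generalizing F d with
  | zero => exact ConeBound.add hf hg
  | succ n ih =>
    exact ⟨hf.1.add hg.1, fun z hz => (hf.2.1 z hz).add (hg.2.1 z hz),
      (ih hf.2.2 hg.2.2).congr fun z hz => (fderiv_fun_add (hf.2.1 z hz) (hg.2.1 z hz)).symm⟩

theorem ConeBound.bilinear (B : F →L[ℝ] G →L[ℝ] H) {d d' : ℝ} {f : E → F} {g : E → G}
    (hf : ConeBound pr d f) (hg : ConeBound pr d' g) :
    ConeBound pr (d + d') (fun z => B (f z) (g z)) := by
  intro ε hε hε1 R
  obtain ⟨C, hC, h⟩ := hf (ε / 2) (by positivity) (by linarith) R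
  obtain ⟨C', hC', h'⟩ := hg (ε / 2) (by positivity) (by linarith) R
  refine ⟨‖B‖ * C * C', by positivity, fun z hz => (B.le_opNorm₂ _ _).trans ?_⟩
  have h1 := h z hz
  have h2 := h' z hz
  calc ‖B‖ * ‖f z‖ * ‖g z‖
      ≤ ‖B‖ * (C * ‖pr z‖ ^ (d - ε / 2)) * (C' * ‖pr z‖ ^ (d' - ε / 2)) := by gcongr
    _ = ‖B‖ * C * C' * (‖pr z‖ ^ (d - ε / 2) * ‖pr z‖ ^ (d' - ε / 2)) := by ring
    _ = _ := by rw [← rpow_add (Cone.pos hz)]; congr 2; ring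

theorem Symb.bilinear {n : ℕ} (B : F →L[ℝ] G →L[ℝ] H) {d d' d'' : ℝ} {f : E → F} {g : E → G}
    (hf : Symb pr n d f) (hg : Symb pr n d' g) (hd : d'' = d + d') :
    Symb pr n d'' (fun z => B (f z) (g z)) := by
  subst hd
  induction n generalizing F G H d d' with
  | zero => exact ConeBound.bilinear B hf hg
  | succ n ih =>
    refine ⟨hf.1.bilinear B hg.1, fun z hz =>
      (B.hasFDerivAt_of_bilinear (hf.2.1 z hz).hasFDerivAt
        (hg.2.1 z hz).hasFDerivAt).differentiableAt, ?_⟩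
    have h1 := ih (B.precompR E) hf.of_succ hg.2.2
    have h2 := ih (B.precompL E) hf.2.2 hg.of_succ
    rw [show d + (d' - 1) = d + d' - 1 by ring] at h1
    rw [show d - 1 + d' = d + d' - 1 by ring] at h2
    exact (h1.add h2).congr fun z hz =>
      (B.fderiv_of_bilinear (hf.2.1 z hz) (hg.2.1 z hz)).symm

theorem Symb.zero (n : ℕ) (d : ℝ) : Symb pr n d (fun _ : E => (0 : F)) := by
  have hb : ∀ {F : Type} [NormedAddCommGroup F] [NormedSpace ℝ F] (d : ℝ),
      ConeBound pr d (fun _ : E => (0 : F)) := fun d =>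
    ConeBound.of_le fun R => ⟨0, le_rfl, fun z _ => by simp⟩
  induction n generalizing F d with
  | zero => exact hb d
  | succ n ih =>
    refine ⟨hb d, fun z _ => differentiableAt_const _, ?_⟩
    have : fderiv ℝ (fun _ : E => (0 : F)) = fun _ => 0 := by ext1 z; simp
    rw [this]
    exact ih _

theorem Symb.const (n : ℕ) (c : F) : Symb pr n 0 (fun _ : E => c) := by
  have hb : ConeBound pr 0 (fun _ : E => c) :=
    ConeBound.of_le fun R => ⟨‖c‖, norm_nonneg _, fun z _ => by simp⟩
  cases n with
  | zero => exact hb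
  | succ n =>
    refine ⟨hb, fun z _ => differentiableAt_const _, ?_⟩
    have : fderiv ℝ (fun _ : E => c) = fun _ => 0 := by ext1 z; simp
    rw [this]
    exact Symb.zero _ _

/-- On a cone the whole vector is controlled by its projection, so every linear map has order one,
including those that do not factor through `pr`. -/
theorem Symb.clm (n : ℕ) (L : E →L[ℝ] F) : Symb pr n 1 L := by
  have hb : ConeBound pr 1 L := ConeBound.of_le fun R =>
    ⟨‖L‖ * max R 0, by positivity, fun z hz => by
      rw [rpow_one, mul_assoc]
      refine L.le_of_opNorm_le_of_le le_rfl (hz.2.1.trans ?_)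
      gcongr
      exact le_max_left _ _⟩
  cases n with
  | zero => exact hb
  | succ n =>
    refine ⟨hb, fun z _ => L.differentiableAt, ?_⟩
    have : fderiv ℝ L = fun _ => L := by ext1 z; simp
    rw [this, sub_self]
    exact Symb.const _ _

theorem Symb.postcomp {n : ℕ} {d : ℝ} {f : E → F} (L : F →L[ℝ] G) (hf : Symb pr n d f) :
    Symb pr n d (fun z => L (f z)) :=
  (Symb.const n L).bilinear (ContinuousLinearMap.id ℝ (F →L[ℝ] G)) hf (by ring)

theorem Symb.comp_fst {E' : Type} [NormedAddCommGroup E'] [NormedSpace ℝ E'] {n : ℕ} {d : ℝ}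
    {f : E → F} (hf : Symb pr n d f) :
    Symb (pr.comp (ContinuousLinearMap.fst ℝ E E')) n d (fun z : E × E' => f z.1) := by
  have hb : ∀ {F : Type} [NormedAddCommGroup F] [NormedSpace ℝ F] {d : ℝ} {f : E → F},
      ConeBound pr d f →
        ConeBound (pr.comp (ContinuousLinearMap.fst ℝ E E')) d (fun z : E × E' => f z.1) := by
    intro F _ _ d f hf ε hε hε1 R
    obtain ⟨C, hC, h⟩ := hf ε hε hε1 R
    exact ⟨C, hC, fun z hz => h z.1 ⟨hz.1, (norm_fst_le z).trans hz.2.1,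
      (norm_fst_le z).trans hz.2.2⟩⟩
  induction n generalizing F d with
  | zero => exact hb hf
  | succ n ih =>
    refine ⟨hb hf.1, fun z hz => (hf.2.1 z.1 hz).comp z differentiableAt_fst, ?_⟩
    refine ((ih hf.2.2).postcomp ((ContinuousLinearMap.compL ℝ (E × E') E F).flip
      (ContinuousLinearMap.fst ℝ E E'))).congr fun z hz => ?_
    exact (((hf.2.1 z.1 hz).hasFDerivAt.comp z hasFDerivAt_fst).fderiv).symm

/-- The tangent map of a kernel. -/
def tangentKernel (K : E → E) (z : E × E) : E × E := (K z.1, fderiv ℝ K z.1 z.2)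

/-- The derivative of `K` has order zero and the second component has order one on cones, so the
tangent map keeps the order and loses only one degree of differentiability. -/
theorem Symb.tangent {n : ℕ} {K : E → E} (hK : Symb pr (n + 1) 1 K) :
    Symb (pr.comp (ContinuousLinearMap.fst ℝ E E)) n 1 (tangentKernel K) := by
  have h1 := (hK.of_succ.comp_fst (E' := E)).postcomp (ContinuousLinearMap.inl ℝ E E)
  have h2 := ((hK.2.2.comp_fst (E' := E)).bilinear (ContinuousLinearMap.id ℝ (E →L[ℝ] E))
    (Symb.clm n (ContinuousLinearMap.snd ℝ E E)) (d'' := 1) (by ring)).postcomp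
    (ContinuousLinearMap.inr ℝ E E)
  exact (h1.add h2).congr fun z _ => by simp [tangentKernel]

/-- Segments which are short compared with the size of the projection stay in a cone. -/
theorem Cone.segment {R : ℝ} {z w : E} (hz : z ∈ Cone pr R) (hw : w ∈ Cone pr R)
    (hwz : ‖pr w‖ ≤ ‖pr z‖) (hnear : 2 * (‖pr‖ + 1) * ‖z - w‖ ≤ ‖pr z‖) :
    ∀ v ∈ segment ℝ w z, ‖pr z‖ / 2 ≤ ‖pr v‖ ∧ v ∈ Cone pr (2 * R) := by
  intro v hv
  have hz0 := Cone.pos hz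
  have hR := Cone.nonneg hz
  have h1 : ‖z - v‖ ≤ ‖z - w‖ := by
    have := (convex_closedBall z ‖z - w‖).segment_subset
      (mem_closedBall_iff_norm'.2 le_rfl) (by simp) hv
    exact mem_closedBall_iff_norm'.1 this
  have h2 : ‖v‖ ≤ max ‖w‖ ‖z‖ := by
    have := (convex_closedBall (0 : E) (max ‖w‖ ‖z‖)).segment_subset
      (by simp) (by simp) hv
    simpa using this
  have h3 : ‖pr z‖ / 2 ≤ ‖pr v‖ := by
    have e1 : ‖pr z‖ ≤ ‖pr v‖ + ‖pr (z - v)‖ := by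
      calc ‖pr z‖ = ‖pr v + pr (z - v)‖ := by rw [← map_add]; congr 2; abel
        _ ≤ _ := norm_add_le _ _
    have e2 : ‖pr (z - v)‖ ≤ (‖pr‖ + 1) * ‖z - w‖ :=
      pr.le_of_opNorm_le_of_le (by linarith) h1
    linarith
  have h4 : max ‖w‖ ‖z‖ ≤ R * ‖pr z‖ :=
    max_le (hw.2.1.trans (by gcongr)) hz.2.1
  refine ⟨h3, norm_pos_iff.1 (by linarith), ?_, ?_⟩
  · calc ‖v‖ ≤ R * ‖pr z‖ := h2.trans h4
      _ = 2 * R * (‖pr z‖ / 2) := by ring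
      _ ≤ _ := by gcongr
  · exact h2.trans ((max_le hw.2.2 hz.2.2).trans (by linarith))

/-- The two-point estimate for symbols of order at most one. -/
theorem Symb.holder {d : ℝ} {f : E → F} (hf : Symb pr 1 d f) (hd : d ≤ 1) {β ε R : ℝ}
    (hβ : 0 ≤ β) (hβ1 : β ≤ 1) (hε : 0 < ε) (hε1 : ε ≤ 1) :
    ∃ C, 0 ≤ C ∧ ∀ z ∈ Cone pr R, ∀ w ∈ Cone pr R, ‖f z - f w‖ ≤
      C * ‖z - w‖ ^ β * (‖pr z‖ ^ (d - β - ε) + ‖pr w‖ ^ (d - β - ε)) := by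
  obtain ⟨C₁, hC₁, H₁⟩ := hf.1 ε hε hε1 R
  obtain ⟨C₂, hC₂, H₂⟩ := hf.2.2 ε hε hε1 (2 * R)
  set κ := ‖pr‖ + 1 with hκ
  have hκ0 : 0 < κ := by positivity
  refine ⟨C₁ * (2 * κ) ^ β + C₂ * (1 / 2 : ℝ) ^ (d - 1 - ε), by positivity, ?_⟩
  have main : ∀ z ∈ Cone pr R, ∀ w ∈ Cone pr R, ‖pr w‖ ≤ ‖pr z‖ → ‖f z - f w‖ ≤
      (C₁ * (2 * κ) ^ β + C₂ * (1 / 2 : ℝ) ^ (d - 1 - ε)) * ‖z - w‖ ^ β *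
        (‖pr z‖ ^ (d - β - ε) + ‖pr w‖ ^ (d - β - ε)) := by
    intro z hz w hw hwz
    have hz0 := Cone.pos hz
    have hw0 := Cone.pos hw
    have hR := Cone.nonneg hz
    by_cases hzw : z = w
    · subst hzw
      rw [sub_self, norm_zero]
      positivity
    have hzw0 : 0 < ‖z - w‖ := norm_pos_iff.2 (sub_ne_zero.2 hzw)
    -- For close points the mean value inequality applies, because the projection stays comparable
    -- with `‖pr z‖` along the segment; part of `‖z - w‖` is then traded for a power of `‖pr z‖`.
    -- For distant points the values are bounded separately and powers of the projections are traded
    -- for powers of `‖z - w‖`.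
    rcases le_total (2 * κ * ‖z - w‖) ‖pr z‖ with hnear | hfar
    · have hseg := Cone.segment hz hw hwz hnear
      have hmv := (convex_segment w z).norm_image_sub_le_of_norm_fderiv_le (𝕜 := ℝ) (f := f)
        (C := C₂ * (1 / 2 : ℝ) ^ (d - 1 - ε) * ‖pr z‖ ^ (d - 1 - ε))
        (fun v hv => hf.2.1 v (hseg v hv).2.1)
        (fun v hv => by
          refine (H₂ v (hseg v hv).2).trans ?_
          rw [mul_assoc]
          gcongr
          rw [← mul_rpow (by norm_num) hz0.le]
          exact rpow_le_rpow_of_nonpos (by positivity) (by linarith [(hseg v hv).1]) (by linarith))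
        (left_mem_segment ℝ w z) (right_mem_segment ℝ w z)
      have hle : ‖z - w‖ ≤ ‖pr z‖ := by
        have : ‖pr‖ * ‖z - w‖ ≥ 0 := by positivity
        nlinarith
      have h5 : ‖pr z‖ ^ (d - 1 - ε) * ‖z - w‖ ≤ ‖z - w‖ ^ β * ‖pr z‖ ^ (d - β - ε) := by
        calc ‖pr z‖ ^ (d - 1 - ε) * ‖z - w‖
            = ‖pr z‖ ^ (d - 1 - ε) * (‖z - w‖ ^ β * ‖z - w‖ ^ (1 - β)) := by
              rw [← rpow_add hzw0, add_sub_cancel, rpow_one]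
          _ ≤ ‖pr z‖ ^ (d - 1 - ε) * (‖z - w‖ ^ β * ‖pr z‖ ^ (1 - β)) := by
              gcongr
          _ = ‖z - w‖ ^ β * (‖pr z‖ ^ (d - 1 - ε) * ‖pr z‖ ^ (1 - β)) := by ring
          _ = _ := by rw [← rpow_add hz0]; congr 2; ring
      calc ‖f z - f w‖ ≤ _ := hmv
        _ = C₂ * (1 / 2 : ℝ) ^ (d - 1 - ε) * (‖pr z‖ ^ (d - 1 - ε) * ‖z - w‖) := by ring
        _ ≤ C₂ * (1 / 2 : ℝ) ^ (d - 1 - ε) * (‖z - w‖ ^ β * ‖pr z‖ ^ (d - β - ε)) := by gcongr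
        _ = (0 + C₂ * (1 / 2 : ℝ) ^ (d - 1 - ε)) * ‖z - w‖ ^ β * (‖pr z‖ ^ (d - β - ε) + 0) := by
            ring
        _ ≤ _ := by gcongr <;> positivity
    · have hpow : ∀ v, v ∈ Cone pr R → ‖pr v‖ ≤ ‖pr z‖ →
          ‖f v‖ ≤ C₁ * (2 * κ) ^ β * ‖z - w‖ ^ β * ‖pr v‖ ^ (d - β - ε) := by
        intro v hv hvz
        have hv0 := Cone.pos hv
        calc ‖f v‖ ≤ C₁ * ‖pr v‖ ^ (d - ε) := H₁ v hv
          _ = C₁ * (‖pr v‖ ^ β * ‖pr v‖ ^ (d - β - ε)) := by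
              rw [← rpow_add hv0]; congr 2; ring
          _ ≤ C₁ * ((2 * κ * ‖z - w‖) ^ β * ‖pr v‖ ^ (d - β - ε)) := by
              gcongr; exact hvz.trans hfar
          _ = _ := by rw [mul_rpow (by positivity) hzw0.le]; ring
      calc ‖f z - f w‖ ≤ ‖f z‖ + ‖f w‖ := norm_sub_le _ _
        _ ≤ C₁ * (2 * κ) ^ β * ‖z - w‖ ^ β * ‖pr z‖ ^ (d - β - ε) +
            C₁ * (2 * κ) ^ β * ‖z - w‖ ^ β * ‖pr w‖ ^ (d - β - ε) :=
            add_le_add (hpow z hz le_rfl) (hpow w hw hwz)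
        _ = (C₁ * (2 * κ) ^ β + 0) * ‖z - w‖ ^ β *
            (‖pr z‖ ^ (d - β - ε) + ‖pr w‖ ^ (d - β - ε)) := by ring
        _ ≤ _ := by gcongr; positivity
  intro z hz w hw
  rcases le_total ‖pr w‖ ‖pr z‖ with h | h
  · exact main z hz w hw h
  · rw [norm_sub_rev, norm_sub_rev z, add_comm (‖pr z‖ ^ _)]
    exact main w hw z hz h

/-- The first order Taylor estimate for symbols of order one. -/
theorem Symb.taylor {f : E → F} (hf : Symb pr 2 1 f) {β ε R : ℝ}
    (hβ : 0 ≤ β) (hβ1 : β ≤ 1) (hε : 0 < ε) (hε1 : ε ≤ 1) :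
    ∃ C, 0 ≤ C ∧ ∀ z ∈ Cone pr R, ∀ w ∈ Cone pr R, ‖f w - f z - fderiv ℝ f z (w - z)‖ ≤
      C * ‖w - z‖ ^ (1 + β) * (‖pr z‖ ^ (-β - ε) + ‖pr w‖ ^ (-β - ε)) := by
  obtain ⟨C₀, hC₀, H₀⟩ := hf.2.2.1 ε hε hε1 R
  obtain ⟨C₁, hC₁, H₁⟩ := hf.of_succ.holder le_rfl (R := R) zero_le_one le_rfl hε hε1
  obtain ⟨C₂, hC₂, H₂⟩ := hf.2.2.holder (by norm_num) (R := 2 * R) hβ hβ1 hε hε1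
  set κ := ‖pr‖ + 1 with hκ
  have hκ0 : 0 < κ := by positivity
  refine ⟨(C₁ + C₀) * (2 * κ) ^ β + C₂ * (2 * (1 / 2 : ℝ) ^ (-β - ε)), by positivity,
    fun z hz w hw => ?_⟩
  have hz0 := Cone.pos hz
  have hw0 := Cone.pos hw
  have hR := Cone.nonneg hz
  by_cases hzw : z = w
  · subst hzw
    simp only [sub_self, map_zero, norm_zero]
    positivity
  have hzw0 : 0 < ‖w - z‖ := norm_pos_iff.2 (sub_ne_zero.2 (Ne.symm hzw))
  have hp1 : ‖w - z‖ ^ (1 + β) = ‖w - z‖ ^ β * ‖w - z‖ := by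
    rw [add_comm, rpow_add_one hzw0.ne']
  -- Here `m` is the larger of the two projections. The base point `z` of the expansion need not be
  -- the one that attains it, so the cases near and far are measured against `m`.
  obtain ⟨m, hm0, hmz, hmw, hnearm, hmmem⟩ : ∃ m : ℝ, 0 < m ∧ ‖pr z‖ ≤ m ∧ ‖pr w‖ ≤ m ∧
      (2 * κ * ‖w - z‖ ≤ m → ∀ v ∈ segment ℝ z w, m / 2 ≤ ‖pr v‖ ∧ v ∈ Cone pr (2 * R)) ∧
      m ^ (-β - ε) ≤ ‖pr z‖ ^ (-β - ε) + ‖pr w‖ ^ (-β - ε) := by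
    rcases le_total ‖pr w‖ ‖pr z‖ with h | h
    · refine ⟨‖pr z‖, hz0, le_rfl, h, fun hn => ?_, by linarith [rpow_nonneg hw0.le (-β - ε)]⟩
      rw [segment_symm]
      exact Cone.segment hz hw h (by rwa [norm_sub_rev])
    · exact ⟨‖pr w‖, hw0, h, le_rfl, fun hn => Cone.segment hw hz h hn,
        by linarith [rpow_nonneg hz0.le (-β - ε)]⟩
  rcases le_total (2 * κ * ‖w - z‖) m with hnear | hfar
  · have hseg := hnearm hnear
    have hlow : ∀ v ∈ segment ℝ z w, ‖pr v‖ ^ (0 - β - ε) ≤ (1 / 2 : ℝ) ^ (-β - ε) * m ^ (-β - ε) := by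
      intro v hv
      rw [← mul_rpow (by norm_num) hm0.le, zero_sub]
      exact rpow_le_rpow_of_nonpos (by positivity) (by linarith [(hseg v hv).1]) (by linarith)
    have hmv := (convex_segment z w).norm_image_sub_le_of_norm_fderiv_le' (𝕜 := ℝ) (f := f)
      (φ := fderiv ℝ f z) (C := C₂ * (2 * (1 / 2 : ℝ) ^ (-β - ε)) * ‖w - z‖ ^ β * m ^ (-β - ε))
      (fun v hv => hf.2.1 v (hseg v hv).2.1)
      (fun v hv => by
        have hvz : ‖v - z‖ ≤ ‖w - z‖ := by
          have := (convex_closedBall z ‖w - z‖).segment_subset (by simp)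
            (mem_closedBall_iff_norm.2 le_rfl) hv
          exact mem_closedBall_iff_norm.1 this
        calc ‖fderiv ℝ f v - fderiv ℝ f z‖
            ≤ C₂ * ‖v - z‖ ^ β * (‖pr v‖ ^ (0 - β - ε) + ‖pr z‖ ^ (0 - β - ε)) := by
              have := H₂ v (hseg v hv).2 z (hseg z (left_mem_segment ℝ z w)).2
              rwa [sub_self] at this
          _ ≤ C₂ * ‖w - z‖ ^ β * ((1 / 2 : ℝ) ^ (-β - ε) * m ^ (-β - ε) +
                (1 / 2 : ℝ) ^ (-β - ε) * m ^ (-β - ε)) := by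
              gcongr
              · exact hlow v hv
              · exact hlow z (left_mem_segment ℝ z w)
          _ = _ := by ring)
      (left_mem_segment ℝ z w) (right_mem_segment ℝ z w)
    calc ‖f w - f z - fderiv ℝ f z (w - z)‖ ≤ _ := hmv
      _ = (0 + C₂ * (2 * (1 / 2 : ℝ) ^ (-β - ε))) * ‖w - z‖ ^ (1 + β) * m ^ (-β - ε) := by
          rw [hp1]; ring
      _ ≤ _ := by gcongr; positivity
  · have hpow : ∀ r : ℝ, 0 < r → r ≤ m →
        r ^ (-ε) ≤ (2 * κ) ^ β * ‖w - z‖ ^ β * r ^ (-β - ε) := by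
      intro r hr hrm
      calc r ^ (-ε) = r ^ β * r ^ (-β - ε) := by rw [← rpow_add hr]; congr 1; ring
        _ ≤ (2 * κ * ‖w - z‖) ^ β * r ^ (-β - ε) := by gcongr; exact hrm.trans hfar
        _ = _ := by rw [mul_rpow (by positivity) hzw0.le]
    have e1 := H₁ w hw z hz
    rw [rpow_one, show (1 : ℝ) - 1 - ε = -ε by ring] at e1
    have e2 : ‖fderiv ℝ f z (w - z)‖ ≤ C₀ * ‖pr z‖ ^ (-ε) * ‖w - z‖ := by
      have := H₀ z hz
      rw [show (1 : ℝ) - 1 - ε = -ε by ring] at this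
      exact (fderiv ℝ f z).le_of_opNorm_le this _
    have e3 := hpow _ hz0 hmz
    have e4 := hpow _ hw0 hmw
    have e5 : 0 ≤ ‖pr w‖ ^ (-ε) := by positivity
    calc ‖f w - f z - fderiv ℝ f z (w - z)‖
        ≤ C₁ * ‖w - z‖ * (‖pr w‖ ^ (-ε) + ‖pr z‖ ^ (-ε)) + C₀ * ‖pr z‖ ^ (-ε) * ‖w - z‖ :=
          (norm_sub_le _ _).trans (add_le_add e1 e2)
      _ ≤ (C₁ + C₀) * ‖w - z‖ * (‖pr z‖ ^ (-ε) + ‖pr w‖ ^ (-ε)) := by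
          have : 0 ≤ C₀ * ‖w - z‖ * ‖pr w‖ ^ (-ε) := by positivity
          nlinarith
      _ ≤ (C₁ + C₀) * ‖w - z‖ * ((2 * κ) ^ β * ‖w - z‖ ^ β * ‖pr z‖ ^ (-β - ε) +
            (2 * κ) ^ β * ‖w - z‖ ^ β * ‖pr w‖ ^ (-β - ε)) := by gcongr
      _ = ((C₁ + C₀) * (2 * κ) ^ β + 0) * ‖w - z‖ ^ (1 + β) *
            (‖pr z‖ ^ (-β - ε) + ‖pr w‖ ^ (-β - ε)) := by rw [hp1]; ring
      _ ≤ _ := by gcongr; positivity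

end Symbols

/-! ### The kernel is a symbol of order one -/

section KernelSymbol

variable {α : ℝ}

local notation "idP" => ContinuousLinearMap.id ℝ Plane

theorem hasFDerivAt_norm_plane {x : Plane} (hx : x ≠ 0) :
    HasFDerivAt (fun x : Plane => ‖x‖) (‖x‖⁻¹ • innerSL ℝ x) x := by
  have h0 := norm_pos_iff.2 hx
  have h := ((hasStrictFDerivAt_norm_sq x).hasFDerivAt).sqrt (by positivity)
  simp only [sqrt_sq (norm_nonneg _)] at h
  refine h.congr_fderiv ?_
  ext y
  simp
  field_simp

theorem hasFDerivAt_comp_norm {g : ℝ → ℝ} {g' : ℝ} {x : Plane} (hx : x ≠ 0)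
    (hg : HasDerivAt g g' ‖x‖) :
    HasFDerivAt (fun x : Plane => g ‖x‖) ((g' * ‖x‖⁻¹) • innerSL ℝ x) x := by
  refine (hg.comp_hasFDerivAt x (hasFDerivAt_norm_plane hx)).congr_fderiv ?_
  rw [smul_smul]

theorem symb_norm_rpow (n : ℕ) (s : ℝ) : Symb idP n s (fun x : Plane => ‖x‖ ^ s) := by
  have hb : ∀ s, ConeBound idP s (fun x : Plane => ‖x‖ ^ s) := fun s =>
    ConeBound.of_le fun R => ⟨1, zero_le_one, fun z hz => by
      rw [Real.norm_of_nonneg (by positivity), one_mul]; rfl⟩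
  induction n generalizing s with
  | zero => exact hb s
  | succ n ih =>
    have hd : ∀ x : Plane, x ≠ 0 → HasFDerivAt (fun x : Plane => ‖x‖ ^ s)
        ((s * ‖x‖ ^ (s - 1) * ‖x‖⁻¹) • innerSL ℝ x) x := fun x hx =>
      hasFDerivAt_comp_norm hx (hasDerivAt_rpow_const (Or.inl (norm_pos_iff.2 hx).ne'))
    refine ⟨hb s, fun x hx => (hd x hx).differentiableAt, ?_⟩
    have h := (((ih (s - 2)).bilinear (ContinuousLinearMap.lsmul ℝ ℝ)
      (Symb.clm n (innerSL ℝ (E := Plane))) (d'' := s - 1) (by ring))).postcomp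
      (s • ContinuousLinearMap.id ℝ (Plane →L[ℝ] ℝ))
    refine h.congr fun x hx => ?_
    have h0 : 0 < ‖x‖ := norm_pos_iff.2 hx
    rw [(hd x hx).fderiv]
    have : ‖x‖ ^ (s - 1) * ‖x‖⁻¹ = ‖x‖ ^ (s - 2) := by
      rw [← rpow_neg_one, ← rpow_add h0]; congr 1; ring
    simp only [_root_.smul_apply, ContinuousLinearMap.id_apply,
      ContinuousLinearMap.lsmul_apply, smul_smul]
    rw [mul_assoc, this]

/-- The gradient is a product of symbols of orders `-(k + 1)`, `-1` and `1`, so the induction on `n`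
runs over all `k` at once. -/
theorem symb_radial (hα : 0 < α) (n k : ℕ) :
    Symb idP n (-(k : ℝ)) (fun x : Plane => radial α k ‖x‖) := by
  have hb : ∀ k : ℕ, ConeBound idP (-(k : ℝ)) (fun x : Plane => radial α k ‖x‖) := by
    intro k ε hε hε1 R
    obtain ⟨C, hC, H⟩ := abs_radial_le hα k hε hε1
    refine ⟨C, hC, fun z hz => ?_⟩
    have hz0 := Cone.pos hz
    rw [ContinuousLinearMap.id_apply] at hz0 ⊢
    have h := H ‖z‖ hz0
    rw [neg_add, ← sub_eq_add_neg] at h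
    rw [Real.norm_eq_abs]
    exact h
  induction n generalizing k with
  | zero => exact hb k
  | succ n ih =>
    have hd : ∀ x : Plane, x ≠ 0 → HasFDerivAt (fun x : Plane => radial α k ‖x‖)
        ((radial α (k + 1) ‖x‖ * ‖x‖⁻¹) • innerSL ℝ x) x := fun x hx =>
      hasFDerivAt_comp_norm hx (hasDerivAt_radial hα k (norm_pos_iff.2 hx))
    refine ⟨hb k, fun x hx => (hd x hx).differentiableAt, ?_⟩
    have h := ((ih (k + 1)).bilinear (ContinuousLinearMap.mul ℝ ℝ) (symb_norm_rpow n (-1))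
      rfl).bilinear (ContinuousLinearMap.lsmul ℝ ℝ)
      (Symb.clm n (innerSL ℝ (E := Plane))) (d'' := -(k : ℝ) - 1) (by push_cast; ring)
    refine h.congr fun x hx => ?_
    rw [(hd x hx).fderiv]
    simp only [ContinuousLinearMap.lsmul_apply, ContinuousLinearMap.mul_apply', rpow_neg_one]

theorem symb_kernel (hα : 0 < α) (n : ℕ) : Symb idP n 1 (kernel α) := by
  have h := (symb_radial hα n 0).bilinear (ContinuousLinearMap.lsmul ℝ ℝ)
    (Symb.clm n perpL) (d'' := 1) (by simp)
  exact h.congr fun x _ => by rw [kernel_eq hα]; rfl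

end KernelSymbol

end BRAlpha

end

noncomputable section

namespace BRAlpha

/-! ### Curves moving with the velocity induced by a singular kernel -/

/-- Parameter domains: `J` is the set of parameters, the integrals are over `D`, and `ρ` is the
distance of parameters. -/
structure ParamDomain (J D : Set ℝ) (ρ : ℝ → ℝ → ℝ) : Prop where
  isOpen : IsOpen J
  measurableSet : MeasurableSet D
  subset : D ⊆ J
  finite : volume D < ⊤
  nonneg : ∀ Γ Γ', 0 ≤ ρ Γ Γ'
  le_abs : ∀ Γ Γ', ρ Γ Γ' ≤ |Γ - Γ'|
  ae_pos : ∀ Γ ∈ J, ∀ᵐ Γ' ∂volume.restrict D, 0 < ρ Γ Γ'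
  integrable : ∀ γ : ℝ, 0 ≤ γ → γ < 1 → ∃ C, 0 ≤ C ∧ ∀ Γ ∈ J,
    IntegrableOn (fun Γ' => ρ Γ Γ' ^ (-γ)) D ∧ ∫ Γ' in D, ρ Γ Γ' ^ (-γ) ≤ C

/-- The curve `z t` moves with the velocity `v t` induced by the kernel `K`, with uniform two-sided
Lipschitz bounds. -/
structure CurveFlow {E : Type} [NormedAddCommGroup E] [NormedSpace ℝ E] (J D : Set ℝ)
    (ρ : ℝ → ℝ → ℝ) (pr : E →L[ℝ] Plane) (K : E → E) (T L : ℝ) (z v : ℝ → ℝ → E) : Prop where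
  one_le : 1 ≤ L
  nonneg : 0 ≤ T
  deriv : ∀ t ∈ Icc (-T) T, ∀ Γ ∈ J, HasDerivWithinAt (fun s => z s Γ) (v t Γ) (Icc (-T) T) t
  vel : ∀ t ∈ Icc (-T) T, ∀ Γ ∈ J, v t Γ = ∫ Γ' in D, K (z t Γ - z t Γ')
  lower : ∀ t ∈ Icc (-T) T, ∀ Γ ∈ J, ∀ Γ' ∈ J, ρ Γ Γ' ≤ L * ‖pr (z t Γ - z t Γ')‖
  upper : ∀ t ∈ Icc (-T) T, ∀ Γ ∈ J, ∀ Γ' ∈ J, ‖z t Γ - z t Γ'‖ ≤ L * ρ Γ Γ'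
  velUpper : ∀ t ∈ Icc (-T) T, ∀ Γ ∈ J, ∀ Γ' ∈ J, ‖v t Γ - v t Γ'‖ ≤ L * ρ Γ Γ'
  bound : ∀ t ∈ Icc (-T) T, ∀ Γ ∈ J, ‖z t Γ‖ ≤ L
  velBound : ∀ t ∈ Icc (-T) T, ∀ Γ ∈ J, ‖v t Γ‖ ≤ L

section CurveFlow

set_option linter.unusedSectionVars false

variable {E : Type} [NormedAddCommGroup E] [NormedSpace ℝ E]
  {F : Type} [NormedAddCommGroup F] [NormedSpace ℝ F]
  {J D : Set ℝ} {ρ : ℝ → ℝ → ℝ} {pr : E →L[ℝ] Plane} {K : E → E} {T L : ℝ} {z v : ℝ → ℝ → E}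

theorem ParamDomain.norm_integral_le (hD : ParamDomain J D ρ) {γ : ℝ} (hγ : 0 ≤ γ) (hγ1 : γ < 1) :
    ∃ C, 0 ≤ C ∧ ∀ Γ₁ ∈ J, ∀ Γ₂ ∈ J, ∀ A : ℝ, 0 ≤ A → ∀ f : ℝ → F,
      (∀ᵐ Γ' ∂volume.restrict D, ‖f Γ'‖ ≤ A * (ρ Γ₁ Γ' ^ (-γ) + ρ Γ₂ Γ' ^ (-γ))) →
      ‖∫ Γ' in D, f Γ'‖ ≤ A * C := by
  obtain ⟨C, hC, H⟩ := hD.integrable γ hγ hγ1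
  refine ⟨C + C, by positivity, fun Γ₁ h₁ Γ₂ h₂ A hA f hf => ?_⟩
  obtain ⟨i1, b1⟩ := H Γ₁ h₁
  obtain ⟨i2, b2⟩ := H Γ₂ h₂
  refine (norm_integral_le_of_norm_le ((i1.add i2).const_mul A) hf).trans ?_
  rw [integral_const_mul, integral_add' i1 i2]
  gcongr

theorem ParamDomain.ae_mem (hD : ParamDomain J D ρ) {Γ : ℝ} (hΓ : Γ ∈ J) :
    ∀ᵐ Γ' ∂volume.restrict D, Γ' ∈ J ∧ 0 < ρ Γ Γ' := by
  filter_upwards [ae_restrict_mem hD.measurableSet, hD.ae_pos Γ hΓ] with Γ' h h'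
  exact ⟨hD.subset h, h'⟩

theorem CurveFlow.pos (h : CurveFlow J D ρ pr K T L z v) : 0 < L := one_pos.trans_le h.one_le

theorem CurveFlow.zero_mem (h : CurveFlow J D ρ pr K T L z v) : (0 : ℝ) ∈ Icc (-T) T :=
  ⟨by linarith [h.nonneg], h.nonneg⟩

theorem CurveFlow.cone (h : CurveFlow J D ρ pr K T L z v) {t : ℝ} (ht : t ∈ Icc (-T) T)
    {Γ Γ' : ℝ} (hΓ : Γ ∈ J) (hΓ' : Γ' ∈ J) (hρ : 0 < ρ Γ Γ') :
    z t Γ - z t Γ' ∈ Cone pr (L ^ 2 + 2 * L) := by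
  have hL := h.pos
  have h1 := h.lower t ht Γ hΓ Γ' hΓ'
  have h2 := h.upper t ht Γ hΓ Γ' hΓ'
  refine ⟨fun h0 => ?_, ?_, ?_⟩
  · rw [h0, norm_zero] at h1
    linarith
  · calc ‖z t Γ - z t Γ'‖ ≤ L * (L * ‖pr (z t Γ - z t Γ')‖) := h2.trans (by gcongr)
      _ = (L ^ 2) * ‖pr (z t Γ - z t Γ')‖ := by ring
      _ ≤ _ := by gcongr; linarith
  · have h3 := norm_sub_le (z t Γ) (z t Γ')
    have h4 := h.bound t ht Γ hΓ
    have h5 := h.bound t ht Γ' hΓ'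
    nlinarith

theorem CurveFlow.weight (h : CurveFlow J D ρ pr K T L z v) {t : ℝ} (ht : t ∈ Icc (-T) T)
    {Γ Γ' : ℝ} (hΓ : Γ ∈ J) (hΓ' : Γ' ∈ J) (hρ : 0 < ρ Γ Γ') {e : ℝ} (he : e ≤ 0) :
    ‖pr (z t Γ - z t Γ')‖ ^ e ≤ L ^ (-e) * ρ Γ Γ' ^ e := by
  have hL := h.pos
  have h1 := h.lower t ht Γ hΓ Γ' hΓ'
  calc ‖pr (z t Γ - z t Γ')‖ ^ e ≤ (ρ Γ Γ' / L) ^ e := by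
        apply rpow_le_rpow_of_nonpos (by positivity) _ he
        rwa [div_le_iff₀' hL]
    _ = _ := by rw [div_rpow hρ.le hL.le, rpow_neg hL.le]; field_simp

theorem CurveFlow.norm_symb_le (h : CurveFlow J D ρ pr K T L z v) {f : E → F} {d : ℝ}
    (hf : ConeBound pr d f) {ε : ℝ} (hε : 0 < ε) (hε1 : ε ≤ 1) (he : d - ε ≤ 0) :
    ∃ C, 0 ≤ C ∧ ∀ t ∈ Icc (-T) T, ∀ Γ ∈ J, ∀ Γ' ∈ J, 0 < ρ Γ Γ' →
      ‖f (z t Γ - z t Γ')‖ ≤ C * ρ Γ Γ' ^ (d - ε) := by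
  obtain ⟨C, hC, H⟩ := hf ε hε hε1 (L ^ 2 + 2 * L)
  have hL := h.pos
  refine ⟨C * L ^ (-(d - ε)), by positivity, fun t ht Γ hΓ Γ' hΓ' hρ => ?_⟩
  rw [mul_assoc]
  exact (H _ (h.cone ht hΓ hΓ' hρ)).trans (by gcongr; exact h.weight ht hΓ hΓ' hρ he)

theorem CurveFlow.norm_symb_sub_le (h : CurveFlow J D ρ pr K T L z v) {f : E → F} {d : ℝ}
    (hf : Symb pr 1 d f) (hd : d ≤ 1) {β ε : ℝ} (hβ : 0 ≤ β) (hβ1 : β ≤ 1) (hε : 0 < ε)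
    (hε1 : ε ≤ 1) (he : d - β - ε ≤ 0) :
    ∃ C, 0 ≤ C ∧ ∀ t ∈ Icc (-T) T, ∀ s ∈ Icc (-T) T, ∀ Γ₁ ∈ J, ∀ Γ₁' ∈ J, ∀ Γ₂ ∈ J, ∀ Γ₂' ∈ J,
      0 < ρ Γ₁ Γ₁' → 0 < ρ Γ₂ Γ₂' →
      ‖f (z t Γ₁ - z t Γ₁') - f (z s Γ₂ - z s Γ₂')‖ ≤
        C * ‖(z t Γ₁ - z t Γ₁') - (z s Γ₂ - z s Γ₂')‖ ^ β *
          (ρ Γ₁ Γ₁' ^ (d - β - ε) + ρ Γ₂ Γ₂' ^ (d - β - ε)) := by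
  obtain ⟨C, hC, H⟩ := hf.holder hd (R := L ^ 2 + 2 * L) hβ hβ1 hε hε1
  have hL := h.pos
  refine ⟨C * L ^ (-(d - β - ε)), by positivity,
    fun t ht s hs Γ₁ h₁ Γ₁' h₁' Γ₂ h₂ Γ₂' h₂' hρ₁ hρ₂ => ?_⟩
  refine (H _ (h.cone ht h₁ h₁' hρ₁) _ (h.cone hs h₂ h₂' hρ₂)).trans ?_
  have e1 := h.weight ht h₁ h₁' hρ₁ he
  have e2 := h.weight hs h₂ h₂' hρ₂ he
  set W := ‖(z t Γ₁ - z t Γ₁') - (z s Γ₂ - z s Γ₂')‖ ^ β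
  have hW : 0 ≤ W := by positivity
  calc _ ≤ C * W * (L ^ (-(d - β - ε)) * ρ Γ₁ Γ₁' ^ (d - β - ε) +
        L ^ (-(d - β - ε)) * ρ Γ₂ Γ₂' ^ (d - β - ε)) := by gcongr
    _ = _ := by ring

theorem CurveFlow.norm_taylor_le (h : CurveFlow J D ρ pr K T L z v) {f : E → F}
    (hf : Symb pr 2 1 f) {β ε : ℝ} (hβ : 0 ≤ β) (hβ1 : β ≤ 1) (hε : 0 < ε) (hε1 : ε ≤ 1) :
    ∃ C, 0 ≤ C ∧ ∀ t ∈ Icc (-T) T, ∀ Γ₁ ∈ J, ∀ Γ₂ ∈ J, ∀ Γ' ∈ J, 0 < ρ Γ₁ Γ' → 0 < ρ Γ₂ Γ' →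
      ‖f (z t Γ₂ - z t Γ') - f (z t Γ₁ - z t Γ') -
          fderiv ℝ f (z t Γ₁ - z t Γ') (z t Γ₂ - z t Γ₁)‖ ≤
        C * ‖z t Γ₂ - z t Γ₁‖ ^ (1 + β) * (ρ Γ₁ Γ' ^ (-β - ε) + ρ Γ₂ Γ' ^ (-β - ε)) := by
  obtain ⟨C, hC, H⟩ := hf.taylor (R := L ^ 2 + 2 * L) hβ hβ1 hε hε1
  have hL := h.pos
  refine ⟨C * L ^ (-(-β - ε)), by positivity, fun t ht Γ₁ h₁ Γ₂ h₂ Γ' h' hρ₁ hρ₂ => ?_⟩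
  have := H _ (h.cone ht h₁ h' hρ₁) _ (h.cone ht h₂ h' hρ₂)
  rw [sub_sub_sub_cancel_right] at this
  refine this.trans ?_
  have he : -β - ε ≤ 0 := by linarith
  have e1 := h.weight ht h₁ h' hρ₁ he
  have e2 := h.weight ht h₂ h' hρ₂ he
  set W := ‖z t Γ₂ - z t Γ₁‖ ^ (1 + β)
  have hW : 0 ≤ W := by positivity
  calc _ ≤ C * W * (L ^ (-(-β - ε)) * ρ Γ₁ Γ' ^ (-β - ε) +
        L ^ (-(-β - ε)) * ρ Γ₂ Γ' ^ (-β - ε)) := by gcongr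
    _ = _ := by ring

theorem CurveFlow.norm_diff_sub_le (h : CurveFlow J D ρ pr K T L z v) {t s : ℝ}
    (ht : t ∈ Icc (-T) T) (hs : s ∈ Icc (-T) T) {Γ Γ' : ℝ} (hΓ : Γ ∈ J) (hΓ' : Γ' ∈ J) :
    ‖(z t Γ - z t Γ') - (z s Γ - z s Γ')‖ ≤ L * ρ Γ Γ' * |t - s| :=
  norm_sub_le_of_hasDerivWithinAt (f := fun t => z t Γ - z t Γ')
    (fun r hr => (h.deriv r hr Γ hΓ).sub (h.deriv r hr Γ' hΓ'))
    (fun r hr => h.velUpper r hr Γ hΓ Γ' hΓ') hs ht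

theorem CurveFlow.norm_sub_le_abs (hD : ParamDomain J D ρ) (h : CurveFlow J D ρ pr K T L z v)
    {t : ℝ} (ht : t ∈ Icc (-T) T) {Γ Γ' : ℝ} (hΓ : Γ ∈ J) (hΓ' : Γ' ∈ J) :
    ‖z t Γ - z t Γ'‖ ≤ L * |Γ - Γ'| :=
  (h.upper t ht Γ hΓ Γ' hΓ').trans (mul_le_mul_of_nonneg_left (hD.le_abs _ _) h.pos.le)

theorem CurveFlow.continuousOn (hD : ParamDomain J D ρ) (h : CurveFlow J D ρ pr K T L z v)
    {t : ℝ} (ht : t ∈ Icc (-T) T) : ContinuousOn (z t) J := by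
  refine LipschitzOnWith.continuousOn (K := ⟨L, h.pos.le⟩)
    (LipschitzOnWith.of_dist_le_mul fun Γ hΓ Γ' hΓ' => ?_)
  rw [dist_eq_norm, Real.dist_eq]
  exact h.norm_sub_le_abs hD ht hΓ hΓ'

variable [FiniteDimensional ℝ E] [FiniteDimensional ℝ F]

theorem CurveFlow.aestronglyMeasurable (hD : ParamDomain J D ρ)
    (h : CurveFlow J D ρ pr K T L z v) {t : ℝ} (ht : t ∈ Icc (-T) T) :
    AEStronglyMeasurable (z t) (volume.restrict D) :=
  ((h.continuousOn hD ht).mono hD.subset).aestronglyMeasurable hD.measurableSet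

theorem CurveFlow.integrable_fderiv (hD : ParamDomain J D ρ) (h : CurveFlow J D ρ pr K T L z v)
    {f : E → F} (hf : ConeBound pr 0 (fderiv ℝ f)) {t : ℝ} (ht : t ∈ Icc (-T) T) {Γ : ℝ}
    (hΓ : Γ ∈ J) : IntegrableOn (fun Γ' => fderiv ℝ f (z t Γ - z t Γ')) D := by
  borelize E
  borelize (E →L[ℝ] F)
  obtain ⟨C, hC, H⟩ := h.norm_symb_le hf (ε := 1 / 2) (by norm_num) (by norm_num) (by norm_num)
  obtain ⟨C', hC', H'⟩ := hD.integrable (1 / 2) (by norm_num) (by norm_num)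
  refine ((H' Γ hΓ).1.const_mul C).mono' ?_ ?_
  · have hm : AEMeasurable (fun Γ' => z t Γ - z t Γ') (volume.restrict D) :=
      (aestronglyMeasurable_const.sub (h.aestronglyMeasurable hD ht)).aemeasurable
    exact ((measurable_fderiv ℝ f).comp_aemeasurable hm).aestronglyMeasurable
  · filter_upwards [hD.ae_mem hΓ] with Γ' hΓ'
    have := H t ht Γ hΓ Γ' hΓ'.1 hΓ'.2
    rwa [zero_sub] at this

theorem CurveFlow.integrable_symb (hD : ParamDomain J D ρ) (h : CurveFlow J D ρ pr K T L z v)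
    {f : E → F} (hf : Symb pr 1 1 f) {t : ℝ} (ht : t ∈ Icc (-T) T) {Γ : ℝ}
    (hΓ : Γ ∈ J) : IntegrableOn (fun Γ' => f (z t Γ - z t Γ')) D := by
  obtain ⟨C, hC, H⟩ := h.norm_symb_le hf.1 (ε := 1) (by norm_num) (by norm_num) (by norm_num)
  have : IsFiniteMeasure (volume.restrict D) := ⟨by simpa using hD.finite⟩
  refine Integrable.mono' (integrable_const C) ?_ ?_
  -- Continuity of `f` is known only where the projection does not vanish, so measurability is
  -- checked on this subset `S`, which has full measure in `D`.
  · set S := {Γ' ∈ D | pr (z t Γ - z t Γ') ≠ 0} with hS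
    have hc : ContinuousOn (fun Γ' => z t Γ - z t Γ') D :=
      continuousOn_const.sub ((h.continuousOn hD ht).mono hD.subset)
    have hSm : MeasurableSet S := by
      obtain ⟨U, hU, e⟩ := continuousOn_iff'.1 hc _ (isOpen_pr_ne_zero pr)
      have : S = U ∩ D := by rw [← e]; ext; simp [hS, and_comm]
      rw [this]
      exact hU.measurableSet.inter hD.measurableSet
    have hae : D =ᵐ[volume] S := by
      have h1 := (ae_restrict_iff' hD.measurableSet).1 (hD.ae_mem hΓ)
      filter_upwards [h1] with Γ' h1
      refine propext ⟨fun hm => ⟨hm, ?_⟩, fun hm => hm.1⟩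
      exact (h.cone ht hΓ (h1 hm).1 (h1 hm).2).1
    rw [Measure.restrict_congr_set hae]
    refine ContinuousOn.aestronglyMeasurable (fun Γ' hΓ' => ?_) hSm
    exact ContinuousAt.comp_continuousWithinAt (f := fun Γ' => z t Γ - z t Γ')
      (hf.2.1 _ hΓ'.2).continuousAt ((hc Γ' hΓ'.1).mono (sep_subset _ _))
  · filter_upwards [hD.ae_mem hΓ] with Γ' hΓ'
    have := H t ht Γ hΓ Γ' hΓ'.1 hΓ'.2
    rwa [sub_self, rpow_zero, mul_one] at this

end CurveFlow

end BRAlpha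

end

noncomputable section

namespace BRAlpha

/-! ### The linearized velocity -/

section TangentOp

set_option linter.unusedSectionVars false

variable {E : Type} [NormedAddCommGroup E] [NormedSpace ℝ E] [FiniteDimensional ℝ E]
  {J D : Set ℝ} {ρ : ℝ → ℝ → ℝ} {pr : E →L[ℝ] Plane} {K : E → E} {T L : ℝ} {z v : ℝ → ℝ → E}

/-- The linearization of the velocity at a point of the curve `z`. -/
def tangentOp (K : E → E) (D : Set ℝ) (z : ℝ → E) (Γ : ℝ) : E →L[ℝ] E :=
  ∫ Γ' in D, fderiv ℝ K (z Γ - z Γ')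

theorem symb_fderiv (hK : ∀ n, Symb pr n 1 K) (n : ℕ) : Symb pr n 0 (fderiv ℝ K) := by
  have := (hK (n + 1)).2.2
  rwa [sub_self] at this

theorem tangentOp_sub (hD : ParamDomain J D ρ) (h : CurveFlow J D ρ pr K T L z v)
    (hK : ∀ n, Symb pr n 1 K) {t s Γ₁ Γ₂ : ℝ} (ht : t ∈ Icc (-T) T) (hs : s ∈ Icc (-T) T)
    (h₁ : Γ₁ ∈ J) (h₂ : Γ₂ ∈ J) : tangentOp K D (z t) Γ₁ - tangentOp K D (z s) Γ₂ =
      ∫ Γ' in D, (fderiv ℝ K (z t Γ₁ - z t Γ') - fderiv ℝ K (z s Γ₂ - z s Γ')) :=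
  (integral_sub (h.integrable_fderiv hD (symb_fderiv hK 0) ht h₁)
    (h.integrable_fderiv hD (symb_fderiv hK 0) hs h₂)).symm

theorem norm_tangentOp_le (hD : ParamDomain J D ρ) (h : CurveFlow J D ρ pr K T L z v)
    (hK : ∀ n, Symb pr n 1 K) : ∃ C, 0 ≤ C ∧ ∀ t ∈ Icc (-T) T, ∀ Γ ∈ J,
      ‖tangentOp K D (z t) Γ‖ ≤ C := by
  obtain ⟨A, hA, H⟩ := h.norm_symb_le (symb_fderiv hK 0) (ε := 1 / 2) (by norm_num) (by norm_num)
    (by norm_num)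
  obtain ⟨C, hC, H'⟩ := hD.norm_integral_le (F := E →L[ℝ] E) (γ := 1 / 2) (by norm_num)
    (by norm_num)
  refine ⟨A * C, by positivity, fun t ht Γ hΓ => H' Γ hΓ Γ hΓ A hA _ ?_⟩
  filter_upwards [hD.ae_mem hΓ] with Γ' hΓ'
  have := H t ht Γ hΓ Γ' hΓ'.1 hΓ'.2
  rw [zero_sub] at this
  refine this.trans ?_
  have : 0 ≤ ρ Γ Γ' ^ (-(1 / 2) : ℝ) := rpow_nonneg hΓ'.2.le _
  gcongr
  linarith

/-- An increment of exponent `β` costs the singularity `ρ ^ (-β - ε)`, integrable for `β < 1` with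
`ε = (1 - β) / 2`. This argument stops short of the Lipschitz endpoint; on the circle the missing
endpoint is recovered by cancellation. -/
theorem norm_tangentOp_sub_le (hD : ParamDomain J D ρ) (h : CurveFlow J D ρ pr K T L z v)
    (hK : ∀ n, Symb pr n 1 K) {β : ℝ} (hβ : 0 ≤ β) (hβ1 : β < 1) :
    ∃ C, 0 ≤ C ∧ ∀ t ∈ Icc (-T) T, ∀ Γ₁ ∈ J, ∀ Γ₂ ∈ J,
      ‖tangentOp K D (z t) Γ₁ - tangentOp K D (z t) Γ₂‖ ≤ C * |Γ₁ - Γ₂| ^ β := by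
  obtain ⟨A, hA, H⟩ := h.norm_symb_sub_le (symb_fderiv hK 1) zero_le_one (β := β)
    (ε := (1 - β) / 2) hβ hβ1.le (by linarith) (by linarith) (by linarith)
  obtain ⟨C, hC, H'⟩ := hD.norm_integral_le (F := E →L[ℝ] E) (γ := β + (1 - β) / 2)
    (by linarith) (by linarith)
  have hL := h.pos
  refine ⟨A * L ^ β * C, by positivity, fun t ht Γ₁ h₁ Γ₂ h₂ => ?_⟩
  rw [tangentOp_sub hD h hK ht ht h₁ h₂, mul_right_comm]
  refine H' Γ₁ h₁ Γ₂ h₂ _ (by positivity) _ ?_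
  filter_upwards [hD.ae_mem h₁, hD.ae_mem h₂] with Γ' h₁' h₂'
  have := H t ht t ht Γ₁ h₁ Γ' h₁'.1 Γ₂ h₂ Γ' h₁'.1 h₁'.2 h₂'.2
  rw [sub_sub_sub_cancel_right] at this
  rw [show -(β + (1 - β) / 2) = 0 - β - (1 - β) / 2 by ring]
  refine this.trans ?_
  have e1 : 0 ≤ ρ Γ₁ Γ' ^ (0 - β - (1 - β) / 2) := rpow_nonneg h₁'.2.le _
  have e2 : 0 ≤ ρ Γ₂ Γ' ^ (0 - β - (1 - β) / 2) := rpow_nonneg h₂'.2.le _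
  rw [mul_assoc A (L ^ β), ← mul_rpow hL.le (abs_nonneg _)]
  gcongr
  exact h.norm_sub_le_abs hD ht h₁ h₂

/-- Time increments are milder than parameter increments: a chord changes by at most `L * ρ * |t -
s|`, and the factor `ρ` offsets the singularity of the second derivative of `K`. Hence a Lipschitz
bound. -/
theorem norm_tangentOp_time_sub_le (hD : ParamDomain J D ρ) (h : CurveFlow J D ρ pr K T L z v)
    (hK : ∀ n, Symb pr n 1 K) : ∃ C, 0 ≤ C ∧ ∀ t ∈ Icc (-T) T, ∀ s ∈ Icc (-T) T, ∀ Γ ∈ J,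
      ‖tangentOp K D (z t) Γ - tangentOp K D (z s) Γ‖ ≤ C * |t - s| := by
  obtain ⟨A, hA, H⟩ := h.norm_symb_sub_le (symb_fderiv hK 1) zero_le_one (β := 1)
    (ε := 1 / 2) zero_le_one le_rfl (by norm_num) (by norm_num) (by norm_num)
  obtain ⟨C, hC, H'⟩ := hD.norm_integral_le (F := E →L[ℝ] E) (γ := 1 / 2)
    (by norm_num) (by norm_num)
  have hL := h.pos
  refine ⟨A * L * C, by positivity, fun t ht s hs Γ hΓ => ?_⟩
  rw [tangentOp_sub hD h hK ht hs hΓ hΓ, mul_right_comm]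
  refine H' Γ hΓ Γ hΓ _ (by positivity) _ ?_
  filter_upwards [hD.ae_mem hΓ] with Γ' hΓ'
  have h1 := H t ht s hs Γ hΓ Γ' hΓ'.1 Γ hΓ Γ' hΓ'.1 hΓ'.2 hΓ'.2
  have h2 := h.norm_diff_sub_le ht hs hΓ hΓ'.1
  rw [rpow_one] at h1
  have e : ρ Γ Γ' * ρ Γ Γ' ^ (0 - 1 - 1 / 2 : ℝ) = ρ Γ Γ' ^ (-(1 / 2) : ℝ) := by
    rw [← rpow_one_add' hΓ'.2.le (by norm_num)]
    norm_num
  have e1 : 0 ≤ ρ Γ Γ' ^ (0 - 1 - 1 / 2 : ℝ) := rpow_nonneg hΓ'.2.le _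
  calc _ ≤ _ := h1
    _ ≤ A * (L * ρ Γ Γ' * |t - s|) *
        (ρ Γ Γ' ^ (0 - 1 - 1 / 2 : ℝ) + ρ Γ Γ' ^ (0 - 1 - 1 / 2 : ℝ)) := by gcongr
    _ = A * L * |t - s| * (ρ Γ Γ' * ρ Γ Γ' ^ (0 - 1 - 1 / 2 : ℝ) +
        ρ Γ Γ' * ρ Γ Γ' ^ (0 - 1 - 1 / 2 : ℝ)) := by ring
    _ = _ := by rw [e]

/-- Interpolation of two bounds for a quantity between two powers. -/
theorem le_rpow_interpolate {x a b A B θ : ℝ} (hx : 0 ≤ x) (ha : 0 ≤ a) (hb : 0 ≤ b) (hA : 0 ≤ A)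
    (hB : 0 ≤ B) (hθ : 0 ≤ θ) (hθ1 : θ ≤ 1) (h1 : x ≤ A * a) (h2 : x ≤ B * b) :
    x ≤ (A ^ θ * B ^ (1 - θ)) * a ^ θ * b ^ (1 - θ) := by
  calc x = x ^ θ * x ^ (1 - θ) := by
        rw [← rpow_add_of_nonneg hx hθ (by linarith), add_sub_cancel, rpow_one]
    _ ≤ (A * a) ^ θ * (B * b) ^ (1 - θ) := by
        gcongr
    _ = _ := by rw [mul_rpow hA ha, mul_rpow hB hb]; ring

/-- Interpolation between the Lipschitz bound in time and the `γ`-Hölder bound in the parameter,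
with `γ` midway between `β` and 1. The room `γ > β` leaves the positive time exponent `1 - β / γ`.
-/
theorem exists_norm_tangentOp_diff_le (hD : ParamDomain J D ρ)
    (h : CurveFlow J D ρ pr K T L z v)
    (hK : ∀ n, Symb pr n 1 K) {β : ℝ} (hβ : 0 ≤ β) (hβ1 : β < 1) :
    ∃ C θ : ℝ, 0 ≤ C ∧ 0 < θ ∧ θ ≤ 1 ∧ ∀ t ∈ Icc (-T) T, ∀ s ∈ Icc (-T) T, ∀ Γ₁ ∈ J, ∀ Γ₂ ∈ J,
      ‖(tangentOp K D (z t) Γ₁ - tangentOp K D (z s) Γ₁) -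
        (tangentOp K D (z t) Γ₂ - tangentOp K D (z s) Γ₂)‖ ≤ C * |t - s| ^ θ * |Γ₁ - Γ₂| ^ β := by
  set γ := (1 + β) / 2 with hγ
  have hγ0 : 0 < γ := by positivity
  obtain ⟨A, hA, H⟩ := norm_tangentOp_time_sub_le hD h hK
  obtain ⟨B, hB, H'⟩ := norm_tangentOp_sub_le hD h hK (β := γ) hγ0.le (by linarith)
  have hβγ : β / γ < 1 := by rw [div_lt_one hγ0]; linarith
  have hβγ0 : 0 ≤ β / γ := by positivity
  refine ⟨(A + A) ^ (1 - β / γ) * (B + B) ^ (β / γ), 1 - β / γ, by positivity,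
    by linarith, by linarith, fun t ht s hs Γ₁ h₁ Γ₂ h₂ => ?_⟩
  · have h1 : ‖(tangentOp K D (z t) Γ₁ - tangentOp K D (z s) Γ₁) -
        (tangentOp K D (z t) Γ₂ - tangentOp K D (z s) Γ₂)‖ ≤ (A + A) * |t - s| := by
      rw [add_mul]
      exact (norm_sub_le _ _).trans (add_le_add (H t ht s hs Γ₁ h₁) (H t ht s hs Γ₂ h₂))
    have h2 : ‖(tangentOp K D (z t) Γ₁ - tangentOp K D (z s) Γ₁) -
        (tangentOp K D (z t) Γ₂ - tangentOp K D (z s) Γ₂)‖ ≤ (B + B) * |Γ₁ - Γ₂| ^ γ := by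
      rw [add_mul, sub_sub_sub_comm]
      exact (norm_sub_le _ _).trans (add_le_add (H' t ht Γ₁ h₁ Γ₂ h₂) (H' s hs Γ₁ h₁ Γ₂ h₂))
    have := le_rpow_interpolate (norm_nonneg _) (abs_nonneg _) (by positivity) (by positivity)
      (by positivity) (θ := 1 - β / γ) (by linarith) (by linarith) h1 h2
    rwa [sub_sub_cancel, ← rpow_mul (abs_nonneg (Γ₁ - Γ₂)), mul_div_cancel₀ _ hγ0.ne'] at this

/-- Taylor's estimate with `β = 1/2` and `ε = 1/4` has the integrable singularity `ρ ^ (-3/4)`. For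
differentiability any power of the increment above 1 suffices. -/
theorem CurveFlow.norm_vel_taylor_le (hD : ParamDomain J D ρ) (h : CurveFlow J D ρ pr K T L z v)
    (hK : ∀ n, Symb pr n 1 K) : ∃ C, 0 ≤ C ∧ ∀ t ∈ Icc (-T) T, ∀ Γ₁ ∈ J, ∀ Γ₂ ∈ J,
      ‖v t Γ₂ - v t Γ₁ - tangentOp K D (z t) Γ₁ (z t Γ₂ - z t Γ₁)‖ ≤
        C * |Γ₂ - Γ₁| ^ (3 / 2 : ℝ) := by
  obtain ⟨A, hA, H⟩ := h.norm_taylor_le (hK 2) (β := 1 / 2) (ε := 1 / 4) (by norm_num)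
    (by norm_num) (by norm_num) (by norm_num)
  obtain ⟨C, hC, H'⟩ := hD.norm_integral_le (F := E) (γ := 1 / 2 + 1 / 4)
    (by norm_num) (by norm_num)
  have hL := h.pos
  refine ⟨A * L ^ (3 / 2 : ℝ) * C, by positivity, fun t ht Γ₁ h₁ Γ₂ h₂ => ?_⟩
  have i1 := h.integrable_symb hD (hK 1) ht h₁
  have i2 := h.integrable_symb hD (hK 1) ht h₂
  have i3 := h.integrable_fderiv hD (symb_fderiv hK 0) ht h₁
  have i4 := i3.apply_continuousLinearMap (z t Γ₂ - z t Γ₁)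
  have i5 : IntegrableOn (fun Γ' => K (z t Γ₂ - z t Γ') - K (z t Γ₁ - z t Γ')) D := i2.sub i1
  rw [h.vel t ht Γ₁ h₁, h.vel t ht Γ₂ h₂, tangentOp, ContinuousLinearMap.integral_apply i3,
    ← integral_sub i2 i1, ← integral_sub i5 i4, mul_right_comm]
  refine H' Γ₁ h₁ Γ₂ h₂ _ (by positivity) _ ?_
  filter_upwards [hD.ae_mem h₁, hD.ae_mem h₂] with Γ' h₁' h₂'
  have := H t ht Γ₁ h₁ Γ₂ h₂ Γ' h₁'.1 h₁'.2 h₂'.2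
  rw [show (-(1 / 2 + 1 / 4) : ℝ) = -(1 / 2) - 1 / 4 by ring]
  refine this.trans ?_
  have e1 : 0 ≤ ρ Γ₁ Γ' ^ (-(1 / 2) - 1 / 4 : ℝ) := rpow_nonneg h₁'.2.le _
  have e2 : 0 ≤ ρ Γ₂ Γ' ^ (-(1 / 2) - 1 / 4 : ℝ) := rpow_nonneg h₂'.2.le _
  rw [mul_assoc A (L ^ (3 / 2 : ℝ)), ← mul_rpow hL.le (abs_nonneg _), show (1 + 1 / 2 : ℝ) = 3 / 2 by norm_num]
  gcongr
  exact h.norm_sub_le_abs hD ht h₂ h₁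

/-! ### The spatial derivative of a curve flow -/

/-- `p` is the spatial derivative of `z`, and it evolves by the linearized equation. -/
structure SpatialDeriv (J D : Set ℝ) (K : E → E) (T : ℝ) (z v p : ℝ → ℝ → E) : Prop where
  deriv : ∀ t ∈ Icc (-T) T, ∀ Γ ∈ J,
    HasDerivWithinAt (fun s => p s Γ) (tangentOp K D (z t) Γ (p t Γ)) (Icc (-T) T) t
  spatial : ∀ t ∈ Icc (-T) T, ∀ Γ ∈ J, HasDerivAt (z t) (p t Γ) Γ
  spatialVel : ∀ t ∈ Icc (-T) T, ∀ Γ ∈ J, HasDerivAt (v t) (tangentOp K D (z t) Γ (p t Γ)) Γ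

theorem hasDerivAt_of_remainder {f g : ℝ → E} {f' g' : E} {Γ C : ℝ} (hJ : J ∈ 𝓝 Γ)
    (hg : HasDerivAt g g' Γ) (hfg : ∀ Γ₁ ∈ J, ‖f Γ₁ - f Γ - (Γ₁ - Γ) • f'‖ ≤
      C * (‖g Γ₁ - g Γ - (Γ₁ - Γ) • g'‖ + |Γ₁ - Γ| ^ (3 / 2 : ℝ))) : HasDerivAt f f' Γ := by
  rw [hasDerivAt_iff_isLittleO] at hg ⊢
  have h1 : (fun x : ℝ => |x - Γ| ^ (3 / 2 : ℝ)) =o[𝓝 Γ] fun x => x - Γ := by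
    have h2 : (fun x : ℝ => |x - Γ| ^ (1 / 2 : ℝ)) =o[𝓝 Γ] fun _ => (1 : ℝ) := by
      rw [Asymptotics.isLittleO_one_iff]
      have : ContinuousAt (fun x : ℝ => |x - Γ| ^ (1 / 2 : ℝ)) Γ :=
        ContinuousAt.rpow_const (by fun_prop) (Or.inr (by norm_num))
      have h3 := this.tendsto
      simpa using h3
    refine ((h2.mul_isBigO (Asymptotics.isBigO_refl (fun x => x - Γ) _).norm_left).congr
      (fun x => ?_) (fun x => one_mul _))
    rw [Real.norm_eq_abs, ← rpow_add_one' (abs_nonneg _) (by norm_num)]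
    norm_num
  refine Asymptotics.IsBigO.trans_isLittleO (Asymptotics.IsBigO.of_bound C ?_)
    (hg.norm_left.add h1)
  filter_upwards [hJ] with x hx
  refine (hfg x hx).trans_eq ?_
  rw [Real.norm_of_nonneg (by positivity)]

/-- The candidate `p` is defined by solving the linear equation for each parameter separately. The
remainder `z t Γ₁ - z t Γ - (Γ₁ - Γ) • p` obeys the same equation up to an error of order `|Γ₁ - Γ|
^ (3/2)`, so Grönwall carries the initial differentiability to all times. -/
theorem exists_spatialDeriv (hD : ParamDomain J D ρ) (h : CurveFlow J D ρ pr K T L z v)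
    (hK : ∀ n, Symb pr n 1 K) {z₀' : ℝ → E} (h0 : ∀ Γ ∈ J, HasDerivAt (z 0) (z₀' Γ) Γ) :
    ∃ p, (∀ Γ ∈ J, p 0 Γ = z₀' Γ) ∧ SpatialDeriv J D K T z v p := by
  obtain ⟨C, hC, H⟩ := norm_tangentOp_le hD h hK
  obtain ⟨C', hC', H'⟩ := norm_tangentOp_time_sub_le hD h hK
  obtain ⟨A, hA, HA⟩ := h.norm_vel_taylor_le hD hK
  have hT := h.nonneg
  have hex : ∀ Γ, ∃ p : ℝ → E, Γ ∈ J → p 0 = z₀' Γ ∧ ∀ t ∈ Icc (-T) T,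
      HasDerivWithinAt p (tangentOp K D (z t) Γ (p t)) (Icc (-T) T) t := by
    intro Γ
    by_cases hΓ : Γ ∈ J
    · have hc : ContinuousOn (fun t => tangentOp K D (z t) Γ) (Icc (-T) T) := by
        refine LipschitzOnWith.continuousOn (K := ⟨C', hC'⟩)
          (LipschitzOnWith.of_dist_le_mul fun t ht s hs => ?_)
        rw [dist_eq_norm, Real.dist_eq]
        exact H' t ht s hs Γ hΓ
      obtain ⟨p, hp⟩ := exists_solution_linear hT hc (fun t ht => H t ht Γ hΓ) (z₀' Γ)
      exact ⟨p, fun _ => hp⟩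
    · exact ⟨0, fun h => absurd h hΓ⟩
  choose p hp using hex
  have key : ∀ t ∈ Icc (-T) T, ∀ Γ ∈ J, ∀ Γ₁ ∈ J,
      ‖z t Γ₁ - z t Γ - (Γ₁ - Γ) • p Γ t‖ ≤ (2 * (1 + A * (2 * T)) * exp (2 * C * (2 * T))) *
        (‖z 0 Γ₁ - z 0 Γ - (Γ₁ - Γ) • z₀' Γ‖ + |Γ₁ - Γ| ^ (3 / 2 : ℝ)) := by
    intro t ht Γ hΓ Γ₁ hΓ₁
    have hd : ∀ t ∈ Icc (-T) T, HasDerivWithinAt (fun t => z t Γ₁ - z t Γ - (Γ₁ - Γ) • p Γ t)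
        (v t Γ₁ - v t Γ - (Γ₁ - Γ) • tangentOp K D (z t) Γ (p Γ t)) (Icc (-T) T) t := fun t ht =>
      ((h.deriv t ht Γ₁ hΓ₁).sub (h.deriv t ht Γ hΓ)).sub (((hp Γ hΓ).2 t ht).const_smul _)
    have hg := gronwall h.zero_mem hC (ε := A * |Γ₁ - Γ| ^ (3 / 2 : ℝ)) (by positivity) hd
      (fun t ht => ?_) t ht
    · rw [(hp Γ hΓ).1] at hg
      refine hg.trans ?_
      rw [mul_right_comm _ (exp _)]
      refine mul_le_mul_of_nonneg_right ?_ (exp_pos _).le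
      set W := |Γ₁ - Γ| ^ (3 / 2 : ℝ)
      have hW : 0 ≤ W := by positivity
      nlinarith [norm_nonneg (z 0 Γ₁ - z 0 Γ - (Γ₁ - Γ) • z₀' Γ),
        mul_nonneg (mul_nonneg hA hT) (norm_nonneg (z 0 Γ₁ - z 0 Γ - (Γ₁ - Γ) • z₀' Γ))]
    · have e : v t Γ₁ - v t Γ - (Γ₁ - Γ) • tangentOp K D (z t) Γ (p Γ t) =
          tangentOp K D (z t) Γ (z t Γ₁ - z t Γ - (Γ₁ - Γ) • p Γ t) +
          (v t Γ₁ - v t Γ - tangentOp K D (z t) Γ (z t Γ₁ - z t Γ)) := by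
        simp only [map_sub, map_smul]
        abel
      rw [e]
      refine (norm_add_le _ _).trans (add_le_add ?_ (HA t ht Γ hΓ Γ₁ hΓ₁))
      exact ContinuousLinearMap.le_of_opNorm_le _ (H t ht Γ hΓ) _
  refine ⟨fun t Γ => p Γ t, fun Γ hΓ => (hp Γ hΓ).1, fun t ht Γ hΓ => (hp Γ hΓ).2 t ht,
    fun t ht Γ hΓ => hasDerivAt_of_remainder (hD.isOpen.mem_nhds hΓ) (h0 Γ hΓ)
      (key t ht Γ hΓ), fun t ht Γ hΓ => ?_⟩
  set B := 2 * (1 + A * (2 * T)) * exp (2 * C * (2 * T)) with hB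
  have hB0 : 0 ≤ B := by positivity
  refine hasDerivAt_of_remainder (C := C * B + A) (hD.isOpen.mem_nhds hΓ) (h0 Γ hΓ)
    fun Γ₁ hΓ₁ => ?_
  have e : v t Γ₁ - v t Γ - (Γ₁ - Γ) • tangentOp K D (z t) Γ (p Γ t) =
      tangentOp K D (z t) Γ (z t Γ₁ - z t Γ - (Γ₁ - Γ) • p Γ t) +
      (v t Γ₁ - v t Γ - tangentOp K D (z t) Γ (z t Γ₁ - z t Γ)) := by
    simp only [map_sub, map_smul]
    abel
  rw [e]
  have h1 := ContinuousLinearMap.le_of_opNorm_le_of_le _ (H t ht Γ hΓ) (key t ht Γ hΓ Γ₁ hΓ₁)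
  refine (norm_add_le _ _).trans ((add_le_add h1 (HA t ht Γ hΓ Γ₁ hΓ₁)).trans ?_)
  have : 0 ≤ A * ‖z 0 Γ₁ - z 0 Γ - (Γ₁ - Γ) • z₀' Γ‖ := by positivity
  linarith

end TangentOp

end BRAlpha

end

noncomputable section

namespace BRAlpha

/-! ### Regularity classes of curves and of moving curves -/

section Regularity

variable {E : Type} [NormedAddCommGroup E] [NormedSpace ℝ E]
  {F : Type} [NormedAddCommGroup F] [NormedSpace ℝ F]

/-- Curves with `n` bounded derivatives on `J`, the last one being `β`-Hölder continuous. -/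
def HReg (J : Set ℝ) (β : ℝ) : ℕ → (ℝ → E) → Prop
  | 0, f => ContinuousOn f J ∧ ∃ C, 0 ≤ C ∧ (∀ Γ ∈ J, ‖f Γ‖ ≤ C) ∧
      ∀ Γ ∈ J, ∀ Γ' ∈ J, ‖f Γ - f Γ'‖ ≤ C * |Γ - Γ'| ^ β
  | n + 1, f => (∃ C, ∀ Γ ∈ J, ‖f Γ‖ ≤ C) ∧
      ∃ f' : ℝ → E, (∀ Γ ∈ J, HasDerivAt f (f' Γ) Γ) ∧ HReg J β n f'

/-- Curves `z t` with bounded velocity `v t` which is Hölder continuous in time, uniformly on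
`J`. -/
def MovesContinuously (J : Set ℝ) (T : ℝ) (z v : ℝ → ℝ → E) : Prop :=
  (∀ t ∈ Icc (-T) T, ∀ Γ ∈ J, HasDerivWithinAt (fun s => z s Γ) (v t Γ) (Icc (-T) T) t) ∧
  ∃ C θ : ℝ, 0 ≤ C ∧ 0 < θ ∧ (∀ t ∈ Icc (-T) T, ∀ Γ ∈ J, ‖z t Γ‖ ≤ C ∧ ‖v t Γ‖ ≤ C) ∧
    ∀ t ∈ Icc (-T) T, ∀ s ∈ Icc (-T) T, ∀ Γ ∈ J, ‖v t Γ - v s Γ‖ ≤ C * |t - s| ^ θ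

/-- Curves `z t` with velocity `v t` such that `v` is Hölder continuous in time with values in
`HReg J β n`. -/
def TReg (J : Set ℝ) (β T : ℝ) : ℕ → (ℝ → ℝ → E) → (ℝ → ℝ → E) → Prop
  | 0, z, v => MovesContinuously J T z v ∧
      (∀ t ∈ Icc (-T) T, HReg J β 0 (z t) ∧ HReg J β 0 (v t)) ∧
      ∃ C θ : ℝ, 0 ≤ C ∧ 0 < θ ∧ ∀ t ∈ Icc (-T) T, ∀ s ∈ Icc (-T) T, ∀ Γ ∈ J, ∀ Γ' ∈ J,
        ‖(v t Γ - v s Γ) - (v t Γ' - v s Γ')‖ ≤ C * |t - s| ^ θ * |Γ - Γ'| ^ β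
  | n + 1, z, v => MovesContinuously J T z v ∧ ∃ z' v' : ℝ → ℝ → E,
      (∀ t ∈ Icc (-T) T, ∀ Γ ∈ J, HasDerivAt (z t) (z' t Γ) Γ ∧ HasDerivAt (v t) (v' t Γ) Γ) ∧
      TReg J β T n z' v'

variable {J : Set ℝ} {β T : ℝ}

theorem TReg.hReg {n : ℕ} {z v : ℝ → ℝ → E} (h : TReg J β T n z v) {t : ℝ}
    (ht : t ∈ Icc (-T) T) : HReg J β n (z t) ∧ HReg J β n (v t) := by
  induction n generalizing z v with
  | zero => exact h.2.1 t ht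
  | succ n ih =>
    obtain ⟨⟨_, C, θ, _, _, hC, _⟩, z', v', hd, h'⟩ := h
    exact ⟨⟨⟨C, fun Γ hΓ => (hC t ht Γ hΓ).1⟩, z' t, fun Γ hΓ => (hd t ht Γ hΓ).1, (ih h').1⟩,
      ⟨⟨C, fun Γ hΓ => (hC t ht Γ hΓ).2⟩, v' t, fun Γ hΓ => (hd t ht Γ hΓ).2, (ih h').2⟩⟩

theorem HReg.continuousOn {n : ℕ} {f : ℝ → E} (h : HReg J β n f) : ContinuousOn f J := by
  cases n with
  | zero => exact h.1
  | succ n =>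
    obtain ⟨_, f', hd, _⟩ := h
    exact fun Γ hΓ => (hd Γ hΓ).continuousAt.continuousWithinAt

theorem HReg.bounded {n : ℕ} {f : ℝ → E} (h : HReg J β n f) :
    ∃ C, 0 ≤ C ∧ ∀ Γ ∈ J, ‖f Γ‖ ≤ C := by
  cases n with
  | zero =>
    obtain ⟨_, C, hC, hb, _⟩ := h
    exact ⟨C, hC, hb⟩
  | succ n =>
    obtain ⟨⟨C, hC⟩, _⟩ := h
    exact ⟨max C 0, le_max_right _ _, fun Γ hΓ => (hC Γ hΓ).trans (le_max_left _ _)⟩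

theorem HReg.lipschitz {n : ℕ} {f : ℝ → E} (hJ : Convex ℝ J) (h : HReg J β (n + 1) f) :
    ∃ C, 0 ≤ C ∧ ∀ Γ ∈ J, ∀ Γ' ∈ J, ‖f Γ - f Γ'‖ ≤ C * |Γ - Γ'| := by
  obtain ⟨_, f', hd, hf'⟩ := h
  obtain ⟨C, hC, hb⟩ := hf'.bounded
  exact ⟨C, hC, fun Γ hΓ Γ' hΓ' => hJ.norm_image_sub_le_of_norm_hasDerivWithin_le
    (fun x hx => (hd x hx).hasDerivWithinAt) hb hΓ' hΓ⟩

/-- The exponent may change: a bounded derivative gives every exponent in `[0, 1]` one order lower,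
by the Lipschitz bound at distances below 1 and by boundedness beyond. -/
theorem HReg.of_succ {β' : ℝ} {n : ℕ} {f : ℝ → E} (hJ : Convex ℝ J) (hβ : 0 ≤ β) (hβ1 : β ≤ 1)
    (h : HReg J β' (n + 1) f) : HReg J β n f := by
  induction n generalizing f with
  | zero =>
    obtain ⟨A, hA, HA⟩ := h.bounded
    obtain ⟨B, hB, HB⟩ := h.lipschitz hJ
    refine ⟨h.continuousOn, 2 * A + B, by positivity, fun Γ hΓ => (HA Γ hΓ).trans (by linarith),
      fun Γ hΓ Γ' hΓ' => ?_⟩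
    rcases le_total |Γ - Γ'| 1 with h1 | h1
    · refine (HB Γ hΓ Γ' hΓ').trans ?_
      have := rpow_le_rpow_of_exponent_ge' (abs_nonneg (Γ - Γ')) h1 hβ hβ1
      rw [rpow_one] at this
      gcongr
      linarith
    · have h2 := one_le_rpow h1 hβ
      have h3 := (norm_sub_le _ _).trans (add_le_add (HA Γ hΓ) (HA Γ' hΓ'))
      nlinarith
  | succ n ih =>
    obtain ⟨hb, f', hd, hf'⟩ := h
    exact ⟨hb, f', hd, ih hf'⟩

theorem HReg.prodMk {n : ℕ} {f : ℝ → E} {g : ℝ → F} (hf : HReg J β n f) (hg : HReg J β n g) :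
    HReg J β n (fun Γ => (f Γ, g Γ)) := by
  induction n generalizing f g with
  | zero =>
    obtain ⟨hc, A, hA, b, H⟩ := hf
    obtain ⟨hc', A', hA', b', H'⟩ := hg
    refine ⟨hc.prodMk hc', max A A', le_max_of_le_left hA, fun Γ hΓ =>
      max_le_max (b Γ hΓ) (b' Γ hΓ), fun Γ hΓ Γ' hΓ' => ?_⟩
    rw [max_mul_of_nonneg _ _ (by positivity)]
    exact max_le_max (H Γ hΓ Γ' hΓ') (H' Γ hΓ Γ' hΓ')
  | succ n ih =>
    obtain ⟨A, hA, b⟩ := hf.bounded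
    obtain ⟨A', hA', b'⟩ := hg.bounded
    obtain ⟨_, f', hd, hf'⟩ := hf
    obtain ⟨_, g', hd', hg'⟩ := hg
    exact ⟨⟨max A A', fun Γ hΓ => max_le_max (b Γ hΓ) (b' Γ hΓ)⟩, fun Γ => (f' Γ, g' Γ),
      fun Γ hΓ => (hd Γ hΓ).prodMk (hd' Γ hΓ), ih hf' hg'⟩

theorem HReg.clm (P : E →L[ℝ] F) {n : ℕ} {f : ℝ → E} (hf : HReg J β n f) :
    HReg J β n (fun Γ => P (f Γ)) := by
  induction n generalizing f with
  | zero =>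
    obtain ⟨hc, A, hA, b, H⟩ := hf
    refine ⟨P.continuous.comp_continuousOn hc, ‖P‖ * A, by positivity, fun Γ hΓ =>
      P.le_of_opNorm_le_of_le le_rfl (b Γ hΓ), fun Γ hΓ Γ' hΓ' => ?_⟩
    rw [← map_sub, mul_assoc]
    exact P.le_of_opNorm_le_of_le le_rfl (H Γ hΓ Γ' hΓ')
  | succ n ih =>
    obtain ⟨⟨A, b⟩, f', hd, hf'⟩ := hf
    exact ⟨⟨‖P‖ * A, fun Γ hΓ => P.le_of_opNorm_le_of_le le_rfl (b Γ hΓ)⟩, fun Γ => P (f' Γ),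
      fun Γ hΓ => P.hasFDerivAt.comp_hasDerivAt Γ (hd Γ hΓ), ih hf'⟩

theorem MovesContinuously.clm (P : E →L[ℝ] F) {z v : ℝ → ℝ → E}
    (h : MovesContinuously J T z v) :
    MovesContinuously J T (fun t Γ => P (z t Γ)) (fun t Γ => P (v t Γ)) := by
  obtain ⟨hd, C, θ, hC, hθ, hb, hv⟩ := h
  refine ⟨fun t ht Γ hΓ => P.hasFDerivAt.comp_hasDerivWithinAt t (hd t ht Γ hΓ), ‖P‖ * C, θ,
    by positivity, hθ, fun t ht Γ hΓ => ⟨P.le_of_opNorm_le_of_le le_rfl (hb t ht Γ hΓ).1,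
      P.le_of_opNorm_le_of_le le_rfl (hb t ht Γ hΓ).2⟩, fun t ht s hs Γ hΓ => ?_⟩
  rw [← map_sub, mul_assoc]
  exact P.le_of_opNorm_le_of_le le_rfl (hv t ht s hs Γ hΓ)

theorem TReg.clm (P : E →L[ℝ] F) {n : ℕ} {z v : ℝ → ℝ → E} (h : TReg J β T n z v) :
    TReg J β T n (fun t Γ => P (z t Γ)) (fun t Γ => P (v t Γ)) := by
  induction n generalizing z v with
  | zero =>
    obtain ⟨hm, hr, C, θ, hC, hθ, H⟩ := h
    refine ⟨hm.clm P, fun t ht => ⟨(hr t ht).1.clm P, (hr t ht).2.clm P⟩, ‖P‖ * C, θ,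
      by positivity, hθ, fun t ht s hs Γ hΓ Γ' hΓ' => ?_⟩
    rw [← map_sub, ← map_sub, ← map_sub, mul_assoc, mul_assoc, ← mul_assoc C]
    exact P.le_of_opNorm_le_of_le le_rfl (H t ht s hs Γ hΓ Γ' hΓ')
  | succ n ih =>
    obtain ⟨hm, z', v', hd, h'⟩ := h
    exact ⟨hm.clm P, _, _, fun t ht Γ hΓ => ⟨P.hasFDerivAt.comp_hasDerivAt Γ (hd t ht Γ hΓ).1,
      P.hasFDerivAt.comp_hasDerivAt Γ (hd t ht Γ hΓ).2⟩, ih h'⟩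

end Regularity

/-! ### Curve flows have one derivative -/

section BaseRegularity

set_option linter.unusedSectionVars false

variable {E : Type} [NormedAddCommGroup E] [NormedSpace ℝ E] [FiniteDimensional ℝ E]
  {J D : Set ℝ} {ρ : ℝ → ℝ → ℝ} {pr : E →L[ℝ] Plane} {K : E → E} {T L : ℝ} {z v : ℝ → ℝ → E}

theorem CurveFlow.norm_vel_sub_le (hD : ParamDomain J D ρ) (h : CurveFlow J D ρ pr K T L z v)
    (hK : ∀ n, Symb pr n 1 K) : ∃ C, 0 ≤ C ∧ ∀ t ∈ Icc (-T) T, ∀ s ∈ Icc (-T) T, ∀ Γ ∈ J,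
      ‖v t Γ - v s Γ‖ ≤ C * |t - s| := by
  obtain ⟨A, hA, H⟩ := h.norm_symb_sub_le (hK 1) le_rfl (β := 1) (ε := 1) zero_le_one le_rfl
    one_pos le_rfl (by norm_num)
  obtain ⟨C, hC, H'⟩ := hD.norm_integral_le (F := E) (γ := 0) le_rfl one_pos
  have hL := h.pos
  refine ⟨A * L * C, by positivity, fun t ht s hs Γ hΓ => ?_⟩
  rw [h.vel t ht Γ hΓ, h.vel s hs Γ hΓ, ← integral_sub (h.integrable_symb hD (hK 1) ht hΓ)
    (h.integrable_symb hD (hK 1) hs hΓ), mul_right_comm]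
  refine H' Γ hΓ Γ hΓ _ (by positivity) _ ?_
  filter_upwards [hD.ae_mem hΓ] with Γ' hΓ'
  have h1 := H t ht s hs Γ hΓ Γ' hΓ'.1 Γ hΓ Γ' hΓ'.1 hΓ'.2 hΓ'.2
  have h2 := h.norm_diff_sub_le ht hs hΓ hΓ'.1
  have hρ := hΓ'.2
  rw [rpow_one, sub_self, zero_sub, rpow_neg_one] at h1
  rw [neg_zero, rpow_zero]
  calc _ ≤ _ := h1
    _ ≤ A * (L * ρ Γ Γ' * |t - s|) * ((ρ Γ Γ')⁻¹ + (ρ Γ Γ')⁻¹) := by gcongr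
    _ = _ := by field_simp

theorem CurveFlow.movesContinuously (hD : ParamDomain J D ρ) (h : CurveFlow J D ρ pr K T L z v)
    (hK : ∀ n, Symb pr n 1 K) : MovesContinuously J T z v := by
  obtain ⟨C, hC, H⟩ := h.norm_vel_sub_le hD hK
  have hL := h.pos
  refine ⟨h.deriv, C + L, 1, by positivity, one_pos, fun t ht Γ hΓ =>
    ⟨(h.bound t ht Γ hΓ).trans (by linarith), (h.velBound t ht Γ hΓ).trans (by linarith)⟩,
    fun t ht s hs Γ hΓ => (H t ht s hs Γ hΓ).trans ?_⟩
  rw [rpow_one]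
  gcongr
  linarith

theorem continuousOn_of_norm_sub_le {F G : Type} [NormedAddCommGroup F] [NormedAddCommGroup G]
    {f : ℝ → F} {g : ℝ → G} {C : ℝ} (hg : ContinuousOn g J) (h : ∀ Γ ∈ J, ∀ Γ' ∈ J,
      ‖f Γ - f Γ'‖ ≤ C * (‖g Γ - g Γ'‖ + |Γ - Γ'| ^ (1 / 2 : ℝ))) : ContinuousOn f J := by
  intro Γ hΓ
  have h1 : Tendsto (fun Γ' => C * (‖g Γ' - g Γ‖ + |Γ' - Γ| ^ (1 / 2 : ℝ))) (𝓝[J] Γ) (𝓝 0) := by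
    have e1 : ContinuousWithinAt (fun Γ' => C * (‖g Γ' - g Γ‖ + |Γ' - Γ| ^ (1 / 2 : ℝ))) J Γ := by
      refine continuousWithinAt_const.mul (((hg Γ hΓ).sub continuousWithinAt_const).norm.add ?_)
      exact ContinuousWithinAt.rpow_const (by fun_prop) (Or.inr (by norm_num))
    simpa using e1.tendsto
  exact tendsto_iff_norm_sub_tendsto_zero.2 (squeeze_zero' (Eventually.of_forall fun _ =>
    norm_nonneg _) (eventually_mem_nhdsWithin.mono fun Γ' hΓ' => h Γ' hΓ' Γ hΓ) h1)

theorem norm_clm_sub_le (A A' : E →L[ℝ] E) (x x' : E) :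
    ‖A x - A' x'‖ ≤ ‖A - A'‖ * ‖x‖ + ‖A'‖ * ‖x - x'‖ := by
  have e : A x - A' x' = (A - A') x + A' (x - x') := by simp
  rw [e]
  exact (norm_add_le _ _).trans (add_le_add (ContinuousLinearMap.le_opNorm _ _)
    (ContinuousLinearMap.le_opNorm _ _))

/-- Flows of Lipschitz curves move continuously with respect to the Lipschitz norm. -/
theorem CurveFlow.tReg_zero (hD : ParamDomain J D ρ) (h : CurveFlow J D ρ pr K T L z v)
    (hK : ∀ n, Symb pr n 1 K) : TReg J 1 T 0 z v := by
  have hL := h.pos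
  have hvc : ∀ t ∈ Icc (-T) T, ∀ Γ ∈ J, ∀ Γ' ∈ J, ‖v t Γ - v t Γ'‖ ≤ L * |Γ - Γ'| :=
    fun t ht Γ hΓ Γ' hΓ' => (h.velUpper t ht Γ hΓ Γ' hΓ').trans
      (mul_le_mul_of_nonneg_left (hD.le_abs _ _) hL.le)
  refine ⟨h.movesContinuously hD hK, fun t ht => ⟨⟨h.continuousOn hD ht, L, hL.le, h.bound t ht,
    fun Γ hΓ Γ' hΓ' => ?_⟩, ⟨?_, L, hL.le, h.velBound t ht, fun Γ hΓ Γ' hΓ' => ?_⟩⟩, ?_⟩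
  · rw [rpow_one]
    exact h.norm_sub_le_abs hD ht hΓ hΓ'
  · refine LipschitzOnWith.continuousOn (K := ⟨L, hL.le⟩)
      (LipschitzOnWith.of_dist_le_mul fun Γ hΓ Γ' hΓ' => ?_)
    rw [dist_eq_norm, Real.dist_eq]
    exact hvc t ht Γ hΓ Γ' hΓ'
  · rw [rpow_one]
    exact hvc t ht Γ hΓ Γ' hΓ'
  obtain ⟨A, hA, HA⟩ := h.norm_symb_sub_le (symb_fderiv hK 1) zero_le_one (β := 1)
    (ε := 1 / 2) zero_le_one le_rfl (by norm_num) (by norm_num) (by norm_num)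
  obtain ⟨B, hB, HB⟩ := h.norm_symb_le (symb_fderiv hK 0) (ε := 1 / 2) (by norm_num)
    (by norm_num) (by norm_num)
  obtain ⟨C, hC, HC⟩ := hD.norm_integral_le (F := E) (γ := 1 / 2) (by norm_num) (by norm_num)
  refine ⟨(A * L * L + B * L) * C, 1, by positivity, one_pos,
    fun t ht s hs Γ₁ h₁ Γ₂ h₂ => ?_⟩
  have i := fun (t) (ht : t ∈ Icc (-T) T) (Γ) (hΓ : Γ ∈ J) => h.integrable_symb hD (hK 1) ht hΓ
  have j1 : IntegrableOn (fun Γ' => K (z t Γ₁ - z t Γ') - K (z s Γ₁ - z s Γ')) D :=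
    (i t ht Γ₁ h₁).sub (i s hs Γ₁ h₁)
  have j2 : IntegrableOn (fun Γ' => K (z t Γ₂ - z t Γ') - K (z s Γ₂ - z s Γ')) D :=
    (i t ht Γ₂ h₂).sub (i s hs Γ₂ h₂)
  rw [h.vel t ht Γ₁ h₁, h.vel s hs Γ₁ h₁, h.vel t ht Γ₂ h₂, h.vel s hs Γ₂ h₂,
    ← integral_sub (i t ht Γ₁ h₁) (i s hs Γ₁ h₁), ← integral_sub (i t ht Γ₂ h₂) (i s hs Γ₂ h₂),
    ← integral_sub j1 j2, rpow_one, rpow_one, mul_assoc, mul_right_comm, ]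
  refine HC Γ₁ h₁ Γ₂ h₂ _ (by positivity) _ ?_
  filter_upwards [hD.ae_mem h₁, hD.ae_mem h₂] with Γ' h₁' h₂'
  rw [sub_sub_sub_comm]
  set W := ρ Γ₁ Γ' ^ (-(1 / 2) : ℝ) + ρ Γ₂ Γ' ^ (-(1 / 2) : ℝ) with hW
  have w1 : 0 ≤ ρ Γ₁ Γ' ^ (-(1 / 2) : ℝ) := rpow_nonneg h₁'.2.le _
  have w2 : 0 ≤ ρ Γ₂ Γ' ^ (-(1 / 2) : ℝ) := rpow_nonneg h₂'.2.le _
  -- the estimate of the time derivative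
  have key : ∀ r ∈ Icc (-T) T, ∀ Γ₁ ∈ J, ∀ Γ₂ ∈ J, 0 < ρ Γ₁ Γ' → 0 < ρ Γ₂ Γ' →
      ρ Γ₁ Γ' ≤ ρ Γ₂ Γ' →
      ‖fderiv ℝ K (z r Γ₁ - z r Γ') (v r Γ₁ - v r Γ') -
        fderiv ℝ K (z r Γ₂ - z r Γ') (v r Γ₂ - v r Γ')‖ ≤
      (A * L * L + B * L) * |Γ₁ - Γ₂| *
        (ρ Γ₁ Γ' ^ (-(1 / 2) : ℝ) + ρ Γ₂ Γ' ^ (-(1 / 2) : ℝ)) := by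
    intro r hr Γ₁ h₁ Γ₂ h₂ p₁ p₂ hle
    have w1 : 0 ≤ ρ Γ₁ Γ' ^ (-(1 / 2) : ℝ) := rpow_nonneg p₁.le _
    have w2 : 0 ≤ ρ Γ₂ Γ' ^ (-(1 / 2) : ℝ) := rpow_nonneg p₂.le _
    have e1 := HA r hr r hr Γ₁ h₁ Γ' h₁'.1 Γ₂ h₂ Γ' h₁'.1 p₁ p₂
    have e2 := HB r hr Γ₂ h₂ Γ' h₁'.1 p₂
    rw [sub_sub_sub_cancel_right, rpow_one] at e1
    rw [zero_sub] at e2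
    have f1 : ρ Γ₁ Γ' * ρ Γ₁ Γ' ^ (0 - 1 - 1 / 2 : ℝ) = ρ Γ₁ Γ' ^ (-(1 / 2) : ℝ) := by
      rw [← rpow_one_add' p₁.le (by norm_num)]
      norm_num
    have f2 : ρ Γ₁ Γ' * ρ Γ₂ Γ' ^ (0 - 1 - 1 / 2 : ℝ) ≤ ρ Γ₂ Γ' ^ (-(1 / 2) : ℝ) := by
      calc _ ≤ ρ Γ₂ Γ' * ρ Γ₂ Γ' ^ (0 - 1 - 1 / 2 : ℝ) := by gcongr
        _ = _ := by
          rw [← rpow_one_add' p₂.le (by norm_num)]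
          norm_num
    have q1 : 0 ≤ ρ Γ₁ Γ' ^ (0 - 1 - 1 / 2 : ℝ) := rpow_nonneg p₁.le _
    have q2 : 0 ≤ ρ Γ₂ Γ' ^ (0 - 1 - 1 / 2 : ℝ) := rpow_nonneg p₂.le _
    have e3 := h.norm_sub_le_abs hD hr h₁ h₂
    have e4 := h.velUpper r hr Γ₁ h₁ Γ' h₁'.1
    have e5 := hvc r hr Γ₁ h₁ Γ₂ h₂
    refine (norm_clm_sub_le _ _ _ _).trans ?_
    rw [sub_sub_sub_cancel_right]
    calc _ ≤ A * (L * |Γ₁ - Γ₂|) * (ρ Γ₁ Γ' ^ (0 - 1 - 1 / 2 : ℝ) +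
          ρ Γ₂ Γ' ^ (0 - 1 - 1 / 2 : ℝ)) * (L * ρ Γ₁ Γ') +
          B * ρ Γ₂ Γ' ^ (-(1 / 2) : ℝ) * (L * |Γ₁ - Γ₂|) := by
          gcongr
          refine e1.trans ?_
          gcongr
      _ = A * L * L * |Γ₁ - Γ₂| * (ρ Γ₁ Γ' * ρ Γ₁ Γ' ^ (0 - 1 - 1 / 2 : ℝ) +
          ρ Γ₁ Γ' * ρ Γ₂ Γ' ^ (0 - 1 - 1 / 2 : ℝ)) +
          B * L * |Γ₁ - Γ₂| * (ρ Γ₂ Γ' ^ (-(1 / 2) : ℝ)) := by ring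
      _ ≤ A * L * L * |Γ₁ - Γ₂| * (ρ Γ₁ Γ' ^ (-(1 / 2) : ℝ) + ρ Γ₂ Γ' ^ (-(1 / 2) : ℝ)) +
          B * L * |Γ₁ - Γ₂| * (ρ Γ₁ Γ' ^ (-(1 / 2) : ℝ) + ρ Γ₂ Γ' ^ (-(1 / 2) : ℝ)) := by
          rw [f1]
          gcongr
          linarith
      _ = _ := by ring
  have hd : ∀ r ∈ Icc (-T) T, HasDerivWithinAt
      (fun r => K (z r Γ₁ - z r Γ') - K (z r Γ₂ - z r Γ'))
      (fderiv ℝ K (z r Γ₁ - z r Γ') (v r Γ₁ - v r Γ') -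
        fderiv ℝ K (z r Γ₂ - z r Γ') (v r Γ₂ - v r Γ')) (Icc (-T) T) r := by
    intro r hr
    have d1 := ((hK 1).2.1 _ (h.cone hr h₁ h₁'.1 h₁'.2).1).hasFDerivAt
    have d2 := ((hK 1).2.1 _ (h.cone hr h₂ h₂'.1 h₂'.2).1).hasFDerivAt
    exact (d1.comp_hasDerivWithinAt r ((h.deriv r hr Γ₁ h₁).sub (h.deriv r hr Γ' h₁'.1))).sub
      (d2.comp_hasDerivWithinAt r ((h.deriv r hr Γ₂ h₂).sub (h.deriv r hr Γ' h₁'.1)))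
  have := norm_sub_le_of_hasDerivWithinAt hd
    (C := (A * L * L + B * L) * |Γ₁ - Γ₂| * W) (fun r hr => ?_) hs ht
  · exact this.trans_eq (by ring)
  -- The velocity difference has to be taken at the parameter nearer to `Γ'`: its factor `ρ` then
  -- softens both singularities of the increment of `fderiv ℝ K`, and the bound remains integrable
  -- even though the exponent in `|Γ₁ - Γ₂|` is 1.
  · rcases le_total (ρ Γ₁ Γ') (ρ Γ₂ Γ') with hle | hle
    · exact key r hr Γ₁ h₁ Γ₂ h₂ h₁'.2 h₂'.2 hle
    · rw [norm_sub_rev, hW, abs_sub_comm, add_comm (ρ Γ₁ Γ' ^ _)]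
      exact key r hr Γ₂ h₂ Γ₁ h₁ h₂'.2 h₁'.2 hle

theorem SpatialDeriv.norm_le (hD : ParamDomain J D ρ) (h : CurveFlow J D ρ pr K T L z v)
    (hK : ∀ n, Symb pr n 1 K) {p : ℝ → ℝ → E} (hp : SpatialDeriv J D K T z v p) {B : ℝ}
    (hB : 0 ≤ B) (h0 : ∀ Γ ∈ J, ‖p 0 Γ‖ ≤ B) :
    ∃ C, 0 ≤ C ∧ ∀ t ∈ Icc (-T) T, ∀ Γ ∈ J, ‖p t Γ‖ ≤ C := by
  obtain ⟨A, hA, H⟩ := norm_tangentOp_le hD h hK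
  have hT := h.nonneg
  refine ⟨2 * (B + 0 * (2 * T)) * exp (2 * A * (2 * T)), by positivity, fun t ht Γ hΓ =>
    (gronwall h.zero_mem hA le_rfl (fun t ht => hp.deriv t ht Γ hΓ) (fun t ht => ?_) t ht).trans ?_⟩
  · rw [add_zero]
    exact ContinuousLinearMap.le_of_opNorm_le _ (H t ht Γ hΓ) _
  · gcongr
    exact h0 Γ hΓ

theorem SpatialDeriv.norm_sub_le (hD : ParamDomain J D ρ) (h : CurveFlow J D ρ pr K T L z v)
    (hK : ∀ n, Symb pr n 1 K) {p : ℝ → ℝ → E} (hp : SpatialDeriv J D K T z v p) {B : ℝ}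
    (hB : 0 ≤ B) (h0 : ∀ Γ ∈ J, ‖p 0 Γ‖ ≤ B) {β : ℝ} (hβ : 0 ≤ β) (hβ1 : β < 1) :
    ∃ C, 0 ≤ C ∧ ∀ t ∈ Icc (-T) T, ∀ Γ ∈ J, ∀ Γ' ∈ J,
      ‖p t Γ - p t Γ'‖ ≤ C * (‖p 0 Γ - p 0 Γ'‖ + |Γ - Γ'| ^ β) := by
  obtain ⟨A, hA, HA⟩ := norm_tangentOp_le hD h hK
  obtain ⟨B', hB', HB'⟩ := hp.norm_le hD h hK hB h0
  obtain ⟨C, hC, HC⟩ := norm_tangentOp_sub_le hD h hK hβ hβ1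
  have hT := h.nonneg
  refine ⟨2 * (1 + C * B' * (2 * T)) * exp (2 * A * (2 * T)), by positivity,
    fun t ht Γ hΓ Γ' hΓ' => ?_⟩
  have hg := gronwall h.zero_mem hA (ε := C * |Γ - Γ'| ^ β * B') (by positivity)
    (fun t ht => (hp.deriv t ht Γ hΓ).sub (hp.deriv t ht Γ' hΓ')) (fun t ht => ?_) t ht
  · refine hg.trans ?_
    rw [mul_right_comm _ (exp _)]
    refine mul_le_mul_of_nonneg_right ?_ (exp_pos _).le
    have e1 : 0 ≤ C * B' * T * ‖p 0 Γ - p 0 Γ'‖ := by positivity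
    have e2 : 0 ≤ |Γ - Γ'| ^ β := by positivity
    simp only [Pi.sub_apply]
    linarith
  · refine (norm_clm_sub_le _ _ _ _).trans ?_
    rw [add_comm (A * _)]
    simp only [Pi.sub_apply]
    gcongr
    · exact HC t ht Γ hΓ Γ' hΓ'
    · exact HB' t ht Γ hΓ
    · exact HA t ht Γ' hΓ'

theorem abs_sub_le_rpow {T t s θ : ℝ} (hT : 0 ≤ T) (ht : t ∈ Icc (-T) T) (hs : s ∈ Icc (-T) T)
    (hθ : 0 ≤ θ) (hθ1 : θ ≤ 1) : |t - s| ≤ (1 + 2 * T) * |t - s| ^ θ := by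
  have h1 : |t - s| ≤ 1 + 2 * T := abs_le.2 ⟨by linarith [ht.1, hs.2], by linarith [ht.2, hs.1]⟩
  calc |t - s| = |t - s| ^ (1 - θ) * |t - s| ^ θ := by
        rw [← rpow_add_of_nonneg (abs_nonneg _) (by linarith) hθ, sub_add_cancel, rpow_one]
    _ ≤ (1 + 2 * T) * |t - s| ^ θ := by
        gcongr
        calc |t - s| ^ (1 - θ) ≤ (1 + 2 * T) ^ (1 - θ) := by gcongr
          _ ≤ (1 + 2 * T) ^ (1 : ℝ) := by gcongr <;> linarith
          _ = _ := rpow_one _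

theorem SpatialDeriv.tReg (hD : ParamDomain J D ρ) (h : CurveFlow J D ρ pr K T L z v)
    (hK : ∀ n, Symb pr n 1 K) {p : ℝ → ℝ → E} (hp : SpatialDeriv J D K T z v p) {β : ℝ}
    (hβ : 0 ≤ β) (hβ1 : β < 1) (h0 : HReg J β 0 (p 0)) :
    TReg J β T 0 p (fun t Γ => tangentOp K D (z t) Γ (p t Γ)) := by
  obtain ⟨hc0, B₀, hB₀, hb0, hh0⟩ := h0
  have hT := h.nonneg
  obtain ⟨A, hA, HA⟩ := norm_tangentOp_le hD h hK
  obtain ⟨A₁, hA₁, HA₁⟩ := norm_tangentOp_sub_le hD h hK hβ hβ1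
  -- For `β = 0` the Hölder bound carries no continuity; the exponent `1/2` is used to obtain it.
  obtain ⟨A₂, hA₂, HA₂⟩ := norm_tangentOp_sub_le hD h hK (β := 1 / 2) (by norm_num) (by norm_num)
  obtain ⟨A₃, hA₃, HA₃⟩ := norm_tangentOp_time_sub_le hD h hK
  obtain ⟨A₄, θ, hA₄, hθ, hθ1, HA₄⟩ := exists_norm_tangentOp_diff_le hD h hK hβ hβ1
  obtain ⟨B, hB, HB⟩ := hp.norm_le hD h hK hB₀ hb0
  obtain ⟨B₁', hB₁', HB₁'⟩ := hp.norm_sub_le hD h hK hB₀ hb0 hβ hβ1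
  obtain ⟨B₂, hB₂, HB₂⟩ := hp.norm_sub_le hD h hK hB₀ hb0 (β := 1 / 2) (by norm_num) (by norm_num)
  obtain ⟨B₁, hB₁, HB₁⟩ : ∃ B₁, 0 ≤ B₁ ∧ ∀ t ∈ Icc (-T) T, ∀ Γ ∈ J, ∀ Γ' ∈ J,
      ‖p t Γ - p t Γ'‖ ≤ B₁ * |Γ - Γ'| ^ β := by
    refine ⟨B₁' * (B₀ + 1), by positivity, fun t ht Γ hΓ Γ' hΓ' =>
      (HB₁' t ht Γ hΓ Γ' hΓ').trans ?_⟩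
    rw [mul_assoc]
    refine mul_le_mul_of_nonneg_left ?_ hB₁'
    linarith [hh0 Γ hΓ Γ' hΓ']
  have hvb : ∀ t ∈ Icc (-T) T, ∀ Γ ∈ J, ‖tangentOp K D (z t) Γ (p t Γ)‖ ≤ A * B :=
    fun t ht Γ hΓ => ContinuousLinearMap.le_of_opNorm_le_of_le _ (HA t ht Γ hΓ) (HB t ht Γ hΓ)
  have hvh : ∀ t ∈ Icc (-T) T, ∀ Γ ∈ J, ∀ Γ' ∈ J,
      ‖tangentOp K D (z t) Γ (p t Γ) - tangentOp K D (z t) Γ' (p t Γ')‖ ≤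
        (A₁ * B + A * B₁) * |Γ - Γ'| ^ β := fun t ht Γ hΓ Γ' hΓ' => by
    refine (norm_clm_sub_le _ _ _ _).trans ?_
    calc _ ≤ A₁ * |Γ - Γ'| ^ β * B + A * (B₁ * |Γ - Γ'| ^ β) := by
          gcongr
          exacts [HA₁ t ht Γ hΓ Γ' hΓ', HB t ht Γ hΓ, HA t ht Γ' hΓ', HB₁ t ht Γ hΓ Γ' hΓ']
      _ = _ := by ring
  have hpt : ∀ t ∈ Icc (-T) T, ∀ s ∈ Icc (-T) T, ∀ Γ ∈ J, ‖p t Γ - p s Γ‖ ≤ A * B * |t - s| :=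
    fun t ht s hs Γ hΓ => norm_sub_le_of_hasDerivWithinAt (fun r hr => hp.deriv r hr Γ hΓ)
      (fun r hr => hvb r hr Γ hΓ) hs ht
  have hph : ∀ t ∈ Icc (-T) T, ∀ s ∈ Icc (-T) T, ∀ Γ ∈ J, ∀ Γ' ∈ J,
      ‖(p t Γ - p s Γ) - (p t Γ' - p s Γ')‖ ≤
        (A₁ * B + A * B₁) * |Γ - Γ'| ^ β * |t - s| := fun t ht s hs Γ hΓ Γ' hΓ' => by
    rw [sub_sub_sub_comm]
    exact norm_sub_le_of_hasDerivWithinAt (f := fun r => p r Γ - p r Γ')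
      (fun r hr => (hp.deriv r hr Γ hΓ).sub (hp.deriv r hr Γ' hΓ'))
      (fun r hr => hvh r hr Γ hΓ Γ' hΓ') hs ht
  have hMc : ∀ t ∈ Icc (-T) T, ContinuousOn (tangentOp K D (z t)) J := fun t ht => by
    refine continuousOn_of_norm_sub_le (g := fun _ => (0 : ℝ)) (C := A₂) continuousOn_const
      fun Γ hΓ Γ' hΓ' => ?_
    rw [sub_self, norm_zero, zero_add]
    exact HA₂ t ht Γ hΓ Γ' hΓ'
  have hpc : ∀ t ∈ Icc (-T) T, ContinuousOn (p t) J := fun t ht =>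
    continuousOn_of_norm_sub_le hc0 (HB₂ t ht)
  refine ⟨⟨hp.deriv, B + A * B + (A₃ * B + A * (A * B)), 1, by positivity, one_pos,
    fun t ht Γ hΓ => ⟨(HB t ht Γ hΓ).trans ?_, (hvb t ht Γ hΓ).trans ?_⟩,
    fun t ht s hs Γ hΓ => ?_⟩,
    fun t ht => ⟨⟨hpc t ht, B + B₁, by positivity, fun Γ hΓ => (HB t ht Γ hΓ).trans (by linarith),
      fun Γ hΓ Γ' hΓ' => (HB₁ t ht Γ hΓ Γ' hΓ').trans ?_⟩,
      ⟨(hMc t ht).clm_apply (hpc t ht), A * B + (A₁ * B + A * B₁), by positivity,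
        fun Γ hΓ => (hvb t ht Γ hΓ).trans ?_,
        fun Γ hΓ Γ' hΓ' => (hvh t ht Γ hΓ Γ' hΓ').trans ?_⟩⟩, ?_⟩
  · have : 0 ≤ A * B + (A₃ * B + A * (A * B)) := by positivity
    linarith
  · have : 0 ≤ B + (A₃ * B + A * (A * B)) := by positivity
    linarith
  · refine (norm_clm_sub_le _ _ _ _).trans ?_
    rw [rpow_one]
    calc _ ≤ A₃ * |t - s| * B + A * (A * B * |t - s|) := by
          gcongr
          exacts [HA₃ t ht s hs Γ hΓ, HB t ht Γ hΓ, HA s hs Γ hΓ, hpt t ht s hs Γ hΓ]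
      _ = (A₃ * B + A * (A * B)) * |t - s| := by ring
      _ ≤ _ := by
          refine mul_le_mul_of_nonneg_right ?_ (abs_nonneg _)
          have : 0 ≤ B + A * B := by positivity
          linarith
  · gcongr
    linarith
  · have : 0 ≤ A₁ * B + A * B₁ := by positivity
    linarith
  · refine mul_le_mul_of_nonneg_right ?_ (by positivity)
    have : 0 ≤ A * B := by positivity
    linarith
  set Q := 1 + 2 * T with hQ
  have hQ0 : 0 ≤ Q := by positivity
  refine ⟨A₄ * B + A₃ * Q * B₁ + A₁ * (A * B * Q) + A * ((A₁ * B + A * B₁) * Q), θ,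
    by positivity, hθ, fun t ht s hs Γ hΓ Γ' hΓ' => ?_⟩
  set X := |Γ - Γ'| ^ β with hX
  have hX0 : 0 ≤ X := by positivity
  have hQt : |t - s| ≤ Q * |t - s| ^ θ := abs_sub_le_rpow hT ht hs hθ.le hθ1
  set Y := |t - s| ^ θ with hY
  have hY0 : 0 ≤ Y := by positivity
  -- Discrete product rule in time; taking the increment in `Γ` of both products leaves four terms,
  -- each with a known bound.
  have e : ∀ Γ, tangentOp K D (z t) Γ (p t Γ) - tangentOp K D (z s) Γ (p s Γ) =
      (tangentOp K D (z t) Γ - tangentOp K D (z s) Γ) (p t Γ) +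
        tangentOp K D (z s) Γ (p t Γ - p s Γ) := fun Γ => by simp
  rw [e, e, add_sub_add_comm]
  refine (norm_add_le _ _).trans ((add_le_add (norm_clm_sub_le _ _ _ _)
    (norm_clm_sub_le _ _ _ _)).trans ?_)
  calc _ ≤ (A₄ * Y * X * B + A₃ * |t - s| * (B₁ * X)) +
        (A₁ * X * (A * B * |t - s|) + A * ((A₁ * B + A * B₁) * X * |t - s|)) := by
        gcongr
        exacts [HA₄ t ht s hs Γ hΓ Γ' hΓ', HB t ht Γ hΓ, HA₃ t ht s hs Γ' hΓ',
          HB₁ t ht Γ hΓ Γ' hΓ', HA₁ s hs Γ hΓ Γ' hΓ', hpt t ht s hs Γ hΓ, HA s hs Γ' hΓ',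
          hph t ht s hs Γ hΓ Γ' hΓ']
    _ ≤ (A₄ * Y * X * B + A₃ * (Q * Y) * (B₁ * X)) +
        (A₁ * X * (A * B * (Q * Y)) + A * ((A₁ * B + A * B₁) * X * (Q * Y))) := by gcongr
    _ = _ := by ring

theorem CurveFlow.tReg_one (hD : ParamDomain J D ρ) (h : CurveFlow J D ρ pr K T L z v)
    (hK : ∀ n, Symb pr n 1 K) {β : ℝ} (hβ : 0 ≤ β) (hβ1 : β < 1) (h0 : HReg J β 1 (z 0)) :
    TReg J β T 1 z v := by
  obtain ⟨_, z₀', hd, hr⟩ := h0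
  obtain ⟨p, hp0, hp⟩ := exists_spatialDeriv hD h hK hd
  refine ⟨h.movesContinuously hD hK, p, _, fun t ht Γ hΓ =>
    ⟨hp.spatial t ht Γ hΓ, hp.spatialVel t ht Γ hΓ⟩, hp.tReg hD h hK hβ hβ1 ?_⟩
  obtain ⟨hc, C, hC, hb, hh⟩ := hr
  refine ⟨hc.congr hp0, C, hC, fun Γ hΓ => by rw [hp0 Γ hΓ]; exact hb Γ hΓ,
    fun Γ hΓ Γ' hΓ' => by rw [hp0 Γ hΓ, hp0 Γ' hΓ']; exact hh Γ hΓ Γ' hΓ'⟩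

end BaseRegularity

end BRAlpha

end

noncomputable section

namespace BRAlpha

/-! ### Intervals and the circle as parameter domains -/

/-- On intervals centred at `Γ` the integral does not depend on `Γ`, which gives the uniform
constant required of a parameter domain. -/
theorem exists_integral_abs_sub_rpow_le {γ R : ℝ} (hγ1 : γ < 1) (hR : 0 ≤ R) :
    ∃ C, 0 ≤ C ∧ ∀ Γ : ℝ,
      IntervalIntegrable (fun Γ' => |Γ - Γ'| ^ (-γ)) volume (Γ - R) (Γ + R) ∧
        ∫ Γ' in (Γ - R)..(Γ + R), |Γ - Γ'| ^ (-γ) = C := by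
  have h1 : ∀ R : ℝ, 0 ≤ R → IntervalIntegrable (fun u : ℝ => |u| ^ (-γ)) volume 0 R := by
    intro R hR
    refine (intervalIntegral.intervalIntegrable_rpow' (r := -γ) (by linarith)).congr
      fun u hu => ?_
    rw [uIoc_of_le hR] at hu
    simp only [abs_of_pos hu.1]
  have h2 : IntervalIntegrable (fun u : ℝ => |u| ^ (-γ)) volume (-R) R := by
    refine IntervalIntegrable.trans (b := 0) ?_ (h1 R hR)
    have := (IntervalIntegrable.iff_comp_neg (by simp)).1 (h1 R hR)
    simp only [abs_neg, neg_zero] at this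
    exact this.symm
  refine ⟨∫ u in (-R)..R, |u| ^ (-γ), intervalIntegral.integral_nonneg (by linarith)
    fun u _ => by positivity, fun Γ => ⟨?_, ?_⟩⟩
  · have := (h2.comp_sub_left Γ).symm
    simpa using this
  · rw [intervalIntegral.integral_comp_sub_left (fun u => |u| ^ (-γ)) Γ]
    simp

theorem paramDomain_Ioo (a b : ℝ) :
    ParamDomain (Ioo a b) (Ioo a b) (fun Γ Γ' => |Γ - Γ'|) where
  isOpen := isOpen_Ioo
  measurableSet := measurableSet_Ioo
  subset := subset_rfl
  finite := by simp
  nonneg _ _ := abs_nonneg _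
  le_abs _ _ := le_rfl
  ae_pos Γ _ := by
    filter_upwards [ae_restrict_of_ae (Measure.ae_ne volume Γ)] with Γ' h
    exact abs_pos.2 (sub_ne_zero.2 h.symm)
  integrable γ _ hγ1 := by
    obtain ⟨C, hC, H⟩ := exists_integral_abs_sub_rpow_le hγ1 (abs_nonneg (b - a))
    refine ⟨C, hC, fun Γ hΓ => ?_⟩
    have hab : a < b := hΓ.1.trans hΓ.2
    rw [abs_of_pos (sub_pos.2 hab)] at H
    obtain ⟨h1, h2⟩ := H Γ
    have hle : Γ - (b - a) ≤ Γ + (b - a) := by linarith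
    have hs : Ioo a b ⊆ Ioc (Γ - (b - a)) (Γ + (b - a)) := fun x hx =>
      ⟨by linarith [hx.1, hΓ.2], by linarith [hx.2, hΓ.1]⟩
    rw [intervalIntegrable_iff_integrableOn_Ioc_of_le hle] at h1
    rw [intervalIntegral.integral_of_le hle] at h2
    refine ⟨h1.mono_set hs, h2 ▸ setIntegral_mono_set h1 ?_ hs.eventuallyLE⟩
    exact Eventually.of_forall fun x => by positivity

/-- The distance on `ℝ/2πℤ`. -/
def circleDist (Γ Γ' : ℝ) : ℝ := ‖((Γ - Γ' : ℝ) : AddCircle (2 * π))‖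

theorem circleDist_le_abs (Γ Γ' : ℝ) : circleDist Γ Γ' ≤ |Γ - Γ'| :=
  QuotientAddGroup.norm_mk_le_norm

theorem exists_circleDist_eq (Γ Γ' : ℝ) : ∃ k : ℤ, circleDist Γ Γ' = |Γ - Γ' - k * (2 * π)| :=
  ⟨_, AddCircle.norm_eq (2 * π)⟩

theorem circleDist_nonneg (Γ Γ' : ℝ) : 0 ≤ circleDist Γ Γ' := norm_nonneg _

theorem circleDist_add_right (Γ Γ' h : ℝ) : circleDist (Γ + h) (Γ' + h) = circleDist Γ Γ' := by
  rw [circleDist, circleDist, add_sub_add_right_eq_sub]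

theorem circleDist_pos_iff {Γ Γ' : ℝ} :
    0 < circleDist Γ Γ' ↔ (Γ : AddCircle (2 * π)) ≠ (Γ' : AddCircle (2 * π)) := by
  rw [circleDist, norm_pos_iff, AddCircle.coe_sub, sub_ne_zero]

theorem circleDist_eq_abs {Γ Γ' : ℝ} (h : |Γ - Γ'| ≤ π) : circleDist Γ Γ' = |Γ - Γ'| := by
  refine (AddCircle.norm_coe_eq_abs_iff (2 * π) (by positivity)).2 ?_
  rw [abs_of_pos (by positivity : 0 < 2 * π)]
  linarith

theorem circleDist_pos {Γ Γ' : ℝ} (h : Γ' ∈ Ioo Γ (Γ + 2 * π)) : 0 < circleDist Γ Γ' := by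
  have : Fact (0 < 2 * π) := ⟨by positivity⟩
  rw [circleDist_pos_iff]
  intro h0
  have := (AddCircle.coe_eq_coe_iff_of_mem_Ico (p := 2 * π) (a := Γ) ⟨le_rfl, by linarith [h.1, h.2]⟩
    ⟨h.1.le, h.2⟩).1 h0
  exact h.1.ne this

theorem circleDist_add_period (Γ Γ' : ℝ) : circleDist Γ (Γ' + 2 * π) = circleDist Γ Γ' := by
  rw [circleDist, circleDist, AddCircle.coe_sub, AddCircle.coe_sub, AddCircle.coe_add_period]

section Periodic

set_option linter.unusedSectionVars false

variable {F : Type} [NormedAddCommGroup F] [NormedSpace ℝ F]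

theorem norm_sub_le_circleDist {f : ℝ → F} (hf : Function.Periodic f (2 * π)) {C β : ℝ}
    (h : ∀ Γ Γ', ‖f Γ - f Γ'‖ ≤ C * |Γ - Γ'| ^ β) (Γ Γ' : ℝ) :
    ‖f Γ - f Γ'‖ ≤ C * circleDist Γ Γ' ^ β := by
  obtain ⟨k, hk⟩ := exists_circleDist_eq Γ Γ'
  rw [hk, ← hf.sub_int_mul_eq k (x := Γ), sub_right_comm]
  exact h _ _

theorem integral_circle_eq {f : ℝ → F} (hf : Function.Periodic f (2 * π)) (a : ℝ) :
    ∫ Γ' in Ioo 0 (2 * π), f Γ' = ∫ Γ' in a..(a + 2 * π), f Γ' := by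
  rw [hf.intervalIntegral_add_eq a 0, zero_add, intervalIntegral.integral_of_le (by positivity),
    integral_Ioc_eq_integral_Ioo]

theorem integral_circle_add {f : ℝ → F} (hf : Function.Periodic f (2 * π)) (h : ℝ) :
    ∫ Γ' in Ioo 0 (2 * π), f (Γ' + h) = ∫ Γ' in Ioo 0 (2 * π), f Γ' := by
  have h1 : Function.Periodic (fun Γ' => f (Γ' + h)) (2 * π) := fun x => by
    simp only
    rw [add_right_comm]
    exact hf _
  rw [integral_circle_eq h1 0, intervalIntegral.integral_comp_add_right, integral_circle_eq hf h,
    zero_add, zero_add, add_comm h]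

theorem integrableOn_circle_iff {f : ℝ → F} (hf : Function.Periodic f (2 * π)) (a : ℝ) :
    IntegrableOn f (Ioo 0 (2 * π)) ↔ IntervalIntegrable f volume a (a + 2 * π) := by
  rw [hf.intervalIntegrable_iff (t₁ := a) (t₂ := 0), zero_add,
    intervalIntegrable_iff_integrableOn_Ioo_of_le (by positivity)]

theorem periodic_of_hasDerivAt {f f' : ℝ → F} {c : ℝ} (hf : Function.Periodic f c)
    (hd : ∀ Γ, HasDerivAt f (f' Γ) Γ) : Function.Periodic f' c := by
  intro Γ
  have h1 := (hd (Γ + c)).comp_add_const Γ c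
  have h2 : (fun x => f (x + c)) = f := funext hf
  rw [h2] at h1
  exact h1.unique (hd Γ)

theorem integrableOn_circle_add {f : ℝ → F} (hf : Function.Periodic f (2 * π))
    (hi : IntegrableOn f (Ioo 0 (2 * π))) (h : ℝ) :
    IntegrableOn (fun Γ' => f (Γ' + h)) (Ioo 0 (2 * π)) := by
  have h1 : Function.Periodic (fun Γ' => f (Γ' + h)) (2 * π) := fun x => by
    simp only
    rw [add_right_comm]
    exact hf _
  rw [integrableOn_circle_iff h1 0]
  have := ((integrableOn_circle_iff hf h).1 hi).comp_add_right h
  rwa [sub_self, add_sub_cancel_left, ← zero_add (2 * π)] at this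

theorem paramDomain_circle : ParamDomain univ (Ioo 0 (2 * π)) circleDist where
  isOpen := isOpen_univ
  measurableSet := measurableSet_Ioo
  subset := subset_univ _
  finite := by simp [ENNReal.mul_lt_top]
  nonneg := circleDist_nonneg
  le_abs := circleDist_le_abs
  ae_pos Γ _ := by
    have hc : (range fun k : ℤ => Γ - k • (2 * π)).Countable := countable_range _
    filter_upwards [ae_restrict_of_ae (measure_eq_zero_iff_ae_notMem.1 (hc.measure_zero volume))]
      with Γ' h
    rw [circleDist, norm_pos_iff]
    intro h0
    obtain ⟨n, hn⟩ := (AddCircle.coe_eq_zero_iff (2 * π)).1 h0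
    exact h ⟨n, by simp only [hn]; ring⟩
  integrable γ _ hγ1 := by
    obtain ⟨C, hC, H⟩ := exists_integral_abs_sub_rpow_le hγ1 pi_pos.le
    refine ⟨C, hC, fun Γ _ => ?_⟩
    have hper : Function.Periodic (fun Γ' => circleDist Γ Γ' ^ (-γ)) (2 * π) := fun x => by
      simp only [circleDist_add_period]
    obtain ⟨h1, h2⟩ := H Γ
    have he : Γ - π + 2 * π = Γ + π := by ring
    have hle : Γ - π ≤ Γ + π := by linarith [pi_pos]
    have heq : EqOn (fun Γ' => |Γ - Γ'| ^ (-γ)) (fun Γ' => circleDist Γ Γ' ^ (-γ))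
        (uIoc (Γ - π) (Γ + π)) := fun x hx => by
      rw [uIoc_of_le hle] at hx
      simp only
      rw [circleDist_eq_abs (abs_le.2 ⟨by linarith [hx.2], by linarith [hx.1]⟩)]
    rw [integrableOn_circle_iff hper (Γ - π), integral_circle_eq hper (Γ - π), he]
    refine ⟨h1.congr heq, le_of_eq ?_⟩
    rw [← h2, intervalIntegral.integral_of_le hle, intervalIntegral.integral_of_le hle]
    rw [uIoc_of_le hle] at heq
    exact (setIntegral_congr_fun measurableSet_Ioc heq).symm

end Periodic

/-! ### The tangent flow of a closed curve -/

section Circle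

set_option linter.unusedSectionVars false

variable {E : Type} [NormedAddCommGroup E] [NormedSpace ℝ E] [FiniteDimensional ℝ E]
  {pr : E →L[ℝ] Plane} {K : E → E} {T L : ℝ} {z v : ℝ → ℝ → E}

local notation "𝔻" => Ioo (0 : ℝ) (2 * π)

theorem CurveFlow.periodic (h : CurveFlow univ 𝔻 circleDist pr K T L z v) {t : ℝ}
    (ht : t ∈ Icc (-T) T) : Function.Periodic (z t) (2 * π) ∧ Function.Periodic (v t) (2 * π) := by
  have h0 : ∀ Γ, circleDist (Γ + 2 * π) Γ = 0 := fun Γ => by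
    rw [circleDist, add_sub_cancel_left, AddCircle.coe_period, norm_zero]
  refine ⟨fun Γ => ?_, fun Γ => ?_⟩
  · have := h.upper t ht (Γ + 2 * π) trivial Γ trivial
    rw [h0, mul_zero] at this
    exact sub_eq_zero.1 (norm_le_zero_iff.1 this)
  · have := h.velUpper t ht (Γ + 2 * π) trivial Γ trivial
    rw [h0, mul_zero] at this
    exact sub_eq_zero.1 (norm_le_zero_iff.1 this)

theorem SpatialDeriv.periodic (h : CurveFlow univ 𝔻 circleDist pr K T L z v) {p : ℝ → ℝ → E}
    (hp : SpatialDeriv univ 𝔻 K T z v p) {t : ℝ} (ht : t ∈ Icc (-T) T) :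
    Function.Periodic (p t) (2 * π) ∧
      Function.Periodic (fun Γ => tangentOp K 𝔻 (z t) Γ (p t Γ)) (2 * π) :=
  ⟨periodic_of_hasDerivAt (h.periodic ht).1 fun Γ => hp.spatial t ht Γ trivial,
    periodic_of_hasDerivAt (h.periodic ht).2 fun Γ => hp.spatialVel t ht Γ trivial⟩

theorem CurveFlow.integrable_mul (h : CurveFlow univ 𝔻 circleDist pr K T L z v)
    (hK : ∀ n, Symb pr n 1 K) {p : ℝ → E} {t : ℝ}
    (ht : t ∈ Icc (-T) T) (hc : Continuous p) (Γ : ℝ) :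
    IntegrableOn (fun Γ' => fderiv ℝ K (z t Γ - z t Γ') (p Γ')) 𝔻 := by
  have i1 := h.integrable_fderiv paramDomain_circle (symb_fderiv hK 0) ht (mem_univ Γ)
  obtain ⟨B, hB⟩ := isCompact_Icc.exists_bound_of_continuousOn (s := Icc 0 (2 * π)) hc.continuousOn
  refine Integrable.mono' (i1.norm.mul_const B) ?_ ?_
  · exact isBoundedBilinearMap_apply.continuous.comp_aestronglyMeasurable
      (i1.aestronglyMeasurable.prodMk hc.aestronglyMeasurable)
  · filter_upwards [ae_restrict_mem measurableSet_Ioo] with Γ' hΓ'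
    exact ContinuousLinearMap.le_opNorm_of_le _ (hB Γ' (Ioo_subset_Icc_self hΓ'))

/-- By periodicity, the kernel of the linearized equation may be applied to differences. -/
theorem SpatialDeriv.tangentOp_eq (h : CurveFlow univ 𝔻 circleDist pr K T L z v)
    (hK : ∀ n, Symb pr n 1 K) {p : ℝ → ℝ → E} (hp : SpatialDeriv univ 𝔻 K T z v p) {t : ℝ}
    (ht : t ∈ Icc (-T) T) (hc : Continuous (p t)) (Γ : ℝ) :
    IntegrableOn (fun Γ' => fderiv ℝ K (z t Γ - z t Γ') (p t Γ - p t Γ')) 𝔻 ∧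
    tangentOp K 𝔻 (z t) Γ (p t Γ) =
      ∫ Γ' in 𝔻, fderiv ℝ K (z t Γ - z t Γ') (p t Γ - p t Γ') := by
  have hL := h.pos
  have i1 := h.integrable_fderiv paramDomain_circle (symb_fderiv hK 0) ht (mem_univ Γ)
  have i2 := h.integrable_mul hK ht hc Γ
  have i3 := i1.apply_continuousLinearMap (p t Γ)
  have hz := (h.periodic ht).1
  have hpp := (hp.periodic h ht).1
  have hper : Function.Periodic (fun Γ' => fderiv ℝ K (z t Γ - z t Γ') (p t Γ')) (2 * π) :=
    fun x => by simp only [hz x, hpp x]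
  -- Order one with a loss of `1/2`: the kernel vanishes at least like the square root of the
  -- distance, so it has limit zero at both ends of the period that starts at `Γ`.
  obtain ⟨C', hC', H'⟩ := hK 0 (1 / 2) (by norm_num) (by norm_num) (L ^ 2 + 2 * L)
  obtain ⟨C, hC, H⟩ : ∃ C, 0 ≤ C ∧ ∀ x, 0 < circleDist Γ x →
      ‖K (z t Γ - z t x)‖ ≤ C * circleDist Γ x ^ (1 / 2 : ℝ) := by
    refine ⟨C' * (‖pr‖ * L) ^ (1 / 2 : ℝ), by positivity, fun x hx => ?_⟩
    refine (H' _ (h.cone ht (mem_univ Γ) (mem_univ x) hx)).trans ?_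
    rw [mul_assoc, ← mul_rpow (by positivity) hx.le, show (1 : ℝ) - 1 / 2 = 1 / 2 by norm_num,
      mul_assoc ‖pr‖]
    gcongr
    exact pr.le_of_opNorm_le_of_le le_rfl (h.upper t ht Γ trivial x trivial)
  have hlim : ∀ {l : Filter ℝ} {g : ℝ → ℝ}, (∀ᶠ x in l, x ∈ Ioo Γ (Γ + 2 * π)) →
      Tendsto g l (𝓝 0) → (∀ x, circleDist Γ x ≤ |g x|) →
      Tendsto (fun x => K (z t Γ - z t x)) l (𝓝 0) := by
    intro l g hl hg hle
    have h1 : Tendsto (fun x => C * |g x| ^ (1 / 2 : ℝ)) l (𝓝 0) := by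
      have := ((hg.abs).rpow_const (p := 1 / 2) (Or.inr (by norm_num))).const_mul C
      simpa using this
    refine squeeze_zero_norm' (hl.mono fun x hx => ?_) h1
    refine (H x (circleDist_pos hx)).trans ?_
    gcongr
    · exact circleDist_nonneg _ _
    · exact hle x
  -- The integrand is minus the derivative of `Γ' ↦ K (z t Γ - z t Γ')`, and the period is cut at
  -- `Γ`, where the chord vanishes.
  have hzero : ∫ Γ' in 𝔻, fderiv ℝ K (z t Γ - z t Γ') (p t Γ') = 0 := by
    have hlt : Γ < Γ + 2 * π := by linarith [pi_pos]
    rw [integral_circle_eq hper Γ, ← neg_eq_zero, ← intervalIntegral.integral_neg]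
    have := intervalIntegral.integral_eq_sub_of_hasDerivAt_of_tendsto hlt
      (f := fun x => K (z t Γ - z t x)) (fa := 0) (fb := 0)
      (f' := fun x => -(fderiv ℝ K (z t Γ - z t x) (p t x))) (fun x hx => ?_)
      (((integrableOn_circle_iff hper Γ).1 i2).neg) ?_ ?_
    · rw [this, sub_zero]
    · have d1 := ((hK 1).2.1 _ (h.cone ht (mem_univ Γ) (mem_univ x) (circleDist_pos hx)).1).hasFDerivAt
      have := d1.comp_hasDerivAt x ((hp.spatial t ht x trivial).const_sub (z t Γ))
      rwa [map_neg] at this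
    · refine hlim (Ioo_mem_nhdsGT hlt) (g := fun x => Γ - x) ?_ fun x => circleDist_le_abs _ _
      have : Tendsto (fun x => Γ - x) (𝓝 Γ) (𝓝 (Γ - Γ)) := by
        exact (continuous_const.sub continuous_id).tendsto Γ
      rw [sub_self] at this
      exact this.mono_left nhdsWithin_le_nhds
    · refine hlim (Ioo_mem_nhdsLT hlt) (g := fun x => Γ + 2 * π - x) ?_ fun x => ?_
      · have : Tendsto (fun x => Γ + 2 * π - x) (𝓝 (Γ + 2 * π))
            (𝓝 (Γ + 2 * π - (Γ + 2 * π))) :=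
          (continuous_const.sub continuous_id).tendsto (Γ + 2 * π)
        rw [sub_self] at this
        exact this.mono_left nhdsWithin_le_nhds
      · have h1 := circleDist_le_abs (Γ + 2 * π) x
        rwa [← circleDist_add_period, circleDist_add_right] at h1
  simp only [map_sub]
  refine ⟨i3.sub i2, ?_⟩
  rw [integral_sub i3 i2, hzero, sub_zero, tangentOp, ContinuousLinearMap.integral_apply i1]

end Circle

end BRAlpha

end

noncomputable section

namespace BRAlpha

/-! ### Higher regularity of closed curves -/

section HigherRegularity

variable {E : Type} [NormedAddCommGroup E] [NormedSpace ℝ E] [FiniteDimensional ℝ E]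
  {pr : E →L[ℝ] Plane} {K : E → E} {T L : ℝ} {z v : ℝ → ℝ → E}

local notation "𝔻" => Ioo (0 : ℝ) (2 * π)

/-- The integration variable is shifted together with `Γ`, so chords of `z` change by `O(|h|)`. The
resulting singularity `ρ ^ (-5/4)` is multiplied by `p Γ - p Γ' = O(ρ ^ (1/2))`, which leaves `ρ ^
(-3/4)`: this recovers the Lipschitz endpoint. The increments of `p` at all parameters enter, hence
the uniform bound `m`. -/
theorem SpatialDeriv.norm_shift_le (h : CurveFlow univ 𝔻 circleDist pr K T L z v)
    (hK : ∀ n, Symb pr n 1 K) {p : ℝ → ℝ → E} (hp : SpatialDeriv univ 𝔻 K T z v p)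
    (hc : ∀ t ∈ Icc (-T) T, Continuous (p t)) {B : ℝ} (hB : 0 ≤ B)
    (hb : ∀ t ∈ Icc (-T) T, ∀ Γ Γ', ‖p t Γ - p t Γ'‖ ≤ B * |Γ - Γ'| ^ (1 / 2 : ℝ)) :
    ∃ C, 0 ≤ C ∧ ∀ t ∈ Icc (-T) T, ∀ h m : ℝ, (∀ Γ, ‖p t (Γ + h) - p t Γ‖ ≤ m) → ∀ Γ,
      ‖tangentOp K 𝔻 (z t) (Γ + h) (p t (Γ + h)) - tangentOp K 𝔻 (z t) Γ (p t Γ)‖ ≤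
        C * m + C * |h| := by
  have hL := h.pos
  obtain ⟨A, hA, HA⟩ := h.norm_symb_sub_le (symb_fderiv hK 1) zero_le_one (β := 1)
    (ε := 1 / 4) zero_le_one le_rfl (by norm_num) (by norm_num) (by norm_num)
  obtain ⟨A', hA', HA'⟩ := h.norm_symb_le (symb_fderiv hK 0) (ε := 3 / 4) (by norm_num)
    (by norm_num) (by norm_num)
  obtain ⟨C, hC, HC⟩ := paramDomain_circle.norm_integral_le (F := E) (γ := 3 / 4) (by norm_num)
    (by norm_num)
  refine ⟨(4 * A * L * B + 2 * A') * C, by positivity, fun t ht δ m hm Γ => ?_⟩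
  have hm0 : 0 ≤ m := (norm_nonneg _).trans (hm 0)
  obtain ⟨i1, e1⟩ := hp.tangentOp_eq h hK ht (hc t ht) Γ
  obtain ⟨i2, e2⟩ := hp.tangentOp_eq h hK ht (hc t ht) (Γ + δ)
  have hz := (h.periodic ht).1
  have hpp := (hp.periodic h ht).1
  have hper : Function.Periodic
      (fun Γ' => fderiv ℝ K (z t (Γ + δ) - z t Γ') (p t (Γ + δ) - p t Γ')) (2 * π) :=
    fun x => by simp only [hz x, hpp x]
  rw [e1, e2, ← integral_circle_add hper δ,
    ← integral_sub (integrableOn_circle_add hper i2 δ) i1]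
  have hle : (2 * A * L * B * |δ| + A' * m) * C ≤
      (4 * A * L * B + 2 * A') * C * m + (4 * A * L * B + 2 * A') * C * |δ| := by
    have q1 : 0 ≤ A * L * B * C * m := by positivity
    have q2 : 0 ≤ A * L * B * C * |δ| := by positivity
    have q3 : 0 ≤ A' * C * m := by positivity
    have q4 : 0 ≤ A' * C * |δ| := by positivity
    linarith
  refine (HC Γ trivial Γ trivial (2 * A * L * B * |δ| + A' * m) (by positivity) _ ?_).trans hle
  filter_upwards [paramDomain_circle.ae_mem (mem_univ Γ)] with Γ' hΓ'
  have hρ := hΓ'.2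
  have hρ' : 0 < circleDist (Γ + δ) (Γ' + δ) := by rwa [circleDist_add_right]
  have f1 := HA t ht t ht (Γ + δ) trivial (Γ' + δ) trivial Γ trivial Γ' trivial hρ' hρ
  have f2 := HA' t ht Γ trivial Γ' trivial hρ
  have f3 := norm_sub_le_circleDist hpp (hb t ht) (Γ + δ) (Γ' + δ)
  rw [circleDist_add_right] at f1 f3
  rw [rpow_one] at f1
  rw [zero_sub] at f2
  have f4 : ‖z t (Γ + δ) - z t (Γ' + δ) - (z t Γ - z t Γ')‖ ≤ 2 * L * |δ| := by
    have g1 := h.norm_sub_le_abs paramDomain_circle ht (mem_univ (Γ + δ)) (mem_univ Γ)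
    have g2 := h.norm_sub_le_abs paramDomain_circle ht (mem_univ (Γ' + δ)) (mem_univ Γ')
    rw [add_sub_cancel_left] at g1 g2
    rw [sub_sub_sub_comm]
    exact (_root_.norm_sub_le _ _).trans (by linarith)
  have f5 : ‖p t (Γ + δ) - p t (Γ' + δ) - (p t Γ - p t Γ')‖ ≤ 2 * m := by
    rw [sub_sub_sub_comm]
    exact (_root_.norm_sub_le _ _).trans (by linarith [hm Γ, hm Γ'])
  set r := circleDist Γ Γ' with hr
  have er : r ^ (0 - 1 - 1 / 4 : ℝ) * r ^ (1 / 2 : ℝ) = r ^ (-(3 / 4) : ℝ) := by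
    rw [← rpow_add hρ]
    norm_num
  have r0 : 0 ≤ r ^ (0 - 1 - 1 / 4 : ℝ) := rpow_nonneg hρ.le _
  refine (norm_clm_sub_le _ _ _ _).trans ?_
  calc _ ≤ A * (2 * L * |δ|) * (r ^ (0 - 1 - 1 / 4 : ℝ) + r ^ (0 - 1 - 1 / 4 : ℝ)) *
        (B * r ^ (1 / 2 : ℝ)) + A' * r ^ (-(3 / 4) : ℝ) * (2 * m) := by
        gcongr
        refine f1.trans ?_
        gcongr
    _ = 4 * A * L * B * |δ| * (r ^ (0 - 1 - 1 / 4 : ℝ) * r ^ (1 / 2 : ℝ)) +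
        2 * A' * m * r ^ (-(3 / 4) : ℝ) := by ring
    _ = _ := by rw [er]; ring

/-- The non-cancelling estimate first gives exponent `1/2`. Then, for a fixed shift `δ`, the
increments `p (Γ + δ) - p Γ` form a family indexed by `Γ`, to which `sup_gronwall` applies. -/
theorem SpatialDeriv.lipschitz (h : CurveFlow univ 𝔻 circleDist pr K T L z v)
    (hK : ∀ n, Symb pr n 1 K) {p : ℝ → ℝ → E} (hp : SpatialDeriv univ 𝔻 K T z v p)
    {B₀ : ℝ} (hB₀ : 0 ≤ B₀) (hb₀ : ∀ Γ, ‖p 0 Γ‖ ≤ B₀)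
    (hl₀ : ∀ Γ Γ', ‖p 0 Γ - p 0 Γ'‖ ≤ B₀ * |Γ - Γ'|) :
    ∃ C, 0 ≤ C ∧ ∀ t ∈ Icc (-T) T, ∀ Γ Γ', ‖p t Γ - p t Γ'‖ ≤ C * |Γ - Γ'| ∧
      ‖tangentOp K 𝔻 (z t) Γ (p t Γ) - tangentOp K 𝔻 (z t) Γ' (p t Γ')‖ ≤ C * |Γ - Γ'| := by
  have hT := h.nonneg
  obtain ⟨B, hB, HB⟩ := hp.norm_le paramDomain_circle h hK hB₀ fun Γ _ => hb₀ Γ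
  obtain ⟨B₁, hB₁, HB₁⟩ : ∃ B₁, 0 ≤ B₁ ∧ ∀ t ∈ Icc (-T) T, ∀ Γ Γ',
      ‖p t Γ - p t Γ'‖ ≤ B₁ * |Γ - Γ'| ^ (1 / 2 : ℝ) := by
    obtain ⟨B₁, hB₁, HB₁⟩ := hp.norm_sub_le paramDomain_circle h hK hB₀ (fun Γ _ => hb₀ Γ)
      (β := 1 / 2) (by norm_num) (by norm_num)
    refine ⟨B₁ * (2 * B₀ + 1), by positivity, fun t ht Γ Γ' =>
      (HB₁ t ht Γ trivial Γ' trivial).trans ?_⟩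
    rw [mul_assoc]
    refine mul_le_mul_of_nonneg_left ?_ hB₁
    rw [add_mul, one_mul]
    refine add_le_add ?_ le_rfl
    rcases le_total |Γ - Γ'| 1 with h1 | h1
    · have := rpow_le_rpow_of_exponent_ge' (abs_nonneg (Γ - Γ')) h1 (by norm_num : (0 : ℝ) ≤ 1 / 2)
        (by norm_num : (1 / 2 : ℝ) ≤ 1)
      rw [rpow_one] at this
      have h2 := hl₀ Γ Γ'
      have h3 : 0 ≤ |Γ - Γ'| ^ (1 / 2 : ℝ) := by positivity
      nlinarith
    · have h2 := one_le_rpow h1 (by norm_num : (0 : ℝ) ≤ 1 / 2)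
      have h3 := (_root_.norm_sub_le _ _).trans (add_le_add (hb₀ Γ) (hb₀ Γ'))
      nlinarith
  have hc : ∀ t ∈ Icc (-T) T, Continuous (p t) := fun t ht => by
    rw [← continuousOn_univ]
    refine continuousOn_of_norm_sub_le (g := fun _ => (0 : ℝ)) (C := B₁) continuousOn_const
      fun Γ _ Γ' _ => ?_
    rw [sub_self, norm_zero, zero_add]
    exact HB₁ t ht Γ Γ'
  obtain ⟨C, hC, HC⟩ := hp.norm_shift_le h hK hc hB₁ HB₁
  have key : ∀ δ Γ : ℝ, ∀ t ∈ Icc (-T) T, ‖p t (Γ + δ) - p t Γ‖ ≤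
      2 * (B₀ * |δ| + C * |δ| * (2 * T)) * exp (2 * C * (2 * T)) := by
    intro δ
    refine sup_gronwall (f := fun Γ t => p t (Γ + δ) - p t Γ) h.zero_mem hC (by positivity)
      (fun Γ t ht => (hp.deriv t ht (Γ + δ) trivial).sub (hp.deriv t ht Γ trivial))
      (B := B + B) (fun Γ t ht => (_root_.norm_sub_le _ _).trans
        (add_le_add (HB t ht _ trivial) (HB t ht _ trivial))) (fun Γ => ?_)
      (fun t ht m hm Γ => HC t ht δ m hm Γ)
    have := hl₀ (Γ + δ) Γ
    rwa [add_sub_cancel_left] at this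
  set Q := 2 * (B₀ + C * (2 * T)) * exp (2 * C * (2 * T)) with hQ
  have hQ0 : 0 ≤ Q := by positivity
  have key' : ∀ δ Γ : ℝ, ∀ t ∈ Icc (-T) T, ‖p t (Γ + δ) - p t Γ‖ ≤ Q * |δ| := fun δ Γ t ht =>
    (key δ Γ t ht).trans_eq (by rw [hQ]; ring)
  refine ⟨Q + (C * Q + C), by positivity, fun t ht Γ Γ' => ⟨?_, ?_⟩⟩
  · have := key' (Γ - Γ') Γ' t ht
    rw [add_sub_cancel] at this
    refine this.trans ?_
    gcongr
    have : 0 ≤ C * Q + C := by positivity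
    linarith
  · have := HC t ht (Γ - Γ') _ (fun Γ'' => key' (Γ - Γ') Γ'' t ht) Γ'
    rw [add_sub_cancel] at this
    refine this.trans ?_
    have : 0 ≤ Q * |Γ - Γ'| := by positivity
    linarith

/-- The cancellation identity exhibits the velocity of the pair as an integral of `tangentKernel K`.
The lower chord bound involves only the first component, so it is inherited. -/
theorem SpatialDeriv.curveFlow (h : CurveFlow univ 𝔻 circleDist pr K T L z v)
    (hK : ∀ n, Symb pr n 1 K) {p : ℝ → ℝ → E} (hp : SpatialDeriv univ 𝔻 K T z v p)
    {B₀ : ℝ} (hB₀ : 0 ≤ B₀) (hb₀ : ∀ Γ, ‖p 0 Γ‖ ≤ B₀)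
    (hl₀ : ∀ Γ Γ', ‖p 0 Γ - p 0 Γ'‖ ≤ B₀ * |Γ - Γ'|) :
    ∃ L', CurveFlow univ 𝔻 circleDist (pr.comp (ContinuousLinearMap.fst ℝ E E)) (tangentKernel K)
      T L' (fun t Γ => (z t Γ, p t Γ))
      (fun t Γ => (v t Γ, tangentOp K 𝔻 (z t) Γ (p t Γ))) := by
  have hL := h.pos
  obtain ⟨B, hB, HB⟩ := hp.norm_le paramDomain_circle h hK hB₀ fun Γ _ => hb₀ Γ
  obtain ⟨A, hA, HA⟩ := norm_tangentOp_le paramDomain_circle h hK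
  obtain ⟨C, hC, HC⟩ := hp.lipschitz h hK hB₀ hb₀ hl₀
  have hc : ∀ t ∈ Icc (-T) T, Continuous (p t) := fun t ht =>
    (LipschitzWith.of_dist_le_mul (K := ⟨C, hC⟩) fun Γ Γ' => by
      rw [dist_eq_norm, Real.dist_eq]
      exact (HC t ht Γ Γ').1).continuous
  have hAB : 0 ≤ A * B := by positivity
  refine ⟨L + B + A * B + C, by linarith [h.one_le], h.nonneg, fun t ht Γ hΓ =>
    (h.deriv t ht Γ hΓ).prodMk (hp.deriv t ht Γ hΓ), fun t ht Γ hΓ => ?_,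
    fun t ht Γ hΓ Γ' hΓ' => ?_, fun t ht Γ hΓ Γ' hΓ' => ?_, fun t ht Γ hΓ Γ' hΓ' => ?_,
    fun t ht Γ hΓ => ?_, fun t ht Γ hΓ => ?_⟩
  · obtain ⟨i, e⟩ := hp.tangentOp_eq h hK ht (hc t ht) Γ
    rw [h.vel t ht Γ hΓ, e]
    exact (integral_pair (h.integrable_symb paramDomain_circle (hK 1) ht hΓ) i).symm
  · refine (h.lower t ht Γ hΓ Γ' hΓ').trans ?_
    change L * ‖pr (z t Γ - z t Γ')‖ ≤ _ * ‖pr (z t Γ - z t Γ')‖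
    gcongr
    linarith
  · refine max_le ((h.upper t ht Γ hΓ Γ' hΓ').trans ?_) ?_
    · gcongr
      · exact circleDist_nonneg _ _
      · linarith
    · have := norm_sub_le_circleDist (hp.periodic h ht).1 (C := C) (β := 1)
        (fun Γ Γ' => by rw [rpow_one]; exact (HC t ht Γ Γ').1) Γ Γ'
      rw [rpow_one] at this
      refine this.trans ?_
      gcongr
      · exact circleDist_nonneg _ _
      · linarith
  · refine max_le ((h.velUpper t ht Γ hΓ Γ' hΓ').trans ?_) ?_
    · gcongr
      · exact circleDist_nonneg _ _
      · linarith
    · have := norm_sub_le_circleDist (hp.periodic h ht).2 (C := C) (β := 1)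
        (fun Γ Γ' => by rw [rpow_one]; exact (HC t ht Γ Γ').2) Γ Γ'
      rw [rpow_one] at this
      refine this.trans ?_
      gcongr
      · exact circleDist_nonneg _ _
      · linarith
  · exact max_le ((h.bound t ht Γ hΓ).trans (by linarith)) ((HB t ht Γ hΓ).trans (by linarith))
  · exact max_le ((h.velBound t ht Γ hΓ).trans (by linarith))
      ((ContinuousLinearMap.le_of_opNorm_le_of_le _ (HA t ht Γ hΓ) (HB t ht Γ hΓ)).trans
        (by linarith))

end HigherRegularity

/-- The induction ranges over all spaces and kernels because its step replaces `z` by `(z, p)` in `E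
× E`. Regularity `n + 1` of the pair gives regularity `n + 1` of `p`, hence `n + 2` of `z`. Each
step consumes one derivative of the kernel, so `K` must be a symbol for every `n`. -/
theorem CurveFlow.tReg_circle (n : ℕ) {β : ℝ} (hβ : 0 ≤ β) (hβ1 : β < 1) :
    ∀ {E : Type} [NormedAddCommGroup E] [NormedSpace ℝ E] [FiniteDimensional ℝ E]
      {pr : E →L[ℝ] Plane} {K : E → E} {T L : ℝ} {z v : ℝ → ℝ → E},
      CurveFlow univ (Ioo 0 (2 * π)) circleDist pr K T L z v → (∀ n, Symb pr n 1 K) →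
      HReg univ β (n + 1) (z 0) → TReg univ β T (n + 1) z v := by
  induction n with
  | zero =>
    intro E _ _ _ pr K T L z v h hK h0
    exact h.tReg_one paramDomain_circle hK hβ hβ1 h0
  | succ n ih =>
    intro E _ _ _ pr K T L z v h hK h0
    have h0' := h0.of_succ convex_univ hβ hβ1.le
    obtain ⟨_, z₀', hd, hr⟩ := h0
    obtain ⟨p, hp0, hp⟩ := exists_spatialDeriv paramDomain_circle h hK hd
    have hpz : p 0 = z₀' := funext fun Γ => hp0 Γ trivial
    obtain ⟨B, hB, HB⟩ := hr.bounded
    obtain ⟨B', hB', HB'⟩ := hr.lipschitz convex_univ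
    obtain ⟨L', h'⟩ := hp.curveFlow h hK (B₀ := B + B') (by positivity)
      (fun Γ => by rw [hpz]; linarith [HB Γ trivial])
      (fun Γ Γ' => by
        rw [hpz]
        refine (HB' Γ trivial Γ' trivial).trans ?_
        gcongr
        linarith)
    have := ih h' (fun m => (hK (m + 1)).tangent) (h0'.prodMk (by rw [hpz]; exact hr))
    exact ⟨h.movesContinuously paramDomain_circle hK, p, _, fun t ht Γ hΓ =>
      ⟨hp.spatial t ht Γ hΓ, hp.spatialVel t ht Γ hΓ⟩, this.clm (ContinuousLinearMap.snd ℝ E E)⟩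

end BRAlpha

end

noncomputable section

namespace BRAlpha

/-! ### The flow of a chord-arc curve -/

theorem abs_log_le {r : ℝ} (hr : 0 < r) : |log r| ≤ 2 * r ^ (-(1 / 2) : ℝ) + r := by
  have h0 : 0 < r ^ (-(1 / 2) : ℝ) := rpow_pos_of_pos hr _
  have h1 := log_le_sub_one_of_pos hr
  have h2 := log_le_sub_one_of_pos h0
  rw [log_rpow hr] at h2
  exact abs_le.2 ⟨by linarith, by linarith⟩

/-- The flow of a curve with two-sided Lipschitz bounds exists and is unique. -/
theorem exists_curveFlow {α : ℝ} (hα : 0 < α) {T : ℝ} (hT : 0 ≤ T) {J D : Set ℝ}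
    {ρ : ℝ → ℝ → ℝ} (hD : ParamDomain J D ρ) {x₀ : ℝ → Plane} {B : ℝ} (hB : 0 < B)
    (hb : ∀ Γ ∈ J, ‖x₀ Γ‖ ≤ B) (hu : ∀ Γ ∈ J, ∀ Γ' ∈ J, ‖x₀ Γ - x₀ Γ'‖ ≤ B * ρ Γ Γ')
    (hl : ∀ Γ ∈ J, ∀ Γ' ∈ J, ρ Γ Γ' ≤ B * ‖x₀ Γ - x₀ Γ'‖) :
    ∃ x v L, CurveFlow J D ρ (ContinuousLinearMap.id ℝ Plane) (kernel α) T L x v ∧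
      SolvesBR α T J D x₀ x ∧
      ∀ y, (∀ t ∈ Icc (-T) T, ContinuousOn (y t) J) → SolvesBR α T J D x₀ y →
        ∀ t ∈ Icc (-T) T, EqOn (y t) (x t) J := by
  have hJ := hD.isOpen.measurableSet
  have hemb := MeasurableEmbedding.subtype_coe hJ
  -- Curves become continuous functions on the subtype `J`, with the measure of `D` transported to
  -- it, as the flow theory requires.
  set μ : Measure J := (volume.restrict D).comap (↑) with hμ
  have hmap : μ.map ((↑) : J → ℝ) = volume.restrict D := by
    rw [hμ, map_comap_subtype_coe hJ, Measure.restrict_restrict hJ, inter_eq_right.2 hD.subset]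
  have hfin : IsFiniteMeasure μ := by
    have h1 : IsFiniteMeasure (μ.map ((↑) : J → ℝ)) := by
      rw [hmap]
      exact ⟨by simpa using hD.finite⟩
    exact ⟨by
      have := h1.measure_univ_lt_top
      rwa [Measure.map_apply measurable_subtype_coe MeasurableSet.univ] at this⟩
  have hcont : ContinuousOn x₀ J := by
    refine LipschitzOnWith.continuousOn (K := ⟨B, hB.le⟩)
      (LipschitzOnWith.of_dist_le_mul fun Γ hΓ Γ' hΓ' => ?_)
    rw [dist_eq_norm, Real.dist_eq]
    exact (hu Γ hΓ Γ' hΓ').trans (mul_le_mul_of_nonneg_left (hD.le_abs _ _) hB.le)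
  set X₀ : BoundedContinuousFunction J Plane := BoundedContinuousFunction.ofNormedAddCommGroup
    (fun Γ : J => x₀ Γ) (continuousOn_iff_continuous_domRestrict.1 hcont) B (fun Γ => hb Γ Γ.2) with hX₀
  have hX₀' : ∀ Γ : J, X₀ Γ = x₀ Γ := fun Γ => rfl
  obtain ⟨C, hC, HC⟩ := hD.integrable (1 / 2) (by norm_num) (by norm_num)
  -- By `abs_log_le` the logarithm of a chord is at most `2 r ^ (-1/2) + r`, and the lower bound `r
  -- ≥ ρ / B` reduces this to the integrability of `ρ ^ (-1/2)`.
  have hlog : LogIntegrable μ (2 * B ^ (1 / 2 : ℝ) * C + 2 * B * volume.real D) X₀ := by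
    intro Γ
    obtain ⟨i1, i2⟩ := HC Γ Γ.2
    have hae : ∀ᵐ Γ' : J ∂μ, 0 < ρ Γ Γ' := by
      rw [← hemb.ae_map_iff (p := fun Γ' => 0 < ρ Γ Γ'), hmap]
      exact hD.ae_pos Γ Γ.2
    have hae' : ∀ᵐ Γ' : J ∂μ, X₀ Γ ≠ X₀ Γ' := by
      filter_upwards [hae] with Γ' h h0
      have := hl Γ Γ.2 Γ' Γ'.2
      rw [hX₀', hX₀'] at h0
      rw [h0, sub_self, norm_zero, mul_zero] at this
      linarith
    have i3 : Integrable (fun Γ' : J => 2 * B ^ (1 / 2 : ℝ) * ρ Γ Γ' ^ (-(1 / 2) : ℝ) + 2 * B) μ := by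
      refine Integrable.add (Integrable.const_mul ?_ _) (integrable_const _)
      rw [IntegrableOn, ← hmap] at i1
      exact hemb.integrable_map_iff.1 i1
    have hle : ∀ᵐ Γ' : J ∂μ, ‖|log ‖X₀ Γ - X₀ Γ'‖|‖ ≤
        2 * B ^ (1 / 2 : ℝ) * ρ Γ Γ' ^ (-(1 / 2) : ℝ) + 2 * B := by
      filter_upwards [hae, hae'] with Γ' h h'
      rw [norm_eq_abs, abs_abs]
      have hr : 0 < ‖X₀ Γ - X₀ Γ'‖ := norm_pos_iff.2 (sub_ne_zero.2 h')
      refine (abs_log_le hr).trans (add_le_add ?_ ?_)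
      · rw [mul_assoc]
        refine mul_le_mul_of_nonneg_left ?_ zero_le_two
        calc ‖X₀ Γ - X₀ Γ'‖ ^ (-(1 / 2) : ℝ) ≤ (ρ Γ Γ' / B) ^ (-(1 / 2) : ℝ) := by
              apply rpow_le_rpow_of_nonpos (by positivity) _ (by norm_num)
              rw [div_le_iff₀' hB]
              exact hl Γ Γ.2 Γ' Γ'.2
          _ = _ := by rw [div_rpow h.le hB.le, rpow_neg hB.le]; field_simp
      · have n1 : ‖X₀ Γ‖ ≤ B := hb Γ Γ.2
        have n2 : ‖X₀ Γ'‖ ≤ B := hb Γ' Γ'.2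
        exact (norm_sub_le _ _).trans (by linarith)
    refine ⟨hae', Integrable.mono' i3 ?_ hle, ?_⟩
    · exact (continuous_const.sub X₀.continuous).norm.measurable.log.abs.aestronglyMeasurable
    · refine (le_abs_self _).trans ((norm_integral_le_of_norm_le i3 hle).trans ?_)
      have e := hemb.integral_map (μ := μ)
        (fun Γ' => 2 * B ^ (1 / 2 : ℝ) * ρ Γ Γ' ^ (-(1 / 2) : ℝ) + 2 * B)
      have : IsFiniteMeasure (volume.restrict D) := ⟨by simpa using hD.finite⟩
      rw [← e, hmap, integral_add (i1.const_mul _) (integrable_const _), integral_const_mul,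
        setIntegral_const, smul_eq_mul, mul_comm (volume.real D)]
      gcongr
  obtain ⟨X, hX, A, hA, hbi⟩ := exists_isFlow hα hT X₀ hlog
  obtain ⟨Λ, hΛ, HΛ⟩ := IsFlow.ellIntegrable hα hT hlog
  have hell := HΛ 0 X le_rfl hX
  obtain ⟨C₁, hC₁, H₁⟩ := EllIntegrable.norm_velocity_sub_le (μ := μ) hα
  obtain ⟨C₂, hC₂, H₂⟩ := norm_truncKernel_le hα
  obtain ⟨C₃, hC₃, H₃⟩ := IsFlow.norm_sub_le (μ := μ) hα
  have hker : truncKernel α 0 = kernel α := funext (truncKernel_zero hα)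
  have hvel : ∀ y : ℝ → Plane, ∀ Γ : J, velocity (truncKernel α 0) μ (fun Γ' : J => y Γ') Γ =
      ∫ Γ' in D, kernel α (y Γ - y Γ') := by
    intro y Γ
    rw [hker, ← hmap, hemb.integral_map]
    rfl
  set x : ℝ → ℝ → Plane := fun t Γ => by classical exact if h : Γ ∈ J then X t ⟨Γ, h⟩ else 0 with hx
  have hxX : ∀ t (Γ : J), x t Γ = X t Γ := fun t Γ => by simp [hx]
  have hxX' : ∀ t, X t = fun Γ : J => x t Γ := fun t => funext fun Γ => (hxX t Γ).symm
  set v : ℝ → ℝ → Plane := fun t Γ => ∫ Γ' in D, kernel α (x t Γ - x t Γ') with hv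
  have hvX : ∀ t (Γ : J), velocity (truncKernel α 0) μ (X t) Γ = v t Γ := fun t Γ => by
    rw [hxX', hvel]
  have hderiv : ∀ t ∈ Icc (-T) T, ∀ Γ ∈ J,
      HasDerivWithinAt (fun s => x s Γ) (v t Γ) (Icc (-T) T) t := fun t ht Γ hΓ => by
    have := hX.2.2 ⟨Γ, hΓ⟩ t ht
    rw [hvX] at this
    simpa only [hxX'] using this
  refine ⟨x, v, 1 + A * B + B + C₁ * Λ * (A * B) + C₃ * T + C₂ * μ.real univ,
    ⟨?_, hT, hderiv, fun t _ Γ _ => rfl, fun t ht Γ hΓ Γ' hΓ' => ?_, fun t ht Γ hΓ Γ' hΓ' => ?_,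
      fun t ht Γ hΓ Γ' hΓ' => ?_, fun t ht Γ hΓ => ?_, fun t ht Γ hΓ => ?_⟩,
    ⟨hderiv, fun Γ hΓ => ?_⟩, fun y hyc hy t ht Γ hΓ => ?_⟩
  all_goals
    have q1 : 0 ≤ A * B := by positivity
    have q2 : 0 ≤ C₁ * Λ * (A * B) := by positivity
    have q3 : 0 ≤ C₃ * T := by positivity
    have q4 : 0 ≤ C₂ * μ.real univ := by positivity
  · linarith
  · have h1 := (hbi t ht ⟨Γ, hΓ⟩ ⟨Γ', hΓ'⟩).2
    simp only [hxX', hX₀'] at h1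
    rw [ContinuousLinearMap.id_apply]
    calc ρ Γ Γ' ≤ B * ‖x₀ Γ - x₀ Γ'‖ := hl Γ hΓ Γ' hΓ'
      _ ≤ B * (A * ‖x t Γ - x t Γ'‖) := by gcongr
      _ = (A * B) * ‖x t Γ - x t Γ'‖ := by ring
      _ ≤ _ := by
        gcongr
        linarith
  · have h1 := (hbi t ht ⟨Γ, hΓ⟩ ⟨Γ', hΓ'⟩).1
    simp only [hxX', hX₀'] at h1
    have h2 := hD.nonneg Γ Γ'
    calc ‖x t Γ - x t Γ'‖ ≤ A * (B * ρ Γ Γ') := h1.trans (by gcongr; exact hu Γ hΓ Γ' hΓ')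
      _ = (A * B) * ρ Γ Γ' := by ring
      _ ≤ _ := by
        gcongr
        linarith
  · have h1 := (hbi t ht ⟨Γ, hΓ⟩ ⟨Γ', hΓ'⟩).1
    have h3 := H₁ 0 Λ (X t) le_rfl (hX.1 t ht) (hell t ht) ⟨Γ, hΓ⟩ ⟨Γ', hΓ'⟩
    rw [hvX, hvX] at h3
    simp only [hX₀'] at h1
    have h2 := hD.nonneg Γ Γ'
    calc ‖v t Γ - v t Γ'‖ ≤ C₁ * Λ * (A * (B * ρ Γ Γ')) := h3.trans (by
          gcongr
          exact h1.trans (by gcongr; exact hu Γ hΓ Γ' hΓ'))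
      _ = (C₁ * Λ * (A * B)) * ρ Γ Γ' := by ring
      _ ≤ _ := by
        gcongr
        linarith
  · have h1 := H₃ 0 T X₀ X le_rfl hT hX t ht ⟨Γ, hΓ⟩
    simp only [hxX', hX₀'] at h1
    have h2 := norm_le_norm_add_norm_sub' (x t Γ) (x₀ Γ)
    linarith [hb Γ hΓ]
  · have h1 := norm_velocity_le (μ := μ) (H₂ 0 le_rfl) (X t) ⟨Γ, hΓ⟩
    rw [hvX] at h1
    linarith
  · have := congrFun hX.2.1 ⟨Γ, hΓ⟩
    rw [hX₀', hxX'] at this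
    exact this
  -- Every solution that is continuous in the parameter is a flow, so uniqueness asks for no further
  -- regularity.
  · have hY : IsFlow α μ 0 T X₀ (fun t (Γ : J) => y t Γ) := by
      refine ⟨fun t ht => continuousOn_iff_continuous_domRestrict.1 (hyc t ht),
        funext fun Γ => hy.2 Γ.2, fun Γ t ht => ?_⟩
      rw [hvel]
      exact hy.1 t ht Γ Γ.2
    have := congrFun (IsFlow.unique hα hT hΛ hX hY hell t ht) ⟨Γ, hΓ⟩
    rw [hxX'] at this
    exact this

end BRAlpha

end

noncomputable section

namespace BRAlpha

/-! ### Norms of curves -/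

section Norms

variable {J : Set ℝ} {β : ℝ≥0} {T : ℝ}

theorem holderNorm_congr {n : ℕ} {f g : ℝ → Plane} (h : EqOn f g J) :
    holderNorm n β J f = holderNorm n β J g := by
  have hk : ∀ k, EqOn (iteratedDerivWithin k f J) (iteratedDerivWithin k g J) J := fun k =>
    iteratedDerivWithin_congr h
  have h1 : J.domRestrict (iteratedDerivWithin n f J) = J.domRestrict (iteratedDerivWithin n g J) :=
    funext fun Γ => hk n Γ.2
  rw [holderNorm, holderNorm, h1, cNorm, cNorm]
  congr 1
  refine Finset.sum_congr rfl fun k _ => iSup_congr fun Γ => iSup_congr fun hΓ => ?_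
  rw [hk k hΓ]

theorem holderNorm_succ {n : ℕ} {f : ℝ → Plane} :
    holderNorm (n + 1) β J f =
      (⨆ Γ ∈ J, ‖f Γ‖ₑ) + holderNorm n β J (derivWithin f J) := by
  rw [holderNorm, holderNorm, cNorm, cNorm, Finset.sum_range_succ', add_comm _ (iSup _), add_assoc]
  simp only [iteratedDerivWithin_succ', iteratedDerivWithin_zero]

theorem cNorm_le_holderNorm {n : ℕ} {f : ℝ → Plane} : cNorm n J f ≤ holderNorm n β J f :=
  le_self_add

/-- Quantitative version of `HReg`. -/
def HBound (J : Set ℝ) (β A : ℝ) : ℕ → (ℝ → Plane) → Prop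
  | 0, f => (∀ Γ ∈ J, ‖f Γ‖ ≤ A) ∧ ∀ Γ ∈ J, ∀ Γ' ∈ J, ‖f Γ - f Γ'‖ ≤ A * |Γ - Γ'| ^ β
  | n + 1, f => (∀ Γ ∈ J, ‖f Γ‖ ≤ A) ∧
      ∃ f' : ℝ → Plane, (∀ Γ ∈ J, HasDerivAt f (f' Γ) Γ) ∧ HBound J β A n f'

theorem iSup_enorm_le {f : ℝ → Plane} {A : ℝ} (h : ∀ Γ ∈ J, ‖f Γ‖ ≤ A) :
    ⨆ Γ ∈ J, ‖f Γ‖ₑ ≤ ENNReal.ofReal A :=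
  iSup₂_le fun Γ hΓ => by
    rw [← ofReal_norm]
    exact ENNReal.ofReal_le_ofReal (h Γ hΓ)

/-- There are `n + 1` suprema and one Hölder seminorm, each at most `A`. -/
theorem HBound.holderNorm_le (hJ : IsOpen J) {A : ℝ} {n : ℕ} {f : ℝ → Plane}
    (h : HBound J β A n f) : holderNorm n β J f ≤ (n + 2) * ENNReal.ofReal A := by
  induction n generalizing f with
  | zero =>
    have h1 : eHolderNorm β (J.domRestrict (iteratedDerivWithin 0 f J)) ≤ ENNReal.ofReal A := by
      refine HolderWith.eHolderNorm_le fun Γ Γ' => ?_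
      rcases J.eq_empty_or_nonempty with rfl | ⟨Γ₀, h₀⟩
      · exact Γ.2.elim
      have hA : 0 ≤ A := (norm_nonneg _).trans (h.1 Γ₀ h₀)
      simp only [domRestrict_apply, iteratedDerivWithin_zero]
      rw [edist_dist, edist_dist, Subtype.dist_eq, dist_eq_norm, Real.dist_eq,
        ENNReal.ofReal_rpow_of_nonneg (abs_nonneg _) β.coe_nonneg]
      change _ ≤ ENNReal.ofReal A * _
      rw [← ENNReal.ofReal_mul hA]
      exact ENNReal.ofReal_le_ofReal (h.2 Γ Γ.2 Γ' Γ'.2)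
    rw [holderNorm, cNorm, zero_add, Finset.sum_range_one, iteratedDerivWithin_zero]
    rw [iteratedDerivWithin_zero] at h1
    refine (add_le_add (iSup_enorm_le h.1) h1).trans_eq ?_
    push_cast
    ring
  | succ n ih =>
    obtain ⟨hb, f', hd, hf'⟩ := h
    have e : EqOn (derivWithin f J) f' J := fun Γ hΓ => by
      rw [derivWithin_of_isOpen hJ hΓ, (hd Γ hΓ).deriv]
    rw [holderNorm_succ, holderNorm_congr e]
    refine (add_le_add (iSup_enorm_le hb) (ih hf')).trans_eq ?_
    push_cast
    ring

theorem HReg.contDiffOn (hJ : IsOpen J) {b : ℝ} {n : ℕ} {f : ℝ → Plane} (h : HReg J b n f) :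
    ContDiffOn ℝ n f J := by
  induction n generalizing f with
  | zero => exact contDiffOn_zero.2 h.1
  | succ n ih =>
    obtain ⟨_, f', hd, hf'⟩ := h
    rw [Nat.cast_succ, contDiffOn_succ_iff_deriv_of_isOpen hJ]
    refine ⟨fun Γ hΓ => (hd Γ hΓ).differentiableAt.differentiableWithinAt, by simp,
      (ih hf').congr fun Γ hΓ => (hd Γ hΓ).deriv⟩

theorem HReg.exists_hBound {b : ℝ} {n : ℕ} {f : ℝ → Plane} (h : HReg J b n f) :
    ∃ A, ∀ A' ≥ A, HBound J b A' n f := by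
  induction n generalizing f with
  | zero =>
    obtain ⟨_, C, hC, hb, hh⟩ := h
    exact ⟨C, fun A' hA' => ⟨fun Γ hΓ => (hb Γ hΓ).trans hA', fun Γ hΓ Γ' hΓ' =>
      (hh Γ hΓ Γ' hΓ').trans (by gcongr)⟩⟩
  | succ n ih =>
    obtain ⟨⟨C, hb⟩, f', hd, hf'⟩ := h
    obtain ⟨A, hA⟩ := ih hf'
    exact ⟨max C A, fun A' hA' => ⟨fun Γ hΓ => (hb Γ hΓ).trans ((le_max_left _ _).trans hA'), f',
      hd, hA A' ((le_max_right _ _).trans hA')⟩⟩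

theorem HReg.mem_holderSpace (hJ : IsOpen J) {n : ℕ} {f : ℝ → Plane} (h : HReg J β n f) :
    f ∈ holderSpace n β J := by
  obtain ⟨A, hA⟩ := h.exists_hBound
  refine ⟨h.contDiffOn hJ, ((hA A le_rfl).holderNorm_le hJ).trans_lt ?_⟩
  exact ENNReal.mul_lt_top (by finiteness) ENNReal.ofReal_lt_top

theorem exists_bound_of_iSup_lt_top {f : ℝ → Plane} (h : ⨆ Γ ∈ J, ‖f Γ‖ₑ < ⊤) :
    ∃ C, 0 ≤ C ∧ ∀ Γ ∈ J, ‖f Γ‖ ≤ C := by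
  refine ⟨(⨆ Γ ∈ J, ‖f Γ‖ₑ).toReal, ENNReal.toReal_nonneg, fun Γ hΓ => ?_⟩
  rw [← toReal_enorm]
  exact ENNReal.toReal_mono h.ne (le_iSup₂ (f := fun Γ (_ : Γ ∈ J) => ‖f Γ‖ₑ) Γ hΓ)

theorem hReg_of_mem_holderSpace (hJ : IsOpen J) {n : ℕ} {f : ℝ → Plane}
    (h : f ∈ holderSpace n β J) : HReg J β n f := by
  induction n generalizing f with
  | zero =>
    obtain ⟨hc, hn⟩ := h
    rw [holderNorm, cNorm, zero_add, Finset.sum_range_one, iteratedDerivWithin_zero,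
      ENNReal.add_lt_top] at hn
    obtain ⟨C, hC, hb⟩ := exists_bound_of_iSup_lt_top hn.1
    obtain ⟨C', hC'⟩ := eHolderNorm_lt_top.1 hn.2
    refine ⟨hc.continuousOn, C + C', by positivity, fun Γ hΓ => (hb Γ hΓ).trans (by simp),
      fun Γ hΓ Γ' hΓ' => ?_⟩
    have := hC'.dist_le ⟨Γ, hΓ⟩ ⟨Γ', hΓ'⟩
    rw [Subtype.dist_eq, dist_eq_norm, Real.dist_eq] at this
    exact this.trans (by gcongr; linarith)
  | succ n ih =>
    obtain ⟨hc, hn⟩ := h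
    rw [holderNorm_succ, ENNReal.add_lt_top] at hn
    obtain ⟨C, hC, hb⟩ := exists_bound_of_iSup_lt_top hn.1
    rw [Nat.cast_succ, contDiffOn_succ_iff_deriv_of_isOpen hJ] at hc
    have e : EqOn (derivWithin f J) (deriv f) J := fun Γ hΓ => derivWithin_of_isOpen hJ hΓ
    rw [holderNorm_congr e] at hn
    exact ⟨⟨C, hb⟩, deriv f, fun Γ hΓ =>
      ((hc.1 Γ hΓ).differentiableAt (hJ.mem_nhds hΓ)).hasDerivAt, ih ⟨hc.2.2, hn.2⟩⟩

/-! ### Continuously differentiable families of curves -/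

/-- Mean value inequality for `w r - r • w' t` on the part of `I` close to `t`. It reduces the
convergence of difference quotients, in every seminorm needed, to the continuity of the velocity. -/
theorem norm_slope_sub_le {F : Type} [NormedAddCommGroup F] [NormedSpace ℝ F] {w w' : ℝ → F}
    {I : Set ℝ} (hI : Convex ℝ I) (hd : ∀ r ∈ I, HasDerivWithinAt w (w' r) I r) {t s δ ε : ℝ}
    (ht : t ∈ I) (hs : s ∈ I) (hst : |s - t| < δ) (hne : s ≠ t)
    (h : ∀ r ∈ I, |r - t| < δ → ‖w' r - w' t‖ ≤ ε) :
    ‖(s - t)⁻¹ • (w s - w t) - w' t‖ ≤ ε := by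
  have hδ : 0 < δ := (abs_nonneg _).trans_lt hst
  have hst' : 0 < |s - t| := abs_pos.2 (sub_ne_zero.2 hne)
  have := (hI.inter (convex_ball t δ)).norm_image_sub_le_of_norm_hasDerivWithin_le
    (f := fun r => w r - r • w' t) (f' := fun r => w' r - (1 : ℝ) • w' t) (C := ε) (x := t) (y := s)
    (fun r hr => ((hd r hr.1).sub ((hasDerivWithinAt_id r I).smul_const (w' t))).mono
      inter_subset_left) (fun r hr => by rw [one_smul]; exact h r hr.1 hr.2)
    ⟨ht, Metric.mem_ball_self hδ⟩ ⟨hs, hst⟩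
  have e : (s - t)⁻¹ • (w s - w t) - w' t =
      (s - t)⁻¹ • ((w s - s • w' t) - (w t - t • w' t)) := by
    have h1 : w s - s • w' t - (w t - t • w' t) = (w s - w t) - (s - t) • w' t := by
      rw [sub_smul]
      abel
    rw [h1, smul_sub _ (w s - w t), inv_smul_smul₀ (sub_ne_zero.2 hne)]
  rw [e, norm_smul, norm_inv, Real.norm_eq_abs, inv_mul_le_iff₀ hst', mul_comm]
  exact this

theorem exists_delta_rpow {C θ ε : ℝ} (hC : 0 ≤ C) (hθ : 0 < θ) (hε : 0 < ε) :
    ∃ δ > 0, ∀ x : ℝ, |x| < δ → C * |x| ^ θ ≤ ε := by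
  refine ⟨(ε / (C + 1)) ^ θ⁻¹, by positivity, fun x hx => ?_⟩
  have h1 : |x| ^ θ ≤ ε / (C + 1) := by
    calc |x| ^ θ ≤ ((ε / (C + 1)) ^ θ⁻¹) ^ θ := by gcongr
      _ = _ := by rw [← rpow_mul (by positivity), inv_mul_cancel₀ hθ.ne', rpow_one]
  calc C * |x| ^ θ ≤ (C + 1) * (ε / (C + 1)) := by gcongr; linarith
    _ = ε := by field_simp

theorem TReg.exists_delta {b : ℝ} {n : ℕ} {z v : ℝ → ℝ → Plane} (h : TReg J b T n z v) {t ε : ℝ}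
    (ht : t ∈ Icc (-T) T) (hε : 0 < ε) : ∃ δ > 0, ∀ s ∈ Icc (-T) T, |s - t| < δ →
      HBound J b ε n (fun Γ => v s Γ - v t Γ) ∧
      (s ≠ t → HBound J b ε n (fun Γ => (s - t)⁻¹ • (z s Γ - z t Γ) - v t Γ)) := by
  have hI : Convex ℝ (Icc (-T) T) := convex_Icc _ _
  have base : ∀ {z v : ℝ → ℝ → Plane}, MovesContinuously J T z v →
      ∃ δ > 0, ∀ s ∈ Icc (-T) T, |s - t| < δ → ∀ Γ ∈ J, ‖v s Γ - v t Γ‖ ≤ ε ∧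
        (s ≠ t → ‖(s - t)⁻¹ • (z s Γ - z t Γ) - v t Γ‖ ≤ ε) := by
    rintro z v ⟨hd, C, θ, hC, hθ, _, hv⟩
    obtain ⟨δ, hδ, H⟩ := exists_delta_rpow hC hθ hε
    have hv' : ∀ Γ ∈ J, ∀ r ∈ Icc (-T) T, |r - t| < δ → ‖v r Γ - v t Γ‖ ≤ ε :=
      fun Γ hΓ r hr hrt => (hv r hr t ht Γ hΓ).trans (H _ hrt)
    exact ⟨δ, hδ, fun s hs hst Γ hΓ => ⟨hv' Γ hΓ s hs hst, fun hne =>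
      norm_slope_sub_le hI (fun r hr => hd r hr Γ hΓ) ht hs hst hne (hv' Γ hΓ)⟩⟩
  induction n generalizing z v with
  | zero =>
    obtain ⟨hm, _, C, θ, hC, hθ, hv⟩ := h
    obtain ⟨δ₁, hδ₁, H₁⟩ := base hm
    obtain ⟨δ₂, hδ₂, H₂⟩ := exists_delta_rpow hC hθ hε
    have hv' : ∀ Γ ∈ J, ∀ Γ' ∈ J, ∀ r ∈ Icc (-T) T, |r - t| < δ₂ →
        ‖(v r Γ - v r Γ') - (v t Γ - v t Γ')‖ ≤ ε * |Γ - Γ'| ^ b := fun Γ hΓ Γ' hΓ' r hr hrt => by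
      rw [sub_sub_sub_comm]
      exact (hv r hr t ht Γ hΓ Γ' hΓ').trans (by gcongr; exact H₂ _ hrt)
    refine ⟨min δ₁ δ₂, lt_min hδ₁ hδ₂, fun s hs hst => ?_⟩
    have hst₁ := hst.trans_le (min_le_left _ _)
    have hst₂ := hst.trans_le (min_le_right _ _)
    refine ⟨⟨fun Γ hΓ => (H₁ s hs hst₁ Γ hΓ).1, fun Γ hΓ Γ' hΓ' => ?_⟩, fun hne =>
      ⟨fun Γ hΓ => (H₁ s hs hst₁ Γ hΓ).2 hne, fun Γ hΓ Γ' hΓ' => ?_⟩⟩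
    · rw [sub_sub_sub_comm]
      exact hv' Γ hΓ Γ' hΓ' s hs hst₂
    -- The Hölder seminorm of the difference quotient is that of the chord, so the same estimate is
    -- applied to `z r Γ - z r Γ'`.
    · have := norm_slope_sub_le (w := fun r => z r Γ - z r Γ') (w' := fun r => v r Γ - v r Γ') hI
        (fun r hr => (hm.1 r hr Γ hΓ).sub (hm.1 r hr Γ' hΓ')) ht hs hst₂ hne (hv' Γ hΓ Γ' hΓ')
      have e : (s - t)⁻¹ • (z s Γ - z t Γ) - v t Γ - ((s - t)⁻¹ • (z s Γ' - z t Γ') - v t Γ') =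
          (s - t)⁻¹ • (z s Γ - z s Γ' - (z t Γ - z t Γ')) - (v t Γ - v t Γ') := by
        simp only [smul_sub]
        abel
      rw [e]
      exact this
  | succ n ih =>
    obtain ⟨hm, z', v', hd, h'⟩ := h
    obtain ⟨δ₁, hδ₁, H₁⟩ := base hm
    obtain ⟨δ₂, hδ₂, H₂⟩ := ih h'
    refine ⟨min δ₁ δ₂, lt_min hδ₁ hδ₂, fun s hs hst => ?_⟩
    have hst₁ := hst.trans_le (min_le_left _ _)
    have hst₂ := hst.trans_le (min_le_right _ _)
    exact ⟨⟨fun Γ hΓ => (H₁ s hs hst₁ Γ hΓ).1, _, fun Γ hΓ => (hd s hs Γ hΓ).2.sub (hd t ht Γ hΓ).2,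
      (H₂ s hs hst₂).1⟩, fun hne => ⟨fun Γ hΓ => (H₁ s hs hst₁ Γ hΓ).2 hne,
      fun Γ => (s - t)⁻¹ • (z' s Γ - z' t Γ) - v' t Γ, fun Γ hΓ =>
      (((hd s hs Γ hΓ).1.sub (hd t ht Γ hΓ).1).const_smul (s - t)⁻¹).sub (hd t ht Γ hΓ).2,
      (H₂ s hs hst₂).2 hne⟩⟩

theorem TReg.tendsto (hJ : IsOpen J) {n : ℕ} {z v : ℝ → ℝ → Plane} (h : TReg J β T n z v) {t : ℝ}
    (ht : t ∈ Icc (-T) T) :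
    Tendsto (fun s => holderNorm n β J (fun Γ => (s - t)⁻¹ • (z s Γ - z t Γ) - v t Γ))
      (𝓝[Icc (-T) T \ {t}] t) (𝓝 0) ∧
    Tendsto (fun s => holderNorm n β J (fun Γ => v s Γ - v t Γ)) (𝓝[Icc (-T) T] t) (𝓝 0) := by
  have key : ∀ ε : ℝ≥0∞, 0 < ε → ∃ δ > 0, ∀ s ∈ Icc (-T) T, |s - t| < δ →
      holderNorm n β J (fun Γ => v s Γ - v t Γ) ≤ ε ∧ (s ≠ t →
      holderNorm n β J (fun Γ => (s - t)⁻¹ • (z s Γ - z t Γ) - v t Γ) ≤ ε) := by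
    intro ε hε
    obtain ⟨ε', hε', hle⟩ : ∃ ε' : ℝ, 0 < ε' ∧ ((n : ℝ≥0∞) + 2) * ENNReal.ofReal ε' ≤ ε := by
      obtain ⟨e, he, hle⟩ := ENNReal.lt_iff_exists_nnreal_btwn.1 hε
      refine ⟨e / (n + 2), div_pos (by exact_mod_cast he) (by positivity), le_trans (le_of_eq ?_)
        hle.le⟩
      rw [← ENNReal.ofReal_coe_nnreal, show ((n : ℝ≥0∞) + 2) = ENNReal.ofReal (n + 2) by
        rw [ENNReal.ofReal_add (by positivity) (by positivity)]; simp,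
        ← ENNReal.ofReal_mul (by positivity)]
      congr 1
      field_simp
    obtain ⟨δ, hδ, H⟩ := h.exists_delta ht hε'
    exact ⟨δ, hδ, fun s hs hst => ⟨((H s hs hst).1.holderNorm_le hJ).trans hle, fun hne =>
      (((H s hs hst).2 hne).holderNorm_le hJ).trans hle⟩⟩
  refine ⟨ENNReal.tendsto_nhds_zero.2 fun ε hε => ?_, ENNReal.tendsto_nhds_zero.2 fun ε hε => ?_⟩
  all_goals
    obtain ⟨δ, hδ, H⟩ := key ε hε
    filter_upwards [self_mem_nhdsWithin, nhdsWithin_le_nhds (Metric.ball_mem_nhds t hδ)] with s hs hst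
  · exact (H s hs.1 hst).2 hs.2
  · exact (H s hs hst).1

theorem TReg.isC1Into (hJ : IsOpen J) {n : ℕ} {z v : ℝ → ℝ → Plane} (h : TReg J β T n z v) :
    IsC1Into (holderSpace n β J) (fun _ : Unit => holderNorm n β J) (Icc (-T) T) z :=
  ⟨fun _ ht => (h.hReg ht).1.mem_holderSpace hJ, v, fun _ ht => (h.hReg ht).2.mem_holderSpace hJ,
    fun _ ht _ => h.tendsto hJ ht⟩

end Norms

end BRAlpha

end

noncomputable section

namespace BRAlpha

/-! ### Chord-arc constants -/

theorem dist_le_of_le_edist_div {X Y : Type*} [MetricSpace X] [PseudoMetricSpace Y] {p q : X}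
    {a b : Y} {c : ℝ≥0} (hpq : p ≠ q) (h : (c : ℝ≥0∞) ≤ edist a b / edist p q) :
    c * dist p q ≤ dist a b := by
  rw [ENNReal.le_div_iff_mul_le (Or.inl (edist_pos.2 hpq).ne') (Or.inl (edist_ne_top _ _)),
    edist_nndist, edist_nndist] at h
  exact_mod_cast h

theorem le_edist_div_of_dist_le {X Y : Type*} [MetricSpace X] [PseudoMetricSpace Y] {p q : X}
    {a b : Y} {L : ℝ} (hL : 0 < L) (hpq : p ≠ q) (h : dist p q ≤ L * dist a b) :
    ENNReal.ofReal L⁻¹ ≤ edist a b / edist p q := by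
  rw [ENNReal.le_div_iff_mul_le (Or.inl (edist_pos.2 hpq).ne') (Or.inl (edist_ne_top _ _)),
    edist_dist, edist_dist, ← ENNReal.ofReal_mul (by positivity)]
  exact ENNReal.ofReal_le_ofReal (by rwa [inv_mul_le_iff₀ hL])

theorem exists_le_of_chordArc_pos {J : Set ℝ} {x : ℝ → Plane} (h : 0 < chordArc J x) :
    ∃ B : ℝ, 0 < B ∧ ∀ Γ ∈ J, ∀ Γ' ∈ J, |Γ - Γ'| ≤ B * ‖x Γ - x Γ'‖ := by
  obtain ⟨c, hc, hle⟩ := ENNReal.lt_iff_exists_nnreal_btwn.1 h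
  have hc0 : (0 : ℝ) < c := by exact_mod_cast hc
  refine ⟨(c : ℝ)⁻¹, by positivity, fun Γ hΓ Γ' hΓ' => ?_⟩
  rcases eq_or_ne Γ Γ' with rfl | hne
  · simp
  have h1 : (c : ℝ≥0∞) ≤ edist (x Γ) (x Γ') / edist Γ Γ' :=
    hle.le.trans (iInf_le_of_le Γ (iInf_le_of_le hΓ (iInf_le_of_le Γ' (iInf_le_of_le hΓ'
      (iInf_le _ hne)))))
  have h2 := dist_le_of_le_edist_div hne h1
  rw [Real.dist_eq, dist_eq_norm] at h2
  rwa [le_inv_mul_iff₀ hc0]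

theorem chordArc_pos {J : Set ℝ} {x : ℝ → Plane} {L : ℝ} (hL : 0 < L)
    (h : ∀ Γ ∈ J, ∀ Γ' ∈ J, |Γ - Γ'| ≤ L * ‖x Γ - x Γ'‖) : 0 < chordArc J x := by
  refine (ENNReal.ofReal_pos.2 (inv_pos.2 hL)).trans_le ?_
  refine le_iInf fun Γ => le_iInf fun hΓ => le_iInf fun Γ' => le_iInf fun hΓ' => le_iInf fun hne =>
    le_edist_div_of_dist_le hL hne ?_
  rw [Real.dist_eq, dist_eq_norm]
  exact h Γ hΓ Γ' hΓ'

theorem dist_coe_eq_circleDist (Γ Γ' : ℝ) :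
    dist (Γ : AddCircle (2 * π)) (Γ' : AddCircle (2 * π)) = circleDist Γ Γ' := by
  rw [dist_eq_norm, circleDist, AddCircle.coe_sub]

theorem exists_le_of_chordArcCircle_pos {x : ℝ → Plane} (h : 0 < chordArcCircle x) :
    ∃ B : ℝ, 0 < B ∧ ∀ Γ Γ', circleDist Γ Γ' ≤ B * ‖x Γ - x Γ'‖ := by
  obtain ⟨c, hc, hle⟩ := ENNReal.lt_iff_exists_nnreal_btwn.1 h
  have hc0 : (0 : ℝ) < c := by exact_mod_cast hc
  refine ⟨(c : ℝ)⁻¹, by positivity, fun Γ Γ' => ?_⟩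
  by_cases hne : (Γ : AddCircle (2 * π)) = Γ'
  · rw [← dist_coe_eq_circleDist, hne, dist_self]
    positivity
  have h1 : (c : ℝ≥0∞) ≤ edist (x Γ) (x Γ') /
      edist (Γ : AddCircle (2 * π)) (Γ' : AddCircle (2 * π)) :=
    hle.le.trans (iInf_le_of_le Γ (iInf_le_of_le Γ' (iInf_le _ hne)))
  have h2 := dist_le_of_le_edist_div hne h1
  rw [dist_coe_eq_circleDist, dist_eq_norm] at h2
  rwa [le_inv_mul_iff₀ hc0]

theorem chordArcCircle_pos {x : ℝ → Plane} {L : ℝ} (hL : 0 < L)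
    (h : ∀ Γ Γ', circleDist Γ Γ' ≤ L * ‖x Γ - x Γ'‖) : 0 < chordArcCircle x := by
  refine (ENNReal.ofReal_pos.2 (inv_pos.2 hL)).trans_le ?_
  refine le_iInf fun Γ => le_iInf fun Γ' => le_iInf fun hne => le_edist_div_of_dist_le hL hne ?_
  rw [dist_coe_eq_circleDist, dist_eq_norm]
  exact h Γ Γ'

/-! ### Global well-posedness -/

theorem exists_isSolution_Ioo {α : ℝ} (hα : 0 < α) {Γ₀ Γ₁ : ℝ} {n : ℕ} {β : ℝ≥0}
    (hn : (n = 1 ∧ β < 1) ∨ (n = 0 ∧ β = 1)) {x₀ : ℝ → Plane}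
    (hx₀ : x₀ ∈ holderSpace n β (Ioo Γ₀ Γ₁)) (hc : 0 < chordArc (Ioo Γ₀ Γ₁) x₀) {T : ℝ}
    (hT : 0 < T) :
    ∃ x, IsSolution α Γ₀ Γ₁ n β T x₀ x ∧ ∀ y, IsSolution α Γ₀ Γ₁ n β T x₀ y →
      ∀ t ∈ Icc (-T) T, EqOn (y t) (x t) (Ioo Γ₀ Γ₁) := by
  set J := Ioo Γ₀ Γ₁ with hJ
  have hr : HReg J β n x₀ := hReg_of_mem_holderSpace isOpen_Ioo hx₀
  obtain ⟨B₁, hB₁, hb⟩ := hr.bounded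
  obtain ⟨B₂, hB₂, hu⟩ : ∃ C, 0 ≤ C ∧ ∀ Γ ∈ J, ∀ Γ' ∈ J, ‖x₀ Γ - x₀ Γ'‖ ≤ C * |Γ - Γ'| := by
    rcases hn with ⟨rfl, _⟩ | ⟨rfl, rfl⟩
    · exact hr.lipschitz (convex_Ioo _ _)
    · obtain ⟨_, C, hC, _, h⟩ := hr
      exact ⟨C, hC, by simpa using h⟩
  obtain ⟨B₃, hB₃, hl⟩ := exists_le_of_chordArc_pos hc
  obtain ⟨x, v, L, hflow, hsol, huniq⟩ := exists_curveFlow hα hT.le (paramDomain_Ioo Γ₀ Γ₁)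
    (B := B₁ + B₂ + B₃) (by positivity) (fun Γ hΓ => (hb Γ hΓ).trans (by linarith))
    (fun Γ hΓ Γ' hΓ' => (hu Γ hΓ Γ' hΓ').trans (by gcongr; linarith))
    (fun Γ hΓ Γ' hΓ' => (hl Γ hΓ Γ' hΓ').trans (by gcongr; linarith))
  have hreg : TReg J β T n x v := by
    rcases hn with ⟨rfl, hβ⟩ | ⟨rfl, rfl⟩
    · refine hflow.tReg_one (paramDomain_Ioo Γ₀ Γ₁) (symb_kernel hα) β.coe_nonneg
        (by exact_mod_cast hβ) ?_
      obtain ⟨⟨C, hC⟩, f', hd, hf'⟩ := hr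
      refine ⟨⟨C, fun Γ hΓ => ?_⟩, f', fun Γ hΓ => ?_, hf'⟩
      · rw [hsol.2 hΓ]
        exact hC Γ hΓ
      · exact (hd Γ hΓ).congr_of_eventuallyEq
          (hsol.2.eventuallyEq_of_mem (isOpen_Ioo.mem_nhds hΓ))
    · simpa using hflow.tReg_zero (paramDomain_Ioo Γ₀ Γ₁) (symb_kernel hα)
  refine ⟨x, ⟨hreg.isC1Into isOpen_Ioo, fun t ht => chordArc_pos hflow.pos (hflow.lower t ht),
    hsol⟩, fun y hy t ht => huniq y (fun t ht => (hy.1.1 t ht).1.continuousOn) hy.2.2 t ht⟩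

/-- Initial values on the circle which are Lipschitz and chord-arc have a unique flow. -/
theorem exists_curveFlow_circle {α : ℝ} (hα : 0 < α) {x₀ : ℝ → Plane} {b : ℝ}
    (hper : Function.Periodic x₀ (2 * π)) (hr : HReg univ b 1 x₀) (hc : 0 < chordArcCircle x₀)
    {T : ℝ} (hT : 0 < T) :
    ∃ x v L, CurveFlow univ (Ioo 0 (2 * π)) circleDist (ContinuousLinearMap.id ℝ Plane) (kernel α)
      T L x v ∧ x 0 = x₀ ∧ SolvesBR α T univ (Ioo 0 (2 * π)) x₀ x ∧
      (∀ t ∈ Icc (-T) T, 0 < chordArcCircle (x t)) ∧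
      ∀ (n : ℕ) (β : ℝ≥0) (y : ℝ → ℝ → Plane), IsClosedSolution α n β T x₀ y →
        ∀ t ∈ Icc (-T) T, y t = x t := by
  obtain ⟨B₁, hB₁, hb⟩ := hr.bounded
  obtain ⟨B₂, hB₂, hu⟩ := hr.lipschitz convex_univ
  obtain ⟨B₃, hB₃, hl⟩ := exists_le_of_chordArcCircle_pos hc
  have hu' : ∀ Γ Γ', ‖x₀ Γ - x₀ Γ'‖ ≤ B₂ * circleDist Γ Γ' := fun Γ Γ' => by
    have := norm_sub_le_circleDist hper (C := B₂) (β := 1)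
      (fun Γ Γ' => by rw [rpow_one]; exact hu Γ trivial Γ' trivial) Γ Γ'
    rwa [rpow_one] at this
  obtain ⟨x, v, L, hflow, hsol, huniq⟩ := exists_curveFlow hα hT.le paramDomain_circle
    (B := B₁ + B₂ + B₃) (by positivity) (fun Γ hΓ => (hb Γ hΓ).trans (by linarith))
    (fun Γ _ Γ' _ => (hu' Γ Γ').trans (mul_le_mul_of_nonneg_right (by linarith)
      (circleDist_nonneg _ _)))
    (fun Γ _ Γ' _ => (hl Γ Γ').trans (by gcongr; linarith))
  exact ⟨x, v, L, hflow, funext fun Γ => hsol.2 trivial, hsol, fun t ht =>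
    chordArcCircle_pos hflow.pos fun Γ Γ' => hflow.lower t ht Γ trivial Γ' trivial,
    fun n β y hy t ht => funext fun Γ =>
      huniq y (fun t ht => (hy.1.1 t ht).2.1.continuousOn) hy.2.2 t ht trivial⟩

theorem TReg.isC1Into_circle {α T L : ℝ} {n : ℕ} {β : ℝ≥0} {x v : ℝ → ℝ → Plane}
    (h : TReg univ β T n x v)
    (hflow : CurveFlow univ (Ioo 0 (2 * π)) circleDist (ContinuousLinearMap.id ℝ Plane) (kernel α)
      T L x v) :
    IsC1Into (holderSpaceCircle n β) (fun _ : Unit => holderNorm n β univ) (Icc (-T) T) x :=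
  ⟨fun _ ht => ⟨(hflow.periodic ht).1, (h.hReg ht).1.mem_holderSpace isOpen_univ⟩, v,
    fun _ ht => ⟨(hflow.periodic ht).2, (h.hReg ht).2.mem_holderSpace isOpen_univ⟩,
    fun _ ht _ => h.tendsto isOpen_univ ht⟩

theorem exists_isClosedSolution {α : ℝ} (hα : 0 < α) {n : ℕ} {β : ℝ≥0} (hn : 1 ≤ n)
    (hβ : β < 1) {x₀ : ℝ → Plane} (hx₀ : x₀ ∈ holderSpaceCircle n β) (hc : 0 < chordArcCircle x₀)
    {T : ℝ} (hT : 0 < T) :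
    ∃ x, IsClosedSolution α n β T x₀ x ∧ ∀ y, IsClosedSolution α n β T x₀ y →
      ∀ t ∈ Icc (-T) T, y t = x t := by
  obtain ⟨n, rfl⟩ := Nat.exists_eq_add_of_le' hn
  have hβ1 : (β : ℝ) < 1 := by exact_mod_cast hβ
  have hr : HReg univ β (n + 1) x₀ := hReg_of_mem_holderSpace isOpen_univ hx₀.2
  have hr1 : HReg univ β 1 x₀ := by
    clear hx₀ hn
    induction n with
    | zero => exact hr
    | succ n ih => exact ih (hr.of_succ convex_univ β.coe_nonneg hβ1.le)
  obtain ⟨x, v, L, hflow, h0, hsol, hch, huniq⟩ := exists_curveFlow_circle hα hx₀.1 hr1 hc hT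
  have hreg := CurveFlow.tReg_circle n β.coe_nonneg hβ1 hflow (symb_kernel hα) (h0 ▸ hr)
  exact ⟨x, ⟨hreg.isC1Into_circle hflow, hch, hsol⟩, huniq _ _⟩

theorem exists_bound_of_periodic {f : ℝ → Plane} (hper : Function.Periodic f (2 * π))
    (hf : Continuous f) : ∃ C, 0 ≤ C ∧ ∀ Γ, ‖f Γ‖ ≤ C := by
  obtain ⟨C, hC⟩ := isCompact_Icc.exists_bound_of_continuousOn (s := Icc 0 (0 + 2 * π))
    hf.continuousOn
  refine ⟨max C 0, le_max_right _ _, fun Γ => ?_⟩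
  obtain ⟨y, hy, e⟩ := hper.exists_mem_Ico₀ (by positivity) Γ
  rw [e]
  exact (hC y ⟨hy.1, by linarith [hy.2]⟩).trans (le_max_left _ _)

theorem hReg_of_mem_smoothSpaceCircle {x : ℝ → Plane} (h : x ∈ smoothSpaceCircle) {β : ℝ}
    (hβ : 0 ≤ β) (hβ1 : β ≤ 1) (n : ℕ) : HReg univ β n x := by
  -- With exponent 0 only boundedness of the derivatives is needed; one further derivative is then
  -- exchanged for the exponent `β`.
  have key : ∀ (n : ℕ) (f : ℝ → Plane), f ∈ smoothSpaceCircle → HReg univ 0 n f := by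
    intro n
    induction n with
    | zero =>
      intro f hf
      obtain ⟨C, hC, hb⟩ := exists_bound_of_periodic hf.1 hf.2.continuous
      refine ⟨hf.2.continuous.continuousOn, C + C, by positivity, fun Γ _ =>
        (hb Γ).trans (by linarith), fun Γ _ Γ' _ => ?_⟩
      rw [rpow_zero, mul_one]
      exact (norm_sub_le _ _).trans (add_le_add (hb Γ) (hb Γ'))
    | succ n ih =>
      intro f hf
      obtain ⟨C, hC, hb⟩ := exists_bound_of_periodic hf.1 hf.2.continuous
      have hd : ∀ Γ, HasDerivAt f (deriv f Γ) Γ := fun Γ =>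
        ((hf.2.differentiable (by simp)) Γ).hasDerivAt
      exact ⟨⟨C, fun Γ _ => hb Γ⟩, deriv f, fun Γ _ => hd Γ, ih _ ⟨periodic_of_hasDerivAt hf.1 hd,
        (contDiff_infty_iff_deriv.1 hf.2).2⟩⟩
  exact (key (n + 1) x h).of_succ convex_univ hβ hβ1

theorem exists_isSmoothClosedSolution {α : ℝ} (hα : 0 < α) {x₀ : ℝ → Plane}
    (hx₀ : x₀ ∈ smoothSpaceCircle) (hc : 0 < chordArcCircle x₀) {T : ℝ} (hT : 0 < T) :
    ∃ x, IsSmoothClosedSolution α T x₀ x ∧ ∀ (n : ℕ) (β : ℝ≥0), 1 ≤ n → 0 < β → β < 1 →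
      IsClosedSolution α n β T x₀ x ∧ ∀ y, IsClosedSolution α n β T x₀ y →
        ∀ t ∈ Icc (-T) T, y t = x t := by
  have hr := fun (n : ℕ) (β : ℝ≥0) (hβ : (β : ℝ) < 1) =>
    hReg_of_mem_smoothSpaceCircle hx₀ β.coe_nonneg hβ.le n
  obtain ⟨x, v, L, hflow, h0, hsol, hch, huniq⟩ :=
    exists_curveFlow_circle hα hx₀.1 (hr 1 0 (by simp)) hc hT
  have hreg : ∀ (n : ℕ) (β : ℝ≥0), (β : ℝ) < 1 → TReg univ β T (n + 1) x v := fun n β hβ =>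
    CurveFlow.tReg_circle n β.coe_nonneg hβ hflow (symb_kernel hα) (h0 ▸ hr (n + 1) β hβ)
  have hreg0 : ∀ n : ℕ, TReg univ ((0 : ℝ≥0) : ℝ) T (n + 1) x v := fun n => hreg n 0 (by simp)
  have hsm : ∀ f : ℝ → Plane, (∀ n : ℕ, HReg univ ((0 : ℝ≥0) : ℝ) (n + 1) f) →
      ContDiff ℝ ((⊤ : ℕ∞) : WithTop ℕ∞) f := fun f hf =>
    contDiff_infty.2 fun n => ((contDiffOn_univ.1 ((hf n).contDiffOn isOpen_univ))).of_le
      (by exact_mod_cast Nat.le_succ n)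
  refine ⟨x, ⟨⟨fun t ht => ⟨(hflow.periodic ht).1, hsm _ fun n => ((hreg0 n).hReg ht).1⟩, v,
    fun t ht => ⟨(hflow.periodic ht).2, hsm _ fun n => ((hreg0 n).hReg ht).2⟩,
    fun t ht k => ?_⟩, hch, hsol⟩, fun n β hn _ hβ => ?_⟩
  -- The seminorm of order `k` is dominated by the Hölder norm of order `k + 1` with exponent 0, for
  -- which convergence in time is already known.
  · have hle : ∀ f : ℝ → Plane, cNorm k univ f ≤ holderNorm (k + 1) 0 univ f := fun f =>
      (Finset.sum_le_sum_of_subset (Finset.range_mono (by omega))).trans cNorm_le_holderNorm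
    obtain ⟨h1, h2⟩ := (hreg0 k).tendsto isOpen_univ ht
    exact ⟨tendsto_of_tendsto_of_tendsto_of_le_of_le tendsto_const_nhds h1 (fun _ => zero_le)
      fun _ => hle _, tendsto_of_tendsto_of_tendsto_of_le_of_le tendsto_const_nhds h2
      (fun _ => zero_le) fun _ => hle _⟩
  · obtain ⟨n, rfl⟩ := Nat.exists_eq_add_of_le' hn
    exact ⟨⟨(hreg n β (by exact_mod_cast hβ)).isC1Into_circle hflow, hch, hsol⟩, huniq _ _⟩

end BRAlpha

end

theorem mainTheorem2 (α : ℝ) (hα : 0 < α) :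
    -- curves parametrized by an interval, in `C^{1,β}`, `0 ≤ β < 1`, or in `Lip = C^{0,1}`
    (∀ Γ₀ Γ₁ : ℝ, Γ₀ < Γ₁ →
      ∀ (n : ℕ) (β : ℝ≥0), ((n = 1 ∧ β < 1) ∨ (n = 0 ∧ β = 1)) →
      ∀ x₀ ∈ BRAlpha.holderSpace n β (Ioo Γ₀ Γ₁), 0 < BRAlpha.chordArc (Ioo Γ₀ Γ₁) x₀ →
      ∀ T : ℝ, 0 < T →
        ∃ x : ℝ → ℝ → BRAlpha.Plane, BRAlpha.IsSolution α Γ₀ Γ₁ n β T x₀ x ∧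
          ∀ y : ℝ → ℝ → BRAlpha.Plane, BRAlpha.IsSolution α Γ₀ Γ₁ n β T x₀ y →
            ∀ t ∈ Icc (-T) T, EqOn (y t) (x t) (Ioo Γ₀ Γ₁)) ∧
    -- closed curves in `C^{n,β}(S¹)`
    (∀ (n : ℕ) (β : ℝ≥0), 1 ≤ n → 0 < β → β < 1 →
      ∀ x₀ ∈ BRAlpha.holderSpaceCircle n β, 0 < BRAlpha.chordArcCircle x₀ →
      ∀ T : ℝ, 0 < T →
        ∃ x : ℝ → ℝ → BRAlpha.Plane, BRAlpha.IsClosedSolution α n β T x₀ x ∧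
          ∀ y : ℝ → ℝ → BRAlpha.Plane, BRAlpha.IsClosedSolution α n β T x₀ y →
            ∀ t ∈ Icc (-T) T, y t = x t) ∧
    -- closed curves in `C^∞(S¹)`: the solution is one into `C^∞(S¹)`
    (∀ x₀ ∈ BRAlpha.smoothSpaceCircle, 0 < BRAlpha.chordArcCircle x₀ →
      ∀ T : ℝ, 0 < T →
        ∃ x : ℝ → ℝ → BRAlpha.Plane, BRAlpha.IsSmoothClosedSolution α T x₀ x ∧
          ∀ (n : ℕ) (β : ℝ≥0), 1 ≤ n → 0 < β → β < 1 →
            BRAlpha.IsClosedSolution α n β T x₀ x ∧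
            ∀ y : ℝ → ℝ → BRAlpha.Plane, BRAlpha.IsClosedSolution α n β T x₀ y →
              ∀ t ∈ Icc (-T) T, y t = x t) := by
  refine ⟨fun Γ₀ Γ₁ _ n β hn x₀ hx₀ hc T hT => BRAlpha.exists_isSolution_Ioo hα hn hx₀ hc hT,
    fun n β hn _ hβ x₀ hx₀ hc T hT => BRAlpha.exists_isClosedSolution hα hn hβ hx₀ hc hT,
    fun x₀ hx₀ hc T hT => BRAlpha.exists_isSmoothClosedSolution hα hx₀ hc hT⟩
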